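/- Let $\mathbf P$ be the set of primes and $e(t)=e^{2\pi i t}$. For $q\in\mathbb N=\{1,2,\dots\}$ put $$c_q=\frac{2^{2q+2}+2^q-2}{2^{2q+2}+2^q-3}.$$ For $c\in[1,2)$ let $\mathcal F_c$ be the family of all functions $h:[x_0,\infty)\to[1,\infty)$ (for some $x_0\ge 1$) such that: (i) $h\in C^\infty([x_0,\infty))$ and $h'(x)>0$, $h''(x)>0$ for every $x\ge x_0$; (ii) there are a real function $\vartheta\in C^\infty([x_0,\infty))$ and a constant $C_h>0$ with $$h(x)=C_h\,x^c\exp\Big(\int_{x_0}^x\frac{\vartheta(t)}{t}\,dt\Big)\qquad(x\ge x_0),$$ and, if $c>1$, then $\lim_{x\to\infty}\vartheta(x)=0$ and $\lim_{x\to\infty}x^n\vartheta^{(n)}(x)=0$ for every integer $n\ge1$; (iii) if $c=1$, then $\vartheta$ is positive and non-increasing on $[x_0,\infty)$, for every $\varepsilon>0$ there is $C_\varepsilon>0$ with $1/\vartheta(x)\le C_\varepsilon x^\varepsilon$ for all $x\ge x_0$, $\lim_{x\to\infty}x/h(x)=0$, $\lim_{x\to\infty}\vartheta(x)=0$, and $\lim_{x\to\infty}x^n\vartheta^{(n)}(x)/\vartheta(x)=0$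 for every integer $n\ge1$. (Derivatives at the left endpoint of an interval are one-sided.) For $h\in\mathcal F_c$ let $\varphi:[h(x_0),\infty)\to[x_0,\infty)$ be the inverse function of $h$, let $\mathbf P_h=\{p\in\mathbf P:\ p=\lfloor h(n)\rfloor\text{ for some }n\in\mathbb N,\ n\ge x_0\}$, and for $N\in\mathbb N$ let $\mathbf P_{h,N}=\mathbf P_h\cap[1,N]$. **Lemma.** Let $q\in\mathbb N$ and let $W:\mathbb Z\to\mathbb Z$ be a polynomial of degree $q$ (integer-valued, with rational coefficients). Let $c\in[1,c_q)$, $\gamma=1/c$, $h\in\mathcal F_c$ with inverse $\varphi$, and let $\chi>0$ satisfy $$(2^{2q+2}+2^q-2)(1-\gamma)+2^q(2^{q+3}-2)\chi<1.$$ Then there exist $\chi'>0$ and $C>0$ such that for every $N\in\mathbb N$ and every $\xi\in[0,1]$ $$\Big|\sum_{\substack{p\in\mathbf P_{h,N}\\ p\ge h(x_0)}}\varphi'(p)^{-1}\log p\; e(\xi W(p))-\sum_{\substack{p\in\mathbf P\\ p\le N}}\log p\; e(\xi W(p))\Big|\le C\,N^{1-\chi-\chi'}.$$ (The condition $p\ge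 h(x_0)$ only says that $\varphi'(p)$ is defined; it leaves out at most one prime, $p=\lfloor h(x_0)\rfloor$.) -/

import Mathlib

noncomputable section

open scoped ContDiff

namespace ThinPrimes

/-- The logarithmic derivative correction `ϑ` of a function in `𝓕_c`: a function that is smooth on
`[x₀, ∞)` and obeys the decay conditions attached to the exponent `c`.  All derivatives are taken
within `[x₀, ∞)` (one-sided at `x₀`). -/
structure IsCorrection (c x₀ : ℝ) (ϑ : ℝ → ℝ) : Prop where
  smooth : ContDiffOn ℝ ∞ ϑ (Set.Ici x₀)
  tendsto_zero : Filter.Tendsto ϑ Filter.atTop (nhds 0)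
  /-- If `c > 1`, then `x ^ n * ϑ⁽ⁿ⁾(x) → 0` for every `n ≥ 1`. -/
  deriv_of_one_lt : 1 < c → ∀ n : ℕ, 1 ≤ n →
    Filter.Tendsto (fun x => x ^ n * iteratedDerivWithin n ϑ (Set.Ici x₀) x)
      Filter.atTop (nhds 0)
  pos_of_eq_one : c = 1 → ∀ x, x₀ ≤ x → 0 < ϑ x
  antitone_of_eq_one : c = 1 → AntitoneOn ϑ (Set.Ici x₀)
  inv_le_of_eq_one : c = 1 → ∀ ε : ℝ, 0 < ε →
    ∃ C : ℝ, 0 < C ∧ ∀ x, x₀ ≤ x → 1 / ϑ x ≤ C * x ^ ε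
  /-- If `c = 1`, then `x ^ n * ϑ⁽ⁿ⁾(x) / ϑ(x) → 0` for every `n ≥ 1`. -/
  deriv_of_eq_one : c = 1 → ∀ n : ℕ, 1 ≤ n →
    Filter.Tendsto (fun x => x ^ n * iteratedDerivWithin n ϑ (Set.Ici x₀) x / ϑ x)
      Filter.atTop (nhds 0)

/-- `MemF c x₀ h`: the restriction of `h` to `[x₀, ∞)` is a member of the family `𝓕_c`.
Values of `h` to the left of `x₀` play no role. -/
structure MemF (c x₀ : ℝ) (h : ℝ → ℝ) : Prop where
  one_le_c : 1 ≤ c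
  c_lt_two : c < 2
  one_le_x₀ : 1 ≤ x₀
  one_le : ∀ x, x₀ ≤ x → 1 ≤ h x
  smooth : ContDiffOn ℝ ∞ h (Set.Ici x₀)
  deriv_pos : ∀ x, x₀ ≤ x → 0 < derivWithin h (Set.Ici x₀) x
  deriv_two_pos : ∀ x, x₀ ≤ x → 0 < iteratedDerivWithin 2 h (Set.Ici x₀) x
  /-- `h(x) = C_h x ^ c exp (∫_{x₀}^x ϑ(t) / t dt)`. -/
  exists_correction : ∃ (ϑ : ℝ → ℝ) (C : ℝ), IsCorrection c x₀ ϑ ∧ 0 < C ∧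
    ∀ x, x₀ ≤ x → h x = C * x ^ c * Real.exp (∫ t in x₀..x, ϑ t / t)
  div_tendsto_of_eq_one : c = 1 →
    Filter.Tendsto (fun x => x / h x) Filter.atTop (nhds 0)

/-- `φ : [h(x₀), ∞) → [x₀, ∞)` is the inverse function of `h : [x₀, ∞) → [h(x₀), ∞)`. -/
def IsInverse (x₀ : ℝ) (h φ : ℝ → ℝ) : Prop :=
  Set.MapsTo φ (Set.Ici (h x₀)) (Set.Ici x₀) ∧
    Set.InvOn φ h (Set.Ici x₀) (Set.Ici (h x₀))

/-- `𝐏_h`: the primes `p = ⌊h(n)⌋` with `n` a natural number in the domain `[x₀, ∞)` of `h`. -/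
def primesOf (x₀ : ℝ) (h : ℝ → ℝ) : Set ℕ :=
  {p | p.Prime ∧ ∃ n : ℕ, x₀ ≤ (n : ℝ) ∧ (p : ℤ) = ⌊h n⌋}

/-- `W : ℤ → ℤ` is an (integer-valued) polynomial of degree `q`. -/
def IsIntPolynomial (W : ℤ → ℤ) (q : ℕ) : Prop :=
  ∃ P : Polynomial ℚ, P.degree = q ∧ ∀ n : ℤ, P.eval (n : ℚ) = (W n : ℚ)

/-- `e(t) = exp (2 π i t)`. -/
def e (t : ℝ) : ℂ := Complex.exp (2 * Real.pi * Complex.I * t)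

open Classical in
/-- `∑_{p ∈ 𝐏_h, p ≤ N} φ'(p)⁻¹ log p e(ξ W(p))`, the sum being over those `p` that lie in the
domain `[h(x₀), ∞)` of `φ`, i.e. for which `φ'(p)` makes sense (this leaves out at most the single
value `p = ⌊h(x₀)⌋`, when `h(x₀)` is not an integer). -/
def thinSum (x₀ : ℝ) (h φ : ℝ → ℝ) (W : ℤ → ℤ) (N : ℕ) (ξ : ℝ) : ℂ :=
  ∑ p ∈ (Finset.Icc 1 N).filter (fun p : ℕ => p ∈ primesOf x₀ h ∧ h x₀ ≤ (p : ℝ)),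
    (((derivWithin φ (Set.Ici (h x₀)) (p : ℝ))⁻¹ * Real.log p : ℝ) : ℂ) * e (ξ * (W p : ℝ))

/-- `∑_{p ≤ N} log p e(ξ W(p))` over the primes `p`. -/
def primeSum (W : ℤ → ℤ) (N : ℕ) (ξ : ℝ) : ℂ :=
  ∑ p ∈ (Finset.Icc 1 N).filter Nat.Prime, ((Real.log p : ℝ) : ℂ) * e (ξ * (W p : ℝ))

/-- `c_q = (2^(2q+2) + 2^q - 2) / (2^(2q+2) + 2^q - 3)`. -/
def cBound (q : ℕ) : ℝ :=
  ((2 : ℝ) ^ (2 * q + 2) + 2 ^ q - 2) / ((2 : ℝ) ^ (2 * q + 2) + 2 ^ q - 3)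

end ThinPrimes

end

/-! Put a = 1 - 1/c. A prime p ≥ h(x₀) belongs to 𝐏_h exactly when [φ(p), φ(p+1)) contains an
integer. For large p this interval is shorter than 1, so the indicator equals φ(p+1) - φ(p) plus the
sawtooth difference {-φ(p+1)} - {-φ(p)} (`indicator_exists_natCast_eq`). Divided by φ'(p), the
smooth part is 1 + O(1/p) and reproduces the sum over all primes. It remains to save slightly more
than X^χ in the sawtooth part over each dyadic block (X, 2X].

The sawtooth is replaced by its Fourier polynomial of length M, about X^(a+χ), with an error
majorised by Fejér kernels. Partial summation then removes the weights 1/φ' (`norm_sawtoothSum_le`).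
This leaves the sums of Λ(n) e(±mφ(n) + ξW(n)) and of e(mφ(n)) for 1 ≤ m ≤ M, where a saving of a
little more than X^(a+2χ) is needed. As W has degree q, derivatives of order above q do not see ξW,
so the estimates depend on φ alone and are uniform in ξ.

Vaughan's identity with parameter H reduces the sum over Λ to sums of e(g(nk)) and, after
Cauchy-Schwarz, of e(g(nk₁) - g(nk₂)). Differencing q times brings these to the Kusmin-Landau
inequality (`weyl_van_der_corput`, `van_der_corput`). The outcome (`norm_vonMangoldtSum_le`) is a
saving of √H, up to divisor and logarithmic factors, provided that (HV + 1/V) H^(2^q) is a little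
smaller than √X, where V = mΦ(X) measures the derivatives of mφ. With H near X^(2(a+2χ)) and V at
most about X^χ, the requirement becomes (2^q+1)·2(a+2χ) + χ < 1/2, which follows from the hypothesis
on χ.

The derivatives of φ are controlled in `MemF.exists_inverseData`: for k ≥ 2, y^k φ⁽ᵏ⁾(y) is
asymptotic to a nonzero constant times φ(y)σ(y), where σ = 1 if c > 1 and σ = ϑ∘φ if c = 1. The
extra factor is essential for c = 1, because there y²φ''/φ tends to 0. -/

noncomputable section
open Finset
namespace ThinPrimes

/-! ### Additive characters, the Kusmin-Landau inequality and Weyl differencing. -/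

lemma e_add (s t : ℝ) : e (s + t) = e s * e t := by
  simp only [e, ← Complex.exp_add]; congr 1; push_cast; ring

lemma norm_e (t : ℝ) : ‖e t‖ = 1 := by
  rw [e, show (2 * Real.pi * Complex.I * t : ℂ) = ((2 * Real.pi * t : ℝ) : ℂ) * Complex.I by
    push_cast; ring]
  exact Complex.norm_exp_ofReal_mul_I _

lemma e_zero : e 0 = 1 := by simp [e]

lemma e_neg (t : ℝ) : e (-t) = (starRingEnd ℂ) (e t) := by
  simp only [e, ← Complex.exp_conj]; congr 1; simp [map_ofNat]

lemma e_sub (s t : ℝ) : e (s - t) = e s * (starRingEnd ℂ) (e t) := by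
  rw [sub_eq_add_neg, e_add, e_neg]

lemma e_int (n : ℤ) : e n = 1 := by
  rw [e, Complex.exp_eq_one_iff]; exact ⟨n, by push_cast; ring⟩

lemma e_add_int (t : ℝ) (n : ℤ) : e (t + n) = e t := by
  rw [e_add, e_int, mul_one]

lemma norm_e_sub_one (t : ℝ) : ‖e t - 1‖ = 2 * |Real.sin (Real.pi * t)| := by
  have := Complex.norm_exp_I_mul_ofReal_sub_one (2 * Real.pi * t)
  rw [show e t = Complex.exp (Complex.I * ((2 * Real.pi * t : ℝ) : ℂ)) by
    rw [e]; congr 1; push_cast; ring, this, norm_mul, Real.norm_eq_abs, Real.norm_eq_abs]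
  rw [show 2 * Real.pi * t / 2 = Real.pi * t by ring]; norm_num

lemma norm_e_sub_one_le (t : ℝ) : ‖e t - 1‖ ≤ 2 * Real.pi * |t| := by
  rw [norm_e_sub_one]
  have := Real.abs_sin_le_abs (x := Real.pi * t)
  rw [abs_mul, abs_of_pos Real.pi_pos] at this
  linarith

lemma norm_e_sub_e_le (s t : ℝ) : ‖e s - e t‖ ≤ 2 * Real.pi * |s - t| := by
  have : e s - e t = e t * (e (s - t) - 1) := by
    rw [mul_sub, ← e_add]; simp
  rw [this, norm_mul, norm_e, one_mul]
  exact norm_e_sub_one_le _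

lemma le_norm_e_sub_one {t : ℝ} (h0 : 0 ≤ t) (h1 : t ≤ 1 / 2) : 4 * t ≤ ‖e t - 1‖ := by
  rw [norm_e_sub_one]
  have h := Real.mul_le_sin (x := Real.pi * t) (by positivity) (by nlinarith [Real.pi_pos])
  have h2 : 2 / Real.pi * (Real.pi * t) = 2 * t := by field_simp
  rw [h2] at h
  have := le_abs_self (Real.sin (Real.pi * t))
  linarith

/-- With g(n) = 1/(e(f(n+1) - f(n)) - 1) one has e(f(n)) = (e(f(n+1)) - e(f(n))) g(n). Summation by
parts leaves two boundary terms of size 1/θ and the variation of g, which the second differences of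
f control. -/
lemma kusmin_landau (f : ℕ → ℝ) (a b : ℕ) (hab : a ≤ b) {θ κ : ℝ} (hθ : 0 < θ) (hκ : 0 ≤ κ)
    (h1 : ∀ n, a ≤ n → n ≤ b → θ ≤ f (n + 1) - f n ∧ f (n + 1) - f n ≤ 1 / 2)
    (h2 : ∀ n, a ≤ n → n < b → |(f (n + 2) - f (n + 1)) - (f (n + 1) - f n)| ≤ κ) :
    ‖∑ n ∈ Ico a b, e (f n)‖ ≤ 1 / (2 * θ) + (b - a : ℝ) * κ / (2 * θ ^ 2) := by
  set g : ℕ → ℂ := fun n => 1 / (e (f (n + 1) - f n) - 1) with hg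
  have hlow : ∀ n, a ≤ n → n ≤ b → 4 * θ ≤ ‖e (f (n + 1) - f n) - 1‖ := fun n hn hn' => by
    obtain ⟨h3, h4⟩ := h1 n hn hn'
    have := le_norm_e_sub_one (hθ.le.trans h3) h4
    linarith
  have hgn : ∀ n, a ≤ n → n ≤ b → ‖g n‖ ≤ 1 / (4 * θ) := fun n hn hn' => by
    rw [hg]; simp only [norm_div, norm_one]
    exact one_div_le_one_div_of_le (by positivity) (hlow n hn hn')
  have key : ∀ m, a ≤ m → m ≤ b →
      ‖∑ n ∈ Ico a m, e (f n) - (e (f m) * g m - e (f a) * g a)‖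
        ≤ (m - a : ℝ) * κ / (2 * θ ^ 2) := by
    intro m hm
    induction m, hm using Nat.le_induction with
    | base => intro _; simp
    | succ m hm ih =>
      intro hmb
      have ih := ih (by omega)
      rw [sum_Ico_succ_top hm]
      have hne : ∀ n, a ≤ n → n ≤ b → e (f (n + 1) - f n) - 1 ≠ 0 := fun n hn hn' => by
        have := hlow n hn hn'
        rw [← norm_pos_iff]; linarith
      have e1 := hne m hm (by omega)
      have e2 := hne (m + 1) (by omega) hmb
      have hs : e (f (m + 1)) = e (f m) * e (f (m + 1) - f m) := by
        rw [← e_add]; congr 1; ring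
      have hid : e (f m) + e (f m) * g m = e (f (m + 1)) * g m := by
        rw [hs, hg]; field_simp; ring
      have hgd : g m - g (m + 1) = (e (f (m + 2) - f (m + 1)) - e (f (m + 1) - f m)) *
          (g m * g (m + 1)) := by
        rw [hg]; simp only []; rw [show m + 1 + 1 = m + 2 by ring] at *; field_simp; ring
      have hgb : ‖g m - g (m + 1)‖ ≤ κ / (2 * θ ^ 2) := by
        rw [hgd, norm_mul, norm_mul]
        have t1 := (norm_e_sub_e_le (f (m + 2) - f (m + 1)) (f (m + 1) - f m)).trans
          (mul_le_mul_of_nonneg_left (h2 m hm (by omega)) (by positivity))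
        have t2 := mul_le_mul (hgn m hm (by omega)) (hgn (m + 1) (by omega) hmb) (norm_nonneg _)
          (by positivity)
        have t3 := mul_le_mul t1 t2 (by positivity) (by positivity)
        refine t3.trans ?_
        rw [div_mul_div_comm, mul_div_assoc', div_le_div_iff₀ (by positivity) (by positivity)]
        -- The product of the two bounds is 2πκ · (1/(4θ))² = πκ/(8θ²), so π ≤ 4 is enough.
        have := Real.pi_le_four
        have h5 : 0 ≤ κ * θ ^ 2 := by positivity
        nlinarith
      have : ∑ n ∈ Ico a m, e (f n) + e (f m) - (e (f (m + 1)) * g (m + 1) - e (f a) * g a)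
          = (∑ n ∈ Ico a m, e (f n) - (e (f m) * g m - e (f a) * g a))
            + e (f (m + 1)) * (g m - g (m + 1)) := by
        linear_combination hid
      rw [this]
      refine (norm_add_le _ _).trans ?_
      rw [norm_mul, norm_e, one_mul]
      refine (add_le_add ih hgb).trans (le_of_eq ?_)
      push_cast; ring
  have hk := key b hab le_rfl
  have t : ‖∑ n ∈ Ico a b, e (f n)‖ ≤ ‖∑ n ∈ Ico a b, e (f n) - (e (f b) * g b - e (f a) * g a)‖
      + ‖e (f b) * g b - e (f a) * g a‖ := by
    have := norm_add_le (∑ n ∈ Ico a b, e (f n) - (e (f b) * g b - e (f a) * g a))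
      (e (f b) * g b - e (f a) * g a)
    simpa using this
  have t2 : ‖e (f b) * g b - e (f a) * g a‖ ≤ 1 / (2 * θ) := by
    refine (norm_sub_le _ _).trans ?_
    rw [norm_mul, norm_mul, norm_e, norm_e, one_mul, one_mul]
    refine (add_le_add (hgn b hab le_rfl) (hgn a le_rfl hab)).trans (le_of_eq ?_)
    field_simp; ring
  linarith

lemma exists_slope {f f' : ℝ → ℝ} {x y : ℝ} (hxy : x < y)
    (h : ∀ t ∈ Set.Icc x y, HasDerivAt f (f' t) t) :
    ∃ t ∈ Set.Icc x y, f y - f x = f' t * (y - x) := by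
  obtain ⟨c, hc, hc'⟩ := exists_hasDerivAt_eq_slope f f' hxy
    (fun t ht => (h t ht).continuousAt.continuousWithinAt)
    (fun t ht => h t (Set.Ioo_subset_Icc_self ht))
  refine ⟨c, Set.Ioo_subset_Icc_self hc, ?_⟩
  rw [hc']; field_simp [(sub_pos.2 hxy).ne']

/-- The square is expanded and the pairs are grouped by their distance h. Pairs in the two orders
are conjugate, whence the factor 2; counting the diagonal h = 0 twice does no harm. -/
lemma norm_sq_sum_range_le (w : ℕ → ℂ) (N : ℕ) :
    ‖∑ i ∈ range N, w i‖ ^ 2 ≤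
      2 * ∑ h ∈ range N, ‖∑ i ∈ range (N - h), w (i + h) * (starRingEnd ℂ) (w i)‖ := by
  set D : ℕ → ℂ := fun N => ∑ j ∈ range N, ∑ i ∈ range (j + 1), w j * (starRingEnd ℂ) (w i) with hD
  have h1 : ∀ N, ‖∑ i ∈ range N, w i‖ ^ 2 ≤ 2 * (D N).re := by
    intro N
    have : ∀ N, ‖∑ i ∈ range N, w i‖ ^ 2 + ∑ i ∈ range N, ‖w i‖ ^ 2 = 2 * (D N).re := by
      intro N
      induction N with
      | zero => simp [hD]
      | succ N ih =>
        rw [sum_range_succ, sum_range_succ]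
        have : D (N + 1) = D N + w N * (starRingEnd ℂ) (∑ i ∈ range N, w i)
            + w N * (starRingEnd ℂ) (w N) := by
          simp only [hD]
          rw [sum_range_succ _ N, sum_range_succ _ N, map_sum, mul_sum]; ring
        rw [this, Complex.add_re, Complex.add_re, ← Complex.normSq_eq_norm_sq,
          ← Complex.normSq_eq_norm_sq, Complex.normSq_add, Complex.mul_conj]
        rw [← Complex.normSq_eq_norm_sq] at ih
        have h3 : ((∑ i ∈ range N, w i) * (starRingEnd ℂ) (w N)).re
            = (w N * (starRingEnd ℂ) (∑ i ∈ range N, w i)).re := by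
          simp only [Complex.mul_re, Complex.conj_re, Complex.conj_im]; ring
        rw [h3, Complex.ofReal_re]
        linarith
    have h4 := this N
    have : 0 ≤ ∑ i ∈ range N, ‖w i‖ ^ 2 := sum_nonneg fun _ _ => by positivity
    linarith
  have h2 : D N = ∑ h ∈ range N, ∑ i ∈ range (N - h), w (i + h) * (starRingEnd ℂ) (w i) := by
    rw [hD]
    have := sum_range_diag_flip N (fun i h => w (i + h) * (starRingEnd ℂ) (w i))
    rw [show (∑ h ∈ range N, ∑ i ∈ range (N - h), w (i + h) * (starRingEnd ℂ) (w i)) =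
      ∑ i ∈ range N, ∑ h ∈ range (N - i), w (i + h) * (starRingEnd ℂ) (w i) from
        sum_comm' (by intro x y; simp only [mem_range]; omega), ← this]
    refine sum_congr rfl fun j hj => sum_congr rfl fun i hi => ?_
    rw [Nat.add_sub_of_le (by simp at hi; omega)]
  refine (h1 N).trans ?_
  rw [h2]
  refine mul_le_mul_of_nonneg_left ?_ (by norm_num)
  refine (Complex.re_le_norm _).trans (norm_sum_le _ _)

lemma sum_Ico_one_div_le (N L : ℕ) (hNL : N ≤ L) :
    ∑ h ∈ Ico 1 N, 1 / (h : ℝ) ≤ 1 + Real.log L := by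
  have h1 := harmonic_le_one_add_log L
  refine le_trans ?_ h1
  rw [harmonic_eq_sum_Icc]
  push_cast
  simp only [one_div]
  refine sum_le_sum_of_subset_of_nonneg (fun x hx => ?_) (fun _ _ _ => by positivity)
  simp only [mem_Ico, mem_Icc] at *; omega

/-- Induction on the number of differencing steps. For q = 0 this is Kusmin-Landau, `κ * L ≤ ρ * Λ`
making the variation term comparable with 1/Λ. Differencing by h replaces (Λ, κ) by (hΛ, hκ) and
keeps ρ and L. The condition `ρ * Λ * L ^ q ≤ 1 / 2` survives because h ≤ L and q drops by one. -/
theorem weyl_van_der_corput (ρ : ℝ) (hρ : 1 ≤ ρ) (q : ℕ) : ∃ C : ℝ, 1 ≤ C ∧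
    ∀ (F : ℕ → ℝ → ℝ) (a b L : ℕ) (Λ κ ℓ : ℝ), 1 ≤ L → a ≤ b → b ≤ a + L → 0 < Λ →
    1 + Real.log L ≤ ℓ → ρ * Λ * L ^ q ≤ 1 / 2 → κ * L ≤ ρ * Λ →
    (∀ j ≤ q + 1, ∀ x ∈ Set.Icc (a : ℝ) (b + 2), HasDerivAt (F j) (F (j + 1) x) x) →
    (∀ x ∈ Set.Icc (a : ℝ) (b + 2), Λ ≤ F (q + 1) x ∧ F (q + 1) x ≤ ρ * Λ) →
    (∀ x ∈ Set.Icc (a : ℝ) (b + 2), |F (q + 2) x| ≤ κ) →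
    ‖∑ n ∈ Ico a b, e (F 0 n)‖ ^ (2 ^ q) ≤
      C * ℓ ^ q * L ^ (2 ^ q - 1) * (1 + 1 / (Λ * L ^ q)) := by
  induction q with
  | zero =>
    refine ⟨1 + ρ, by linarith, ?_⟩
    intro F a b L Λ κ ℓ hL hab hbL hΛ hℓ hsmall hκ hd hF hF2
    have hab' : (a : ℝ) ≤ b := by exact_mod_cast hab
    have hκ0 : 0 ≤ κ := (abs_nonneg _).trans (hF2 a ⟨le_rfl, by linarith⟩)
    have hk := kusmin_landau (fun n => F 0 n) a b hab hΛ hκ0 (fun n hn hn' => by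
      have hn1 : (a : ℝ) ≤ n := by exact_mod_cast hn
      have hn2 : (n : ℝ) ≤ b := by exact_mod_cast hn'
      obtain ⟨t, ht, ht'⟩ := exists_slope (f := F 0) (f' := F 1) (x := n) (y := n + 1) (by linarith)
        (fun t ht => hd 0 (by omega) t ⟨by linarith [ht.1], by linarith [ht.2]⟩)
      have := hF t ⟨by linarith [ht.1], by linarith [ht.2]⟩
      simp only [zero_add, pow_zero, mul_one] at this hsmall
      push_cast
      rw [ht']
      constructor <;> linarith) (fun n hn hn' => by
      have hn1 : (a : ℝ) ≤ n := by exact_mod_cast hn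
      have hn2 : (n : ℝ) + 1 ≤ b := by exact_mod_cast hn'
      obtain ⟨t, ht, ht'⟩ := exists_slope (f := fun x => F 0 (x + 1) - F 0 x)
        (f' := fun x => F 1 (x + 1) - F 1 x) (x := n) (y := n + 1) (by linarith)
        (fun t ht => ((hd 0 (by omega) (t + 1)
          ⟨by linarith [ht.1], by linarith [ht.2]⟩).comp_add_const t 1).sub (hd 0 (by omega) t
            ⟨by linarith [ht.1], by linarith [ht.2]⟩))
      obtain ⟨u, hu, hu'⟩ := exists_slope (f := F 1) (f' := F 2) (x := t) (y := t + 1) (by linarith)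
        (fun u hu => hd 1 (by omega) u
          ⟨by linarith [ht.1, hu.1], by linarith [ht.2, hu.2]⟩)
      have := hF2 u ⟨by linarith [ht.1, hu.1], by linarith [ht.2, hu.2]⟩
      push_cast
      rw [show (n : ℝ) + 2 = n + 1 + 1 by ring, ht', hu']
      simpa using this)
    simp only [pow_zero, mul_one, pow_one, Nat.sub_self]
    refine hk.trans ?_
    have hbL' : (b : ℝ) - a ≤ L := by
      have : (b : ℝ) ≤ a + L := by exact_mod_cast hbL
      linarith
    have h1 : (b - a : ℝ) * κ ≤ ρ * Λ :=
      (mul_le_mul_of_nonneg_right hbL' hκ0).trans (by linarith)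
    have h2 : (b - a : ℝ) * κ / (2 * Λ ^ 2) ≤ ρ / (2 * Λ) := by
      rw [div_le_div_iff₀ (by positivity) (by positivity)]
      nlinarith
    have h3 : 1 / (2 * Λ) + ρ / (2 * Λ) ≤ (1 + ρ) * (1 / Λ) := by
      rw [← add_div, div_le_iff₀ (by positivity)]
      field_simp
      linarith
    nlinarith
  | succ q ih =>
    obtain ⟨C, hC, ih⟩ := ih
    refine ⟨2 ^ (2 ^ q) * (1 + C), by
      have : (1 : ℝ) ≤ 2 ^ (2 ^ q) := one_le_pow₀ (by norm_num)
      nlinarith, ?_⟩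
    intro F a b L Λ κ ℓ hL hab hbL hΛ hℓ hsmall hκ hd hF hF2
    obtain ⟨N, rfl⟩ := Nat.exists_eq_add_of_le hab
    have hN : N ≤ L := by omega
    have hL' : (1 : ℝ) ≤ L := by exact_mod_cast hL
    have hN' : (N : ℝ) ≤ L := by exact_mod_cast hN
    have hlog : 0 ≤ Real.log L := Real.log_nonneg hL'
    have hℓ1 : 1 ≤ ℓ := by linarith
    set p := 2 ^ q with hp
    have hp1 : 1 ≤ p := Nat.one_le_two_pow
    set T : ℕ → ℝ := fun h => ‖∑ i ∈ range (N - h), e (F 0 ((a + i + h : ℕ) : ℝ)) *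
      (starRingEnd ℂ) (e (F 0 ((a + i : ℕ) : ℝ)))‖ with hT
    have hsq : ‖∑ n ∈ Ico a (a + N), e (F 0 n)‖ ^ 2 ≤ 2 * ∑ h ∈ range N, T h := by
      rw [sum_Ico_eq_sum_range, Nat.add_sub_cancel_left]
      have := norm_sq_sum_range_le (fun i => e (F 0 ((a + i : ℕ) : ℝ))) N
      simpa only [hT, add_assoc] using this
    have hTn : ∀ h, 0 ≤ T h := fun h => norm_nonneg _
    have hT0 : T 0 ^ p ≤ (L : ℝ) ^ p := by
      refine pow_le_pow_left₀ (hTn 0) ?_ _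
      refine (norm_sum_le _ _).trans ?_
      simp [norm_e, hN]
    have hTh : ∀ h ∈ Ico 1 N, T h ^ p ≤
        C * ℓ ^ q * L ^ (p - 1) * (1 + 1 / (Λ * L ^ q) * (1 / h)) := by
      intro h hh
      rw [mem_Ico] at hh
      have hh1 : (1 : ℝ) ≤ h := by exact_mod_cast hh.1
      have hhL : (h : ℝ) ≤ L := by
        have : (h : ℝ) ≤ N := by exact_mod_cast hh.2.le
        linarith
      have hb : ((a + (N - h) : ℕ) : ℝ) = a + N - h := by
        push_cast [Nat.cast_sub hh.2.le]; ring
      -- Shortening the range by h keeps x + h inside the original interval; the mean value theorem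
      -- transfers the derivative bounds to the differenced phase.
      have := ih (fun j x => F j (x + h) - F j x) a (a + (N - h)) L (h * Λ) (h * κ) ℓ hL (by omega)
        (by omega) (by positivity) hℓ (by
          refine le_trans ?_ hsmall
          rw [pow_succ]
          have : 0 ≤ ρ * Λ * L ^ q := by positivity
          nlinarith) (by nlinarith) (fun j hj x hx => by
          rw [hb] at hx
          refine (HasDerivAt.comp_add_const x (h : ℝ) (hd j (by omega) _ ⟨?_, ?_⟩)).sub
            (hd j (by omega) _ ⟨hx.1, ?_⟩)
          · linarith [hx.1]
          · push_cast; linarith [hx.2]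
          · push_cast; linarith [hx.2]) (fun x hx => by
          rw [hb] at hx
          obtain ⟨t, ht, ht'⟩ := exists_slope (f := F (q + 1)) (f' := F (q + 1 + 1)) (x := x)
            (y := x + h) (by linarith) (fun t ht => hd (q + 1) (by omega) t
              ⟨by linarith [ht.1, hx.1], by push_cast; linarith [ht.2, hx.2]⟩)
          have := hF t ⟨by linarith [ht.1, hx.1], by push_cast; linarith [ht.2, hx.2]⟩
          rw [ht']
          constructor <;> nlinarith) (fun x hx => by
          rw [hb] at hx
          obtain ⟨t, ht, ht'⟩ := exists_slope (f := F (q + 2)) (f' := F (q + 2 + 1)) (x := x)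
            (y := x + h) (by linarith) (fun t ht => hd (q + 2) (by omega) t
              ⟨by linarith [ht.1, hx.1], by push_cast; linarith [ht.2, hx.2]⟩)
          have := hF2 t ⟨by linarith [ht.1, hx.1], by push_cast; linarith [ht.2, hx.2]⟩
          rw [ht', abs_mul, add_sub_cancel_left, Nat.abs_cast, mul_comm]
          gcongr)
      rw [sum_Ico_eq_sum_range, Nat.add_sub_cancel_left] at this
      have heq : T h = ‖∑ k ∈ range (N - h), e (F 0 (((a + k : ℕ) : ℝ) + h) - F 0 ((a + k : ℕ) : ℝ))‖ := by
        simp only [hT, e_sub]; push_cast; rfl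
      rw [heq]
      refine this.trans (le_of_eq ?_)
      congr 2
      field_simp
    -- Power mean inequality, so that the bounds for T(h)^p can be summed over h.
    have hsum : (∑ h ∈ range N, T h) ^ p ≤ (L : ℝ) ^ (p - 1) * ∑ h ∈ range N, T h ^ p := by
      obtain ⟨m, hm⟩ : ∃ m, p = m + 1 := ⟨p - 1, by omega⟩
      rw [hm, Nat.add_sub_cancel]
      have h2 := pow_sum_div_card_le_sum_pow (s := range N) (f := T) (fun i _ => hTn i) m
      rw [card_range] at h2
      rcases Nat.eq_zero_or_pos N with h0 | h0
      · subst h0; simp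
      have hN0 : (0 : ℝ) < N := by exact_mod_cast h0
      rw [div_le_iff₀ (by positivity)] at h2
      refine h2.trans ?_
      rw [mul_comm]
      gcongr
    -- The shift h = 0 is bounded trivially; the others give a harmonic sum, which costs one factor
    -- ℓ per differencing.
    have hsum2 : ∑ h ∈ range N, T h ^ p ≤ (L : ℝ) ^ p + C * ℓ ^ q * L ^ (p - 1) *
        (L + 1 / (Λ * L ^ q) * ℓ) := by
      have hsub : ∑ h ∈ range N, T h ^ p ≤ T 0 ^ p + ∑ h ∈ Ico 1 N, T h ^ p := by
        rcases Nat.eq_zero_or_pos N with h0 | h0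
        · subst h0; simp [hTn 0]
        · rw [range_eq_Ico, sum_eq_sum_Ico_succ_bot h0]
      refine hsub.trans (add_le_add hT0 ((sum_le_sum hTh).trans ?_))
      rw [← mul_sum, sum_add_distrib, ← mul_sum]
      have h3 := (sum_Ico_one_div_le N L hN).trans hℓ
      have h4 : ∑ h ∈ Ico 1 N, (1 : ℝ) ≤ L := by
        rw [sum_const, Nat.card_Ico, nsmul_eq_mul, mul_one]
        refine le_trans ?_ hN'
        exact_mod_cast Nat.sub_le _ _
      gcongr
    have hfin : (‖∑ n ∈ Ico a (a + N), e (F 0 n)‖ ^ 2) ^ p ≤ (2 * ∑ h ∈ range N, T h) ^ p :=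
      pow_le_pow_left₀ (by positivity) hsq _
    rw [pow_succ 2 q, mul_comm (2 ^ q) 2, pow_mul]
    refine hfin.trans ?_
    rw [mul_pow]
    have hLp : (L : ℝ) ^ p = L ^ (p - 1) * L := by
      rw [← pow_succ, Nat.sub_add_cancel hp1]
    have hL2p : (L : ℝ) ^ (2 * p - 1) = L ^ (p - 1) * L ^ (p - 1) * L := by
      rw [← pow_add, ← pow_succ]; congr 1; omega
    have hmain : (∑ h ∈ range N, T h) ^ p ≤ L ^ (p - 1) * ((L : ℝ) ^ p + C * ℓ ^ q * L ^ (p - 1) *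
        (L + 1 / (Λ * L ^ q) * ℓ)) := hsum.trans (by gcongr)
    refine (mul_le_mul_of_nonneg_left hmain (by positivity)).trans ?_
    have hid : L ^ (p - 1) * ((L : ℝ) ^ p + C * ℓ ^ q * L ^ (p - 1) * (L + 1 / (Λ * L ^ q) * ℓ))
        = L ^ (2 * p - 1) * (1 + C * ℓ ^ q * (1 + 1 / (Λ * L ^ (q + 1)) * ℓ)) := by
      rw [hL2p, hLp, pow_succ (L : ℝ) q]; field_simp
    rw [hid]
    have hz : (0 : ℝ) ≤ 1 / (Λ * L ^ (q + 1)) := by positivity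
    have h5 : 1 + C * ℓ ^ q * (1 + 1 / (Λ * L ^ (q + 1)) * ℓ) ≤
        (1 + C) * ℓ ^ (q + 1) * (1 + 1 / (Λ * L ^ (q + 1))) := by
      set z := 1 / (Λ * L ^ (q + 1))
      have h6 : 1 ≤ ℓ ^ q := one_le_pow₀ hℓ1
      have h7 : ℓ ^ q ≤ ℓ ^ (q + 1) := pow_le_pow_right₀ hℓ1 (by omega)
      have h8 : ℓ ^ (q + 1) = ℓ ^ q * ℓ := pow_succ _ _
      have h9 : C * ℓ ^ q ≤ C * ℓ ^ (q + 1) := by gcongr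
      have h10 : C * ℓ ^ q * (1 + z * ℓ) = C * ℓ ^ q + C * ℓ ^ (q + 1) * z := by
        rw [h8]; ring
      rw [h10]
      have h11 : 0 ≤ ℓ ^ (q + 1) * z := by positivity
      nlinarith
    calc 2 ^ p * (L ^ (2 * p - 1) * (1 + C * ℓ ^ q * (1 + 1 / (Λ * L ^ (q + 1)) * ℓ)))
        ≤ 2 ^ p * (L ^ (2 * p - 1) * ((1 + C) * ℓ ^ (q + 1) * (1 + 1 / (Λ * L ^ (q + 1))))) := by
          gcongr
      _ = _ := by ring

end ThinPrimes
end

noncomputable section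
open Finset
namespace ThinPrimes

/-! ### Derivative tests for long ranges and for dilated phases. -/

lemma norm_sum_Ico_le_of_pieces (z : ℕ → ℂ) (U : ℝ) (L' K : ℕ) : ∀ (a b : ℕ),
    (∀ a' b', a ≤ a' → a' ≤ b' → b' ≤ b → b' ≤ a' + L' → ‖∑ n ∈ Ico a' b', z n‖ ≤ U) →
    a ≤ b → b ≤ a + K * L' → ‖∑ n ∈ Ico a b, z n‖ ≤ K * U := by
  induction K with
  | zero =>
    intro a b _ h1 h2
    have : a = b := by omega
    subst this; simp
  | succ K ih =>
    intro a b h hab hb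
    have hU := h a (min (a + L') b) le_rfl (by omega) (by omega) (by omega)
    have h2 := ih (min (a + L') b) b (fun a' b' h1 h2 h3 h4 => h a' b' (by omega) h2 h3 h4)
      (by omega) (by rw [add_mul] at hb; omega)
    rw [← sum_Ico_consecutive _ (show a ≤ min (a + L') b by omega) (by omega)]
    refine (norm_add_le _ _).trans ?_
    push_cast; linarith

lemma norm_sum_e_le (f : ℕ → ℝ) (s : Finset ℕ) : ‖∑ n ∈ s, e (f n)‖ ≤ s.card := by
  refine (norm_sum_le _ _).trans ?_
  simp [norm_e]

-- Removes the smallness assumption of `weyl_van_der_corput`. With Y = ΛL^q, that theorem applies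
-- directly if 2ρY ≤ 1. Otherwise the range is cut into pieces of length about L/t with t^q = 2ρY,
-- short enough for the theorem; if even L < t, the trivial bound L ≤ t ≤ 2ρY suffices.
set_option maxHeartbeats 1000000 in
theorem van_der_corput (ρ : ℝ) (hρ : 1 ≤ ρ) (q : ℕ) (hq : 1 ≤ q) : ∃ C : ℝ, 1 ≤ C ∧
    ∀ (F : ℕ → ℝ → ℝ) (a b L : ℕ) (Λ κ ℓ : ℝ), 1 ≤ L → a ≤ b → b ≤ a + L → 0 < Λ →
    1 + Real.log L ≤ ℓ → κ * L ≤ ρ * Λ →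
    (∀ j ≤ q + 1, ∀ x ∈ Set.Icc (a : ℝ) (b + 2), HasDerivAt (F j) (F (j + 1) x) x) →
    (∀ x ∈ Set.Icc (a : ℝ) (b + 2), Λ ≤ F (q + 1) x ∧ F (q + 1) x ≤ ρ * Λ) →
    (∀ x ∈ Set.Icc (a : ℝ) (b + 2), |F (q + 2) x| ≤ κ) →
    ‖∑ n ∈ Ico a b, e (F 0 n)‖ ^ (2 ^ q) ≤
      C * ℓ ^ q * L ^ (2 ^ q - 1) * (Λ * L ^ q + 1 / (Λ * L ^ q)) := by
  obtain ⟨C₀, hC₀, hW⟩ := weyl_van_der_corput ρ hρ q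
  set p := 2 ^ q with hp
  have hp1 : 1 ≤ p := Nat.one_le_two_pow
  refine ⟨2 ^ p * C₀ * (4 * ρ) * (1 + 2 ^ (q + 1) * ρ), ?_, ?_⟩
  · have h1 : (1 : ℝ) ≤ 2 ^ p := one_le_pow₀ (by norm_num)
    have h2 : (1 : ℝ) ≤ 2 ^ (q + 1) := one_le_pow₀ (by norm_num)
    have h3 : 1 ≤ 2 ^ p * C₀ := one_le_mul_of_one_le_of_one_le h1 hC₀
    have h4 : 1 ≤ 2 ^ p * C₀ * (4 * ρ) := one_le_mul_of_one_le_of_one_le h3 (by linarith)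
    exact one_le_mul_of_one_le_of_one_le h4 (by nlinarith)
  intro F a b L Λ κ ℓ hL hab hbL hΛ hℓ hκ hd hF hF2
  have hL' : (1 : ℝ) ≤ L := by exact_mod_cast hL
  have hℓ1 : 1 ≤ ℓ := by linarith [Real.log_nonneg hL']
  set Y := Λ * L ^ q with hY
  have hY0 : 0 < Y := by positivity
  have hℓq : 1 ≤ ℓ ^ q := one_le_pow₀ hℓ1
  have h2p : (1 : ℝ) ≤ 2 ^ p := one_le_pow₀ (by norm_num)
  have h2q : (1 : ℝ) ≤ 2 ^ (q + 1) := one_le_pow₀ (by norm_num)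
  have hab' : (a : ℝ) ≤ b := by exact_mod_cast hab
  have hκ0 : 0 ≤ κ := (abs_nonneg _).trans (hF2 a ⟨le_rfl, by linarith⟩)
  have hLp : (L : ℝ) ^ p = L ^ (p - 1) * L := by
    rw [← pow_succ, Nat.sub_add_cancel hp1]
  by_cases hsm : 2 * ρ * Y ≤ 1
  · refine (hW F a b L Λ κ ℓ hL hab hbL hΛ hℓ (by rw [hY] at hsm; nlinarith) hκ hd hF hF2).trans ?_
    rw [← hY]
    have h1 : 1 ≤ 1 / Y := by
      rw [le_div_iff₀ hY0]; nlinarith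
    have h2 : 1 + 1 / Y ≤ 2 * (Y + 1 / Y) := by linarith
    have h3 : C₀ * 2 ≤ 2 ^ p * C₀ * (4 * ρ) * (1 + 2 ^ (q + 1) * ρ) := by
      have e1 : C₀ ≤ 2 ^ p * C₀ := by nlinarith
      have e2 : 2 ^ p * C₀ * 2 ≤ 2 ^ p * C₀ * (4 * ρ) := by gcongr; linarith
      have e3 : 2 ^ p * C₀ * (4 * ρ) * 1 ≤ 2 ^ p * C₀ * (4 * ρ) * (1 + 2 ^ (q + 1) * ρ) := by
        gcongr; nlinarith
      linarith
    calc C₀ * ℓ ^ q * L ^ (p - 1) * (1 + 1 / Y) ≤ C₀ * ℓ ^ q * L ^ (p - 1) * (2 * (Y + 1 / Y)) := by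
          gcongr
      _ = (C₀ * 2) * ℓ ^ q * L ^ (p - 1) * (Y + 1 / Y) := by ring
      _ ≤ _ := by gcongr
  push Not at hsm
  set t := (2 * ρ * Y) ^ ((q : ℝ)⁻¹) with ht
  have htq : t ^ q = 2 * ρ * Y := Real.rpow_inv_natCast_pow (by positivity) (by omega)
  have ht1 : 1 < t := Real.one_lt_rpow hsm (by positivity)
  have htY : t ≤ 2 * ρ * Y := by
    rw [← htq]; exact le_self_pow₀ ht1.le (by omega)
  have hcard : ‖∑ n ∈ Ico a b, e (F 0 n)‖ ≤ L := by
    refine (norm_sum_e_le _ _).trans ?_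
    rw [Nat.card_Ico]; exact_mod_cast (by omega)
  have hbig : C₀ * (4 * ρ) ≤ 2 ^ p * C₀ * (4 * ρ) * (1 + 2 ^ (q + 1) * ρ) := by
    have e1 : C₀ ≤ 2 ^ p * C₀ := by nlinarith
    have e2 : C₀ * (4 * ρ) ≤ 2 ^ p * C₀ * (4 * ρ) := by gcongr
    have e3 : 2 ^ p * C₀ * (4 * ρ) * 1 ≤ 2 ^ p * C₀ * (4 * ρ) * (1 + 2 ^ (q + 1) * ρ) := by
      gcongr; nlinarith
    linarith
  by_cases hLt : (L : ℝ) < t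
  · calc ‖∑ n ∈ Ico a b, e (F 0 n)‖ ^ p ≤ (L : ℝ) ^ p := pow_le_pow_left₀ (norm_nonneg _) hcard _
      _ = L ^ (p - 1) * L := hLp
      _ ≤ L ^ (p - 1) * (2 * ρ * Y) := by gcongr; linarith
      _ ≤ L ^ (p - 1) * (C₀ * (4 * ρ) * ℓ ^ q * (Y + 1 / Y)) := by
        refine mul_le_mul_of_nonneg_left ?_ (by positivity)
        have e1 : 0 < 1 / Y := by positivity
        have e2 : 4 * ρ ≤ C₀ * (4 * ρ) * ℓ ^ q := by
          have : 1 ≤ C₀ * ℓ ^ q := one_le_mul_of_one_le_of_one_le hC₀ hℓq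
          nlinarith
        calc 2 * ρ * Y ≤ 4 * ρ * (Y + 1 / Y) := by nlinarith
          _ ≤ _ := by gcongr
      _ = C₀ * (4 * ρ) * ℓ ^ q * L ^ (p - 1) * (Y + 1 / Y) := by ring
      _ ≤ _ := by gcongr
  push Not at hLt
  set L' := ⌊(L : ℝ) / t⌋₊ with hL'd
  have ht0 : 0 < t := by linarith
  have hLt1 : 1 ≤ (L : ℝ) / t := by rwa [le_div_iff₀ ht0, one_mul]
  have hL'1 : 1 ≤ L' := Nat.le_floor (by simpa using hLt1)
  have hL'r : (1 : ℝ) ≤ L' := by exact_mod_cast hL'1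
  have hL'le : (L' : ℝ) ≤ L / t := Nat.floor_le (by positivity)
  have hL'L : (L' : ℝ) ≤ L := hL'le.trans (div_le_self (by positivity) ht1.le)
  have hL'ge : (L : ℝ) / (2 * t) ≤ L' := by
    have := Nat.lt_floor_add_one ((L : ℝ) / t)
    rw [← hL'd] at this
    rw [mul_comm, ← div_div]
    linarith
  have hLLn : L' ≤ L := by exact_mod_cast hL'L
  set K := L / L' + 1 with hK
  have hKL : L ≤ K * L' := by
    have := Nat.lt_div_mul_add (a := L) (b := L') (by omega)
    rw [hK, add_mul]; omega
  have hK2 : (K : ℝ) ≤ 2 * L / L' := by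
    have h1 : ((L / L' : ℕ) : ℝ) ≤ L / L' := Nat.cast_div_le
    have h2 : 1 ≤ (L : ℝ) / L' := by rw [le_div_iff₀ (by linarith)]; linarith
    rw [hK]; push_cast
    rw [mul_div_assoc]; linarith
  set B := C₀ * ℓ ^ q * L' ^ (p - 1) * (1 + 1 / (Λ * L' ^ q)) with hB
  have hB0 : 0 ≤ B := by positivity
  set U := B ^ ((p : ℝ)⁻¹) with hU
  have hU0 : 0 ≤ U := by positivity
  have hUp : U ^ p = B := Real.rpow_inv_natCast_pow hB0 (by omega)
  have hpieces : ∀ a' b', a ≤ a' → a' ≤ b' → b' ≤ b → b' ≤ a' + L' →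
      ‖∑ n ∈ Ico a' b', e (F 0 n)‖ ≤ U := by
    intro a' b' h1 h2 h3 h4
    have h1' : (a : ℝ) ≤ a' := by exact_mod_cast h1
    have h3' : (b' : ℝ) ≤ b := by exact_mod_cast h3
    have hsub : ∀ x ∈ Set.Icc (a' : ℝ) (b' + 2), x ∈ Set.Icc (a : ℝ) (b + 2) := fun x hx =>
      ⟨by linarith [hx.1], by linarith [hx.2]⟩
    have := hW F a' b' L' Λ κ ℓ hL'1 h2 h4 hΛ (by
      have := Real.log_le_log (by linarith) hL'L
      linarith) (by
      have : (L' : ℝ) ^ q ≤ (L / t) ^ q := by gcongr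
      rw [div_pow, htq] at this
      calc ρ * Λ * L' ^ q ≤ ρ * Λ * (L ^ q / (2 * ρ * Y)) := by gcongr
        _ = 1 / 2 := by rw [hY]; field_simp)
      ((mul_le_mul_of_nonneg_left hL'L hκ0).trans hκ)
      (fun j hj x hx => hd j hj x (hsub x hx)) (fun x hx => hF x (hsub x hx))
      (fun x hx => hF2 x (hsub x hx))
    rw [← hB, ← hUp] at this
    exact le_of_pow_le_pow_left₀ (by omega) hU0 this
  have hS := norm_sum_Ico_le_of_pieces (fun n => e (F 0 n)) U L' K a b hpieces hab (by omega)
  have hSp : ‖∑ n ∈ Ico a b, e (F 0 n)‖ ^ p ≤ (2 * L / L') ^ p * B := by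
    rw [← hUp, ← mul_pow]
    refine pow_le_pow_left₀ (norm_nonneg _) (hS.trans ?_) _
    gcongr
  refine hSp.trans ?_
  have hL'p : (L' : ℝ) ^ p = L' ^ (p - 1) * L' := by
    rw [← pow_succ, Nat.sub_add_cancel hp1]
  -- Cutting loses the factor L/L' in the end, and L/L' ≤ 2t ≤ 4ρY.
  have hinv : 1 / (L' : ℝ) ≤ 4 * ρ * Y / L := by
    rw [div_le_div_iff₀ (by linarith) (by linarith)]
    rw [div_le_iff₀ (by positivity)] at hL'ge
    have := mul_le_mul_of_nonneg_left htY (by positivity : 0 ≤ 2 * (L' : ℝ))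
    linarith
  have hΛL' : 1 / (Λ * L' ^ q) ≤ 2 ^ (q + 1) * ρ := by
    have h1 : (L / (2 * t)) ^ q ≤ (L' : ℝ) ^ q := by gcongr
    rw [div_pow, mul_pow, htq, div_le_iff₀ (by positivity)] at h1
    rw [div_le_iff₀ (by positivity)]
    have h2 : Y ≤ Λ * (L' ^ q * (2 ^ q * (2 * ρ * Y))) := by
      rw [hY] at h1 ⊢
      exact mul_le_mul_of_nonneg_left h1 hΛ.le
    have h3 : Y * 1 ≤ Y * (2 ^ (q + 1) * ρ * (Λ * L' ^ q)) := by
      rw [pow_succ]; linarith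
    exact le_of_mul_le_mul_left h3 hY0
  calc (2 * L / L') ^ p * B = 2 ^ p * C₀ * ℓ ^ q * L ^ p * (1 / L') * (1 + 1 / (Λ * L' ^ q)) := by
        rw [hB, div_pow, mul_pow, hL'p]; field_simp
    _ ≤ 2 ^ p * C₀ * ℓ ^ q * L ^ p * (4 * ρ * Y / L) * (1 + 2 ^ (q + 1) * ρ) := by gcongr
    _ = 2 ^ p * C₀ * (4 * ρ) * (1 + 2 ^ (q + 1) * ρ) * ℓ ^ q * L ^ (p - 1) * Y := by
        rw [hLp]; field_simp
    _ ≤ _ := by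
        gcongr
        have : 0 < 1 / Y := by positivity
        linarith

/-- The scale-invariant form: on x of order L, the single quantity R measures x^q F⁽q+1⁾(x).
Conjugation reduces to s = 1. In the ratio ρ below, 64^q allows for the variation of x^q over [L/8,
8L], and the extra 8 makes the condition on κ hold with equality. -/
theorem norm_expSum_pow_le (q : ℕ) (hq : 1 ≤ q) (c₁ c₂ : ℝ) (hc₁ : 0 < c₁) (hc₂ : c₁ ≤ c₂) :
    ∃ C : ℝ, 1 ≤ C ∧ ∀ (F : ℕ → ℝ → ℝ) (a b L : ℕ) (R s ℓ : ℝ), 1 ≤ L → a ≤ b → b ≤ a + L →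
    0 < R → (s = 1 ∨ s = -1) → 1 + Real.log L ≤ ℓ →
    (∀ j ≤ q + 1, ∀ x ∈ Set.Icc (a : ℝ) (b + 2), HasDerivAt (F j) (F (j + 1) x) x) →
    (∀ x ∈ Set.Icc (a : ℝ) (b + 2), L / 8 ≤ x ∧ x ≤ 8 * L) →
    (∀ x ∈ Set.Icc (a : ℝ) (b + 2), c₁ * R ≤ s * F (q + 1) x * x ^ q ∧
      s * F (q + 1) x * x ^ q ≤ c₂ * R) →
    (∀ x ∈ Set.Icc (a : ℝ) (b + 2), |F (q + 2) x| * x ^ (q + 1) ≤ c₂ * R) →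
    ‖∑ n ∈ Ico a b, e (F 0 n)‖ ^ (2 ^ q) ≤ C * ℓ ^ q * L ^ (2 ^ q - 1) * (R + 1 / R) := by
  have h64 : (1 : ℝ) ≤ 64 ^ q := one_le_pow₀ (by norm_num)
  have hcc : 1 ≤ c₂ / c₁ := by rwa [le_div_iff₀ hc₁, one_mul]
  have hc₂0 : 0 < c₂ := hc₁.trans_le hc₂
  obtain ⟨C, hC, hV⟩ := van_der_corput (8 * 64 ^ q * (c₂ / c₁)) (by nlinarith) q hq
  have h8 : (1 : ℝ) ≤ 8 ^ q := one_le_pow₀ (by norm_num)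
  refine ⟨C * (1 + c₁ / 8 ^ q + 8 ^ q / c₁), ?_, ?_⟩
  · have : 0 < c₁ / 8 ^ q + 8 ^ q / c₁ := by positivity
    nlinarith
  intro F a b L R s ℓ hL hab hbL hR hs hℓ hd hx hF hF2
  have hL0 : (0 : ℝ) < L := by exact_mod_cast hL
  have hL' : (1 : ℝ) ≤ L := by exact_mod_cast hL
  have hℓ1 : 1 ≤ ℓ := by linarith [Real.log_nonneg hL']
  have hsabs : |s| = 1 := by rcases hs with h | h <;> simp [h]
  have hnorm : ‖∑ n ∈ Ico a b, e (s * F 0 n)‖ = ‖∑ n ∈ Ico a b, e (F 0 n)‖ := by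
    rcases hs with h | h
    · simp [h]
    · rw [h]
      simp only [neg_mul, one_mul, e_neg]
      rw [← map_sum, RCLike.norm_conj]
  have key := hV (fun j x => s * F j x) a b L (c₁ * R / (8 * L) ^ q) (c₂ * R * (8 / L) ^ (q + 1)) ℓ
    hL hab hbL (by positivity) hℓ (le_of_eq (by
      rw [show (64 : ℝ) ^ q = 8 ^ q * 8 ^ q by rw [← mul_pow]; norm_num, mul_pow, div_pow]
      field_simp; ring)) (fun j hj x h => (hd j hj x h).const_mul s) (fun x h => by
        obtain ⟨h1, h2⟩ := hF x h
        obtain ⟨h3, h4⟩ := hx x h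
        have hx0 : 0 < x := by linarith [div_pos hL0 (by norm_num : (0:ℝ) < 8)]
        have hxq1 : x ^ q ≤ (8 * L) ^ q := by gcongr
        have hxq2 : (L / 8) ^ q ≤ x ^ q := by gcongr
        have hpos : 0 < s * F (q + 1) x := by
          have : 0 < c₁ * R := by positivity
          exact pos_of_mul_pos_left (this.trans_le h1) (by positivity)
        constructor
        · rw [div_le_iff₀ (by positivity)]
          exact h1.trans (by gcongr)
        · have h5 : s * F (q + 1) x * (L / 8) ^ q ≤ c₂ * R := by
            refine le_trans ?_ h2; gcongr
          rw [← le_div_iff₀ (by positivity)] at h5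
          refine h5.trans ?_
          rw [show 8 * 64 ^ q * (c₂ / c₁) * (c₁ * R / (8 * L) ^ q) = 8 * (c₂ * R / (L / 8) ^ q) by
            rw [show (64 : ℝ) ^ q = 8 ^ q * 8 ^ q by rw [← mul_pow]; norm_num, mul_pow, div_pow]
            field_simp]
          have : 0 < c₂ * R / (L / 8) ^ q := by positivity
          linarith) (fun x h => by
        have h2 := hF2 x h
        obtain ⟨h3, h4⟩ := hx x h
        have hxq2 : (L / 8 : ℝ) ^ (q + 1) ≤ x ^ (q + 1) := by gcongr
        have h5 : |F (q + 2) x| * (L / 8 : ℝ) ^ (q + 1) ≤ c₂ * R := le_trans (by gcongr) h2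
        rw [← le_div_iff₀ (by positivity)] at h5
        rw [abs_mul, hsabs, one_mul]
        refine h5.trans (le_of_eq ?_)
        rw [div_pow, div_pow]; field_simp)
  rw [hnorm] at key
  refine key.trans ?_
  rw [show c₁ * R / (8 * L) ^ q * (L : ℝ) ^ q = c₁ / 8 ^ q * R by rw [mul_pow]; field_simp]
  rw [show C * (1 + c₁ / 8 ^ q + 8 ^ q / c₁) * ℓ ^ q * L ^ (2 ^ q - 1) * (R + 1 / R)
    = C * ℓ ^ q * L ^ (2 ^ q - 1) * ((1 + c₁ / 8 ^ q + 8 ^ q / c₁) * (R + 1 / R)) by ring]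
  gcongr
  rw [show 1 / (c₁ / 8 ^ q * R) = 8 ^ q / c₁ * (1 / R) by field_simp]
  have e1 : 0 < c₁ / 8 ^ q := by positivity
  have e2 : 0 < 8 ^ q / c₁ := by positivity
  have e3 : 0 < 1 / R := by positivity
  set u := c₁ / 8 ^ q
  set v := 8 ^ q / c₁
  nlinarith [mul_pos e1 e3, mul_pos e2 hR]

/-- Bounds on `[X, 4X]` for the derivatives of a phase `g 0`, `g (j + 1)` being the derivative
of `g j`: up to the sign `s`, the Euler-type derivative `y ^ (q + 1) * g (q + 1) y` is of size
`X * V` and has derivative of size `V`. -/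
structure PhaseBounds (q : ℕ) (c₁ c₂ : ℝ) (X : ℕ) (V s : ℝ) (g : ℕ → ℝ → ℝ) : Prop where
  V_pos : 0 < V
  sign : s = 1 ∨ s = -1
  deriv : ∀ j ≤ q + 2, ∀ y ∈ Set.Icc (X : ℝ) (4 * X), HasDerivAt (g j) (g (j + 1) y) y
  lower : ∀ y ∈ Set.Icc (X : ℝ) (4 * X), c₁ * (X * V) ≤ s * (y ^ (q + 1) * g (q + 1) y)
  upper : ∀ y ∈ Set.Icc (X : ℝ) (4 * X), s * (y ^ (q + 1) * g (q + 1) y) ≤ c₂ * (X * V)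
  upper' : ∀ y ∈ Set.Icc (X : ℝ) (4 * X), |y ^ (q + 2) * g (q + 2) y| ≤ c₂ * (X * V)
  deriv_lower : ∀ y ∈ Set.Icc (X : ℝ) (4 * X),
    c₁ * V ≤ s * ((q + 1) * y ^ q * g (q + 1) y + y ^ (q + 1) * g (q + 2) y)
  deriv_upper : ∀ y ∈ Set.Icc (X : ℝ) (4 * X),
    s * ((q + 1) * y ^ q * g (q + 1) y + y ^ (q + 1) * g (q + 2) y) ≤ c₂ * V
  deriv_upper' : ∀ y ∈ Set.Icc (X : ℝ) (4 * X),
    |(q + 2) * y ^ (q + 1) * g (q + 2) y + y ^ (q + 2) * g (q + 3) y| ≤ c₂ * V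

lemma hasDerivAt_dilate {g g' : ℝ → ℝ} {k x : ℝ} (j : ℕ) (h : HasDerivAt g (g' (x * k)) (x * k)) :
    HasDerivAt (fun x => k ^ j * g (x * k)) (k ^ (j + 1) * g' (x * k)) x := by
  have h1 : HasDerivAt (fun x => x * k) k x := by simpa using (hasDerivAt_id x).mul_const k
  have := (h.comp x h1).const_mul (k ^ j)
  refine this.congr_deriv ?_
  rw [pow_succ]; ring

/-- For the phase x ↦ g(xk) and y = xk, the quantity x^q times the derivative of order q+1 is
y^(q+1) g⁽q+1⁾(y)/x. With y of order X and x of order X/k this has size kV. Since 2k ≤ X, the three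
extra integers beyond b still keep y below 4X. -/
theorem norm_linearSum_pow_le (q : ℕ) (hq : 1 ≤ q) (c₁ c₂ : ℝ) (hc₁ : 0 < c₁) (hc₂ : c₁ ≤ c₂) :
    ∃ C : ℝ, 1 ≤ C ∧ ∀ (g : ℕ → ℝ → ℝ) (X : ℕ) (V s ℓ : ℝ) (k a b : ℕ),
    PhaseBounds q c₁ c₂ X V s g → 1 ≤ k → 2 * k ≤ X → X ≤ (a + 1) * k → b * k ≤ 2 * X → a ≤ b →
    1 + Real.log (2 * X) ≤ ℓ →
    ‖∑ n ∈ Ioc a b, e (g 0 (n * k))‖ ^ (2 ^ q) ≤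
      C * ℓ ^ q * (2 * X / k) ^ (2 ^ q - 1) * (k * V + 1 / (k * V)) := by
  obtain ⟨C, hC, hV⟩ := norm_expSum_pow_le q hq (c₁ / 4) c₂ (by positivity) (by linarith)
  refine ⟨C, hC, ?_⟩
  intro g X V s ℓ k a b hg hk hkX haX hbX hab hℓ
  have hV0 := hg.V_pos
  have hk0 : (0 : ℝ) < k := by exact_mod_cast hk
  have hkX' : 2 * (k : ℝ) ≤ X := by exact_mod_cast hkX
  have hX0 : (0 : ℝ) < X := by linarith
  have haX' : (X : ℝ) ≤ (a + 1) * k := by exact_mod_cast haX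
  have hbX' : (b : ℝ) * k ≤ 2 * X := by exact_mod_cast hbX
  have hbL : b ≤ 2 * X / k := (Nat.le_div_iff_mul_le hk).2 hbX
  have hL1 : 1 ≤ 2 * X / k := (Nat.le_div_iff_mul_le hk).2 (by omega)
  have hbL' : (b : ℝ) ≤ ((2 * X / k : ℕ) : ℝ) := by exact_mod_cast hbL
  have hL1' : (1 : ℝ) ≤ ((2 * X / k : ℕ) : ℝ) := by exact_mod_cast hL1
  have hLle : ((2 * X / k : ℕ) : ℝ) ≤ 2 * X / k := by
    exact Nat.cast_div_le.trans (by push_cast; exact le_rfl)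
  have hLle' : ((2 * X / k : ℕ) : ℝ) * k ≤ 2 * X := by rwa [← le_div_iff₀ hk0]
  rw [show Ioc a b = Ico (a + 1) (b + 1) by ext; simp]
  have hmem : ∀ x ∈ Set.Icc ((a + 1 : ℕ) : ℝ) ((b + 1 : ℕ) + 2),
      x * k ∈ Set.Icc (X : ℝ) (4 * X) ∧ 0 < x := by
    intro x hx
    push_cast at hx
    have : 0 ≤ (a : ℝ) := by positivity
    refine ⟨⟨haX'.trans (by nlinarith [hx.1]), ?_⟩, by linarith [hx.1]⟩
    have : x * k ≤ (b + 3) * k := by nlinarith [hx.2]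
    nlinarith
  have key := hV (fun j x => (k : ℝ) ^ j * g j (x * k)) (a + 1) (b + 1) (2 * X / k) (k * V) s ℓ hL1
    (by omega) (by omega) (by positivity) hg.sign (by
      have : Real.log ((2 * X / k : ℕ) : ℝ) ≤ Real.log (2 * X) := by
        refine Real.log_le_log (by linarith) (hLle.trans ?_)
        rw [div_le_iff₀ hk0]
        have : (1 : ℝ) ≤ k := by exact_mod_cast hk
        nlinarith
      linarith)
    (fun j hj x hx => hasDerivAt_dilate j (hg.deriv j (by omega) _ (hmem x hx).1))
    (fun x hx => by
      obtain ⟨⟨h1, h2⟩, h3⟩ := hmem x hx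
      push_cast at hx
      constructor
      · have : ((2 * X / k : ℕ) : ℝ) * k ≤ 8 * x * k := by linarith
        have := le_of_mul_le_mul_right this hk0
        linarith
      · linarith [hx.2])
    (fun x hx => by
      obtain ⟨h1, h3⟩ := hmem x hx
      have h4 := hg.lower _ h1
      have h5 := hg.upper _ h1
      have hid : s * ((k : ℝ) ^ (q + 1) * g (q + 1) (x * k)) * x ^ q =
          s * ((x * k) ^ (q + 1) * g (q + 1) (x * k)) / x := by
        rw [mul_pow, pow_succ x q]; field_simp
      rw [hid, le_div_iff₀ h3, div_le_iff₀ h3]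
      constructor
      · refine le_trans ?_ h4
        have := mul_le_mul_of_nonneg_left h1.2 (by positivity : 0 ≤ c₁ / 4 * V)
        nlinarith
      · refine h5.trans ?_
        have := mul_le_mul_of_nonneg_left h1.1 (by nlinarith : 0 ≤ c₂ * V)
        nlinarith)
    (fun x hx => by
      obtain ⟨h1, h3⟩ := hmem x hx
      have h5 := hg.upper' _ h1
      have hid : |(k : ℝ) ^ (q + 2) * g (q + 2) (x * k)| * x ^ (q + 1) =
          |(x * k) ^ (q + 2) * g (q + 2) (x * k)| / x := by
        rw [abs_mul, abs_mul, abs_of_pos (by positivity : 0 < (k : ℝ) ^ (q + 2)),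
          abs_of_pos (by positivity : 0 < (x * k) ^ (q + 2)), mul_pow, pow_succ x (q + 1)]
        field_simp
      rw [hid, div_le_iff₀ h3]
      refine h5.trans ?_
      have := mul_le_mul_of_nonneg_left h1.1 (by nlinarith : 0 ≤ c₂ * V)
      nlinarith)
  simp only [pow_zero, one_mul] at key
  refine key.trans ?_
  have hℓ0 : 0 ≤ ℓ := by
    have : 0 ≤ Real.log (2 * X) := Real.log_nonneg (by
      have : (1 : ℝ) ≤ k := by exact_mod_cast hk
      linarith)
    linarith
  gcongr

-- Here x^(q+1) times the derivative of order q+1 of the phase is the difference of y^(q+1)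
-- g⁽q+1⁾(y) between y = xk₁ and y = xk₂. By the mean value theorem it equals x(k₁ - k₂) times the
-- derivative of that function. This is why `PhaseBounds` also controls these derivatives from
-- below, and why R = (k₁ - k₂)V.
set_option maxHeartbeats 1000000 in
theorem norm_bilinearSum_pow_le (q : ℕ) (hq : 1 ≤ q) (c₁ c₂ : ℝ) (hc₁ : 0 < c₁) (hc₂ : c₁ ≤ c₂) :
    ∃ C : ℝ, 1 ≤ C ∧ ∀ (g : ℕ → ℝ → ℝ) (X : ℕ) (V s ℓ : ℝ) (k₀ k₁ k₂ a b : ℕ),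
    PhaseBounds q c₁ c₂ X V s g → 1 ≤ k₀ → k₀ ≤ k₂ → k₂ < k₁ → k₁ ≤ 2 * k₀ → 2 * k₁ ≤ X →
    X ≤ (a + 1) * k₂ → b * k₁ ≤ 2 * X → a ≤ b → 1 + Real.log (2 * X) ≤ ℓ →
    ‖∑ n ∈ Ioc a b, e (g 0 (n * k₁) - g 0 (n * k₂))‖ ^ (2 ^ q) ≤
      C * ℓ ^ q * (2 * X / k₀) ^ (2 ^ q - 1) * ((k₁ - k₂ : ℝ) * V + 1 / ((k₁ - k₂ : ℝ) * V)) := by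
  obtain ⟨C, hC, hV⟩ := norm_expSum_pow_le q hq c₁ c₂ hc₁ hc₂
  refine ⟨C, hC, ?_⟩
  intro g X V s ℓ k₀ k₁ k₂ a b hg hk0 hk02 hk21 hk10 hkX haX hbX hab hℓ
  have hV0 := hg.V_pos
  have hk0' : (0 : ℝ) < k₀ := by exact_mod_cast hk0
  have hk02' : (k₀ : ℝ) ≤ k₂ := by exact_mod_cast hk02
  have hk21' : (k₂ : ℝ) < k₁ := by exact_mod_cast hk21
  have hk10' : (k₁ : ℝ) ≤ 2 * k₀ := by exact_mod_cast hk10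
  have hkX' : 2 * (k₁ : ℝ) ≤ X := by exact_mod_cast hkX
  have hX0 : (0 : ℝ) < X := by linarith
  have haX' : (X : ℝ) ≤ (a + 1) * k₂ := by exact_mod_cast haX
  have hbX' : (b : ℝ) * k₁ ≤ 2 * X := by exact_mod_cast hbX
  have hbL : b ≤ 2 * X / k₀ := (Nat.le_div_iff_mul_le hk0).2 (by nlinarith)
  have hL1 : 1 ≤ 2 * X / k₀ := (Nat.le_div_iff_mul_le hk0).2 (by omega)
  have hbL' : (b : ℝ) ≤ ((2 * X / k₀ : ℕ) : ℝ) := by exact_mod_cast hbL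
  have hL1' : (1 : ℝ) ≤ ((2 * X / k₀ : ℕ) : ℝ) := by exact_mod_cast hL1
  have hLle : ((2 * X / k₀ : ℕ) : ℝ) ≤ 2 * X / k₀ := by
    exact Nat.cast_div_le.trans (by push_cast; exact le_rfl)
  have hLle' : ((2 * X / k₀ : ℕ) : ℝ) * k₀ ≤ 2 * X := by rwa [← le_div_iff₀ hk0']
  rw [show Ioc a b = Ico (a + 1) (b + 1) by ext; simp]
  have hmem : ∀ x ∈ Set.Icc ((a + 1 : ℕ) : ℝ) ((b + 1 : ℕ) + 2),
      (X : ℝ) ≤ x * k₂ ∧ x * k₂ < x * k₁ ∧ x * k₁ ≤ 4 * X ∧ 0 < x := by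
    intro x hx
    push_cast at hx
    have h0 : 0 ≤ (a : ℝ) := by positivity
    have hx0 : 0 < x := by linarith [hx.1]
    refine ⟨haX'.trans (by nlinarith [hx.1]), by nlinarith, ?_, hx0⟩
    have : x * k₁ ≤ (b + 3) * k₁ := by nlinarith [hx.2]
    nlinarith
  have hr : (0 : ℝ) < k₁ - k₂ := by linarith
  have key := hV (fun j x => (k₁ : ℝ) ^ j * g j (x * k₁) - (k₂ : ℝ) ^ j * g j (x * k₂))
    (a + 1) (b + 1) (2 * X / k₀) ((k₁ - k₂ : ℝ) * V) s ℓ hL1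
    (by omega) (by omega) (by positivity) hg.sign (by
      have : Real.log ((2 * X / k₀ : ℕ) : ℝ) ≤ Real.log (2 * X) := by
        refine Real.log_le_log (by linarith) (hLle.trans ?_)
        rw [div_le_iff₀ hk0']
        have : (1 : ℝ) ≤ k₀ := by exact_mod_cast hk0
        nlinarith
      linarith)
    (fun j hj x hx => by
      obtain ⟨h1, h2, h3, h4⟩ := hmem x hx
      exact (hasDerivAt_dilate j (hg.deriv j (by omega) _ ⟨by linarith, by linarith⟩)).sub
        (hasDerivAt_dilate j (hg.deriv j (by omega) _ ⟨by linarith, by linarith⟩)))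
    (fun x hx => by
      obtain ⟨h1, h2, h3, h4⟩ := hmem x hx
      push_cast at hx
      constructor
      · have h5 : x * k₂ ≤ x * (2 * k₀) := by gcongr; linarith
        have : ((2 * X / k₀ : ℕ) : ℝ) * k₀ ≤ 8 * x * k₀ := by linarith
        have := le_of_mul_le_mul_right this hk0'
        linarith
      · linarith [hx.2])
    (fun x hx => by
      obtain ⟨h1, h2, h3, h4⟩ := hmem x hx
      obtain ⟨t, ht, ht'⟩ := exists_slope (f := fun y => y ^ (q + 1) * g (q + 1) y)
        (f' := fun y => (q + 1) * y ^ q * g (q + 1) y + y ^ (q + 1) * g (q + 2) y) h2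
        (fun t ht => by
          have := (hasDerivAt_pow (q + 1) t).fun_mul
            (hg.deriv (q + 1) (by omega) t ⟨by linarith [ht.1], by linarith [ht.2]⟩)
          simpa using this)
      have h5 := hg.deriv_lower t ⟨by linarith [ht.1], by linarith [ht.2]⟩
      have h6 := hg.deriv_upper t ⟨by linarith [ht.1], by linarith [ht.2]⟩
      set D := (q + 1) * t ^ q * g (q + 1) t + t ^ (q + 1) * g (q + 2) t
      have hid : s * ((k₁ : ℝ) ^ (q + 1) * g (q + 1) (x * k₁) -
          (k₂ : ℝ) ^ (q + 1) * g (q + 1) (x * k₂)) * x ^ q = (k₁ - k₂) * (s * D) := by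
        have : ((k₁ : ℝ) ^ (q + 1) * g (q + 1) (x * k₁) -
          (k₂ : ℝ) ^ (q + 1) * g (q + 1) (x * k₂)) * x ^ q * x = (k₁ - k₂) * D * x := by
          rw [mul_pow, mul_pow] at ht'
          rw [pow_succ x q] at ht'
          linear_combination ht'
        have := mul_right_cancel₀ h4.ne' this
        linear_combination s * this
      rw [hid]
      have e1 := mul_le_mul_of_nonneg_left h5 hr.le
      have e2 := mul_le_mul_of_nonneg_left h6 hr.le
      constructor <;> linarith)
    (fun x hx => by
      obtain ⟨h1, h2, h3, h4⟩ := hmem x hx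
      obtain ⟨t, ht, ht'⟩ := exists_slope (f := fun y => y ^ (q + 2) * g (q + 2) y)
        (f' := fun y => (q + 2) * y ^ (q + 1) * g (q + 2) y + y ^ (q + 2) * g (q + 3) y) h2
        (fun t ht => by
          have := (hasDerivAt_pow (q + 2) t).fun_mul
            (hg.deriv (q + 2) (by omega) t ⟨by linarith [ht.1], by linarith [ht.2]⟩)
          simpa using this)
      have h5 := hg.deriv_upper' t ⟨by linarith [ht.1], by linarith [ht.2]⟩
      set D := (q + 2) * t ^ (q + 1) * g (q + 2) t + t ^ (q + 2) * g (q + 3) t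
      have hid : ((k₁ : ℝ) ^ (q + 2) * g (q + 2) (x * k₁) -
          (k₂ : ℝ) ^ (q + 2) * g (q + 2) (x * k₂)) * x ^ (q + 1) = (k₁ - k₂) * D := by
        have : ((k₁ : ℝ) ^ (q + 2) * g (q + 2) (x * k₁) -
          (k₂ : ℝ) ^ (q + 2) * g (q + 2) (x * k₂)) * x ^ (q + 1) * x = (k₁ - k₂) * D * x := by
          rw [mul_pow, mul_pow] at ht'
          rw [pow_succ x (q + 1)] at ht'
          linear_combination ht'
        exact mul_right_cancel₀ h4.ne' this
      rw [← abs_of_pos (pow_pos h4 (q + 1)), ← abs_mul, hid, abs_mul, abs_of_pos hr]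
      have e1 := mul_le_mul_of_nonneg_left h5 hr.le
      linarith)
  simp only [pow_zero, one_mul] at key
  refine key.trans ?_
  have hℓ0 : 0 ≤ ℓ := by
    have : 0 ≤ Real.log (2 * X) := Real.log_nonneg (by
      have : (1 : ℝ) ≤ k₀ := by exact_mod_cast hk0
      linarith)
    linarith
  gcongr

end ThinPrimes
end

noncomputable section
open Finset
namespace ThinPrimes

/-! ### Partial summation, Cauchy-Schwarz, and the linear and bilinear sums. -/

lemma sum_Ioc_mul_eq_sub (w z : ℕ → ℂ) (a b : ℕ) (hab : a ≤ b) :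
    ∑ n ∈ Ioc a b, w n * z n = w b * ∑ n ∈ Ioc a b, z n -
      ∑ n ∈ Ico (a + 1) b, (w (n + 1) - w n) * ∑ k ∈ Ioc a n, z k := by
  induction b, hab using Nat.le_induction with
  | base => simp
  | succ b hab ih =>
    rw [sum_Ioc_succ_top hab, sum_Ioc_succ_top hab, ih]
    rcases hab.eq_or_lt with h | h
    · subst h; simp
    · rw [sum_Ico_succ_top (by omega)]; ring

lemma norm_sum_Ioc_mul_le (w z : ℕ → ℂ) (a b : ℕ) (hab : a ≤ b) (U : ℝ)
    (hU : ∀ y, a ≤ y → y ≤ b → ‖∑ n ∈ Ioc a y, z n‖ ≤ U) :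
    ‖∑ n ∈ Ioc a b, w n * z n‖ ≤ U * (‖w b‖ + ∑ n ∈ Ico (a + 1) b, ‖w (n + 1) - w n‖) := by
  rw [sum_Ioc_mul_eq_sub w z a b hab]
  refine (norm_sub_le _ _).trans ?_
  rw [mul_add, mul_comm U, norm_mul]
  have hU0 : 0 ≤ U := (norm_nonneg _).trans (hU b hab le_rfl)
  gcongr
  · exact hU b hab le_rfl
  · refine (norm_sum_le _ _).trans ?_
    rw [mul_sum]
    refine sum_le_sum fun n hn => ?_
    rw [mem_Ico] at hn
    rw [norm_mul, mul_comm U]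
    gcongr
    exact hU n (by omega) (by omega)

lemma sum_norm_sq_le (S K : Finset ℕ) (β : ℕ → ℂ) (z : ℕ → ℕ → ℂ) :
    ∑ l ∈ S, ‖∑ k ∈ K, β k * z k l‖ ^ 2 ≤
      ∑ k₁ ∈ K, ∑ k₂ ∈ K, ‖β k₁‖ * ‖β k₂‖ * ‖∑ l ∈ S, z k₁ l * (starRingEnd ℂ) (z k₂ l)‖ := by
  have h1 : ((∑ l ∈ S, ‖∑ k ∈ K, β k * z k l‖ ^ 2 : ℝ) : ℂ) =
      ∑ k₁ ∈ K, ∑ k₂ ∈ K, β k₁ * (starRingEnd ℂ) (β k₂) *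
        ∑ l ∈ S, z k₁ l * (starRingEnd ℂ) (z k₂ l) := by
    push_cast
    simp_rw [← Complex.mul_conj', map_sum, sum_mul_sum, mul_sum, map_mul]
    rw [sum_comm]
    refine sum_congr rfl fun k₁ _ => ?_
    rw [sum_comm]
    exact sum_congr rfl fun k₂ _ => sum_congr rfl fun l _ => by ring
  have h2 : 0 ≤ ∑ l ∈ S, ‖∑ k ∈ K, β k * z k l‖ ^ 2 := sum_nonneg fun _ _ => by positivity
  rw [← abs_of_nonneg h2, ← Real.norm_eq_abs, ← Complex.norm_real, h1]
  refine (norm_sum_le _ _).trans (sum_le_sum fun k₁ _ => (norm_sum_le _ _).trans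
    (sum_le_sum fun k₂ _ => ?_))
  rw [norm_mul, norm_mul, RCLike.norm_conj]

/-- Cauchy-Schwarz over l removes α. Of the at most H² pairs (k₁, k₂), the diagonal ones cost L each
and the others L/H each, so both groups contribute HL, and √H is saved over the trivial bound HL. -/
lemma norm_block_le (S K : Finset ℕ) (α β : ℕ → ℂ) (z : ℕ → ℕ → ℂ) (A B L H : ℝ)
    (hA : 0 ≤ A) (hB : 0 ≤ B) (hL : 0 ≤ L) (hH : 1 ≤ H)
    (hα : ∀ l ∈ S, ‖α l‖ ≤ A) (hβ : ∀ k ∈ K, ‖β k‖ ≤ B)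
    (hS : (S.card : ℝ) ≤ L) (hK : (K.card : ℝ) ≤ H) (hz : ∀ k ∈ K, ∀ l ∈ S, ‖z k l‖ ≤ 1)
    (hoff : ∀ k₁ ∈ K, ∀ k₂ ∈ K, k₂ < k₁ → ‖∑ l ∈ S, z k₁ l * (starRingEnd ℂ) (z k₂ l)‖ ≤ L / H) :
    ‖∑ k ∈ K, β k * ∑ l ∈ S, α l * z k l‖ ≤ 2 * A * B * L * √H := by
  have hoff' : ∀ k₁ ∈ K, ∀ k₂ ∈ K, k₁ ≠ k₂ →
      ‖∑ l ∈ S, z k₁ l * (starRingEnd ℂ) (z k₂ l)‖ ≤ L / H := by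
    intro k₁ h1 k₂ h2 hne
    rcases lt_or_gt_of_ne hne with h | h
    · rw [← RCLike.norm_conj, map_sum]
      simp_rw [map_mul, Complex.conj_conj]
      simp_rw [mul_comm ((starRingEnd ℂ) _)]
      exact hoff k₂ h2 k₁ h1 h
    · exact hoff k₁ h1 k₂ h2 h
  have hdiag : ∀ k ∈ K, ‖∑ l ∈ S, z k l * (starRingEnd ℂ) (z k l)‖ ≤ L := by
    intro k hk
    refine (norm_sum_le _ _).trans (le_trans ?_ hS)
    rw [← nsmul_one, ← sum_const]
    refine sum_le_sum fun l hl => ?_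
    rw [norm_mul, RCLike.norm_conj]
    have := hz k hk l hl
    exact mul_le_one₀ this (norm_nonneg _) this
  have hswap : ∑ k ∈ K, β k * ∑ l ∈ S, α l * z k l = ∑ l ∈ S, α l * ∑ k ∈ K, β k * z k l := by
    simp_rw [mul_sum]
    rw [sum_comm]
    exact sum_congr rfl fun _ _ => sum_congr rfl fun _ _ => by ring
  rw [hswap]
  have h1 : ‖∑ l ∈ S, α l * ∑ k ∈ K, β k * z k l‖ ≤ ∑ l ∈ S, ‖α l‖ * ‖∑ k ∈ K, β k * z k l‖ :=
    (norm_sum_le _ _).trans (le_of_eq (sum_congr rfl fun _ _ => norm_mul _ _))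
  have h2 := sum_mul_sq_le_sq_mul_sq S (fun l => ‖α l‖) (fun l => ‖∑ k ∈ K, β k * z k l‖)
  have h3 : ∑ l ∈ S, ‖α l‖ ^ 2 ≤ L * A ^ 2 := by
    refine (sum_le_sum fun l hl => pow_le_pow_left₀ (norm_nonneg _) (hα l hl) 2).trans ?_
    rw [sum_const, nsmul_eq_mul]; gcongr
  have h4 : ∑ l ∈ S, ‖∑ k ∈ K, β k * z k l‖ ^ 2 ≤ B ^ 2 * (2 * H * L) := by
    refine (sum_norm_sq_le S K β z).trans ?_
    have : ∀ k₁ ∈ K, ∑ k₂ ∈ K, ‖β k₁‖ * ‖β k₂‖ * ‖∑ l ∈ S, z k₁ l * (starRingEnd ℂ) (z k₂ l)‖ ≤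
        B ^ 2 * (2 * L) := by
      intro k₁ hk₁
      have h5 : ∀ k₂ ∈ K, ‖β k₁‖ * ‖β k₂‖ * ‖∑ l ∈ S, z k₁ l * (starRingEnd ℂ) (z k₂ l)‖ ≤
          B ^ 2 * (L / H + if k₂ = k₁ then L else 0) := by
        intro k₂ hk₂
        rw [sq]
        have hb := hβ k₁ hk₁
        have hb' := hβ k₂ hk₂
        gcongr
        by_cases h : k₂ = k₁
        · subst h
          rw [if_pos rfl]
          have : 0 ≤ L / H := by positivity
          linarith [hdiag k₂ hk₂]
        · rw [if_neg h, add_zero]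
          exact hoff' k₁ hk₁ k₂ hk₂ (Ne.symm h)
      refine (sum_le_sum h5).trans ?_
      rw [← mul_sum, sum_add_distrib, sum_ite_eq' K k₁, if_pos hk₁, sum_const, nsmul_eq_mul]
      gcongr
      have : K.card * (L / H) ≤ H * (L / H) := by gcongr
      rw [mul_div_cancel₀ _ (by linarith)] at this
      linarith
    refine (sum_le_sum this).trans ?_
    rw [sum_const, nsmul_eq_mul]
    calc K.card * (B ^ 2 * (2 * L)) ≤ H * (B ^ 2 * (2 * L)) := by gcongr
      _ = _ := by ring
  have h6 : (∑ l ∈ S, ‖α l‖ * ‖∑ k ∈ K, β k * z k l‖) ^ 2 ≤ (2 * A * B * L * √H) ^ 2 := by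
    refine h2.trans ((mul_le_mul h3 h4 (sum_nonneg fun _ _ => by positivity) (by positivity)).trans ?_)
    rw [mul_pow, Real.sq_sqrt (by linarith)]
    have : 0 ≤ (A * B * L) ^ 2 * H := by positivity
    nlinarith
  exact h1.trans (le_of_sq_le_sq h6 (by positivity))

/-- Extracts the root of order 2^q. The range k ≤ H² is that of the linear sums in Vaughan's
identity, and Z ≥ H² lets one condition serve both the linear and the bilinear sums. The power
H^(2^q) leaves room, since only a saving of √H is claimed here. -/
theorem norm_linearSum_le (q : ℕ) (hq : 1 ≤ q) (c₁ c₂ : ℝ) (hc₁ : 0 < c₁) (hc₂ : c₁ ≤ c₂) :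
    ∃ C : ℝ, 1 ≤ C ∧ ∀ (g : ℕ → ℝ → ℝ) (X H Z : ℕ) (V s ℓ : ℝ) (k a b : ℕ),
    PhaseBounds q c₁ c₂ X V s g → 1 ≤ H → H ^ 2 ≤ Z → 2 * Z ≤ X → 1 + Real.log (2 * X) ≤ ℓ →
    C * ℓ ^ q * (H * V + 1 / V) * H ^ (2 ^ q) * Z ≤ X →
    1 ≤ k → k ≤ H ^ 2 → X ≤ (a + 1) * k → b * k ≤ 2 * X →
    ‖∑ n ∈ Ioc a b, e (g 0 (n * k))‖ ≤ 2 * X / k / √H := by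
  obtain ⟨C, hC, hlin⟩ := norm_linearSum_pow_le q hq c₁ c₂ hc₁ hc₂
  refine ⟨C, hC, ?_⟩
  intro g X H Z V s ℓ k a b hg hH hHZ hZX hℓ hcond hk hkH haX hbX
  have hH' : (1 : ℝ) ≤ H := by exact_mod_cast hH
  have hk' : (1 : ℝ) ≤ k := by exact_mod_cast hk
  have hkH' : (k : ℝ) ≤ H ^ 2 := by exact_mod_cast hkH
  have hHZ' : (H : ℝ) ^ 2 ≤ Z := by exact_mod_cast hHZ
  have hX0 : (0 : ℝ) < X := by
    have : 0 < X := by nlinarith [pow_pos (show 0 < H by omega) 2]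
    exact_mod_cast this
  rcases lt_or_ge b a with hab | hab
  · rw [Ioc_eq_empty (by omega), sum_empty, norm_zero]; positivity
  have hV := hg.V_pos
  have hℓ1 : 1 ≤ ℓ := by
    have : 0 ≤ Real.log (2 * X) := Real.log_nonneg (by
      have : (1 : ℝ) ≤ X := by exact_mod_cast (by exact_mod_cast hX0 : 0 < X)
      linarith)
    linarith
  have h1 := hlin g X V s ℓ k a b hg hk (by omega) haX hbX hab hℓ
  set p := 2 ^ q with hp
  have hp1 : 1 ≤ p := Nat.one_le_two_pow
  refine le_of_pow_le_pow_left₀ (n := p) (by omega) (by positivity) (h1.trans ?_)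
  obtain ⟨m, hm⟩ : ∃ m, p = 2 * m := ⟨2 ^ (q - 1), by
    rw [hp, ← pow_succ']; congr 1; omega⟩
  have hm1 : 1 ≤ m := by omega
  have hsq : √(H : ℝ) ^ p = H ^ m := by
    rw [hm, pow_mul, Real.sq_sqrt (by positivity)]
  set D := (2 * X / k : ℝ) with hD
  have hD0 : 0 < D := by positivity
  have hDp : D ^ p = D ^ (p - 1) * D := by rw [← pow_succ, Nat.sub_add_cancel hp1]
  rw [div_pow D, hsq, hDp, le_div_iff₀ (by positivity)]
  have h2 : (k * V + 1 / (k * V)) ≤ H * (H * V + 1 / V) := by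
    have e1 : k * V ≤ H ^ 2 * V := by gcongr
    have e2 : 1 / (k * V) ≤ 1 / V := by
      apply one_div_le_one_div_of_le hV; nlinarith
    have e3 : 1 / V ≤ H * (1 / V) := by
      have : 0 < 1 / V := by positivity
      nlinarith
    nlinarith
  have h3 : C * ℓ ^ q * (k * V + 1 / (k * V)) * H ^ m ≤ D := by
    rw [hD, le_div_iff₀ (by linarith)]
    have e1 : (H : ℝ) * H ^ m ≤ H ^ p := by
      rw [hm, two_mul, pow_add]
      gcongr
      exact le_self_pow₀ hH' (by omega)
    calc C * ℓ ^ q * (k * V + 1 / (k * V)) * H ^ m * k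
        ≤ C * ℓ ^ q * (H * (H * V + 1 / V)) * H ^ m * Z := by gcongr; linarith
      _ = C * ℓ ^ q * (H * V + 1 / V) * (H * H ^ m) * Z := by ring
      _ ≤ C * ℓ ^ q * (H * V + 1 / V) * H ^ p * Z := by gcongr
      _ ≤ 2 * X := by linarith
  calc C * ℓ ^ q * D ^ (p - 1) * (k * V + 1 / (k * V)) * H ^ m
      = D ^ (p - 1) * (C * ℓ ^ q * (k * V + 1 / (k * V)) * H ^ m) := by ring
    _ ≤ D ^ (p - 1) * D := by gcongr

/-- The variable k is cut into blocks (iH, (i+1)H], so that k₁ - k₂ ≤ H inside a block and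
`norm_block_le` applies with H terms. The i-th block costs a multiple of X/(i√H), and the sum over i
gives ℓ. The parameter v is a second lower cutoff for l, needed for the hyperbola splitting. -/
theorem norm_bilinearSum_le (q : ℕ) (hq : 1 ≤ q) (c₁ c₂ : ℝ) (hc₁ : 0 < c₁) (hc₂ : c₁ ≤ c₂) :
    ∃ C : ℝ, 1 ≤ C ∧ ∀ (g : ℕ → ℝ → ℝ) (X X' H Z v : ℕ) (V s ℓ A B : ℝ) (α β : ℕ → ℂ),
    PhaseBounds q c₁ c₂ X V s g → 1 ≤ H → H ^ 2 ≤ Z → 2 * Z ≤ X → X' ≤ 2 * X →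
    1 + Real.log (2 * X) ≤ ℓ → C * ℓ ^ q * (H * V + 1 / V) * H ^ (2 ^ q) * Z ≤ X →
    0 ≤ A → 0 ≤ B → (∀ l, 1 ≤ l → l ≤ 2 * X → ‖α l‖ ≤ A) →
    (∀ l, 1 ≤ l → l ≤ 2 * X → ‖β l‖ ≤ B) →
    ‖∑ k ∈ Ioc H Z, β k * ∑ l ∈ Ioc (max v (X / k)) (X' / k), α l * e (g 0 (l * k))‖
      ≤ 4 * A * B * ℓ * X / √H := by
  obtain ⟨C, hC, hbil⟩ := norm_bilinearSum_pow_le q hq c₁ c₂ hc₁ hc₂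
  refine ⟨C, hC, ?_⟩
  intro g X X' H Z v V s ℓ A B α β hg hH hHZ hZX hX' hℓ hcond hA hB hα hβ
  have hH' : (1 : ℝ) ≤ H := by exact_mod_cast hH
  have hHZn : H ≤ Z := (Nat.le_self_pow (by norm_num) H).trans hHZ
  have hX0 : (0 : ℝ) < X := by exact_mod_cast (show 0 < X by omega)
  have hV := hg.V_pos
  have hℓ1 : 1 ≤ ℓ := by
    have : 0 ≤ Real.log (2 * X) := Real.log_nonneg (by
      have : (1 : ℝ) ≤ X := by exact_mod_cast (by exact_mod_cast hX0 : 0 < X)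
      linarith)
    linarith
  set p := 2 ^ q with hp
  have hp1 : 1 ≤ p := Nat.one_le_two_pow
  set f : ℕ → ℂ := fun k => β k * ∑ l ∈ Ioc (max v (X / k)) (X' / k), α l * e (g 0 (l * k)) with hf
  -- The shift by one makes the blocks half-open on the left, and k > H gives i ≥ 1, hence k ≤
  -- (i+1)H ≤ 2iH.
  have hmaps : ∀ k ∈ Ioc H Z, (k - 1) / H ∈ Ico 1 (Z / H + 1) := by
    intro k hk
    rw [mem_Ioc] at hk
    rw [mem_Ico]
    exact ⟨(Nat.le_div_iff_mul_le (by omega)).2 (by omega),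
      Nat.lt_succ_of_le (Nat.div_le_div_right (by omega))⟩
  rw [← sum_fiberwise_of_maps_to hmaps]
  have hblock : ∀ i ∈ Ico 1 (Z / H + 1), ‖∑ k ∈ Ioc H Z with (k - 1) / H = i, f k‖ ≤
      4 * A * B * X / √H * (1 / i) := by
    intro i hi
    rw [mem_Ico] at hi
    set k₀ := i * H with hk₀
    have hk₀1 : 1 ≤ k₀ := Nat.mul_pos hi.1 hH
    have hk₀r : (1 : ℝ) ≤ k₀ := by exact_mod_cast hk₀1
    have hi0 : (0 : ℝ) < i := by exact_mod_cast hi.1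
    set K := {k ∈ Ioc H Z | (k - 1) / H = i} with hKd
    have hKm : ∀ k ∈ K, k₀ < k ∧ k ≤ k₀ + H ∧ k ≤ Z := by
      intro k hk
      rw [hKd, mem_filter, mem_Ioc] at hk
      obtain ⟨⟨h1, h2⟩, h3⟩ := hk
      have h4 := Nat.div_mul_le_self (k - 1) H
      have h5 := Nat.lt_div_mul_add (a := k - 1) (b := H) (by omega)
      rw [h3, ← hk₀] at h4 h5
      omega
    set S := Ioc 0 (2 * X / k₀) with hS
    -- The range of l depends on k; hiding it in z gives all k of the block a common range S. A
    -- product of two such terms is again supported on an interval.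
    set z : ℕ → ℕ → ℂ := fun k l => if max v (X / k) < l ∧ l ≤ X' / k then e (g 0 (l * k)) else 0
      with hz
    have hfz : ∀ k ∈ K, f k = β k * ∑ l ∈ S, α l * z k l := by
      intro k hk
      obtain ⟨h1, h2, h3⟩ := hKm k hk
      simp only [hf, hz, mul_ite, mul_zero]
      rw [← sum_filter]
      congr 2
      ext l
      simp only [mem_Ioc, mem_filter, hS]
      have : X' / k ≤ 2 * X / k₀ := (Nat.div_le_div_right hX').trans (Nat.div_le_div_left h1.le hk₀1)
      omega
    rw [sum_congr rfl hfz]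
    have hmain := norm_block_le S K α β z A B (2 * X / k₀) H hA hB (by positivity) hH'
      (fun l hl => by
        rw [hS, mem_Ioc] at hl
        exact hα l hl.1 (hl.2.trans (Nat.div_le_self _ _)))
      (fun k hk => by
        obtain ⟨h1, h2, h3⟩ := hKm k hk
        exact hβ k (by omega) (by omega))
      (by
        rw [hS, Nat.card_Ioc, Nat.sub_zero]
        exact Nat.cast_div_le.trans (by push_cast; exact le_rfl))
      (by
        have : K ⊆ Ioc k₀ (k₀ + H) := fun k hk => by
          obtain ⟨h1, h2, h3⟩ := hKm k hk
          rw [mem_Ioc]; omega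
        have := card_le_card this
        rw [Nat.card_Ioc, Nat.add_sub_cancel_left] at this
        exact_mod_cast this)
      (fun k _ l _ => by
        simp only [hz]; split_ifs <;> simp [norm_e])
      (fun k₁ h1 k₂ h2 h21 => by
        obtain ⟨h11, h12, h13⟩ := hKm k₁ h1
        obtain ⟨h21', h22, h23⟩ := hKm k₂ h2
        have hHk : H ≤ k₀ := Nat.le_mul_of_pos_left H hi.1
        have hdiv : X' / k₁ ≤ X' / k₂ := Nat.div_le_div_left h21.le (by omega)
        have hdiv' : X / k₁ ≤ X / k₂ := Nat.div_le_div_left h21.le (by omega)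
        have heq : ∑ l ∈ S, z k₁ l * (starRingEnd ℂ) (z k₂ l) =
            ∑ l ∈ Ioc (max v (X / k₂)) (X' / k₁), e (g 0 (l * k₁) - g 0 (l * k₂)) := by
          rw [show Ioc (max v (X / k₂)) (X' / k₁) =
            {l ∈ S | max v (X / k₂) < l ∧ l ≤ X' / k₁} by
              ext l
              simp only [mem_Ioc, mem_filter, hS]
              have : X' / k₁ ≤ 2 * X / k₀ :=
                (Nat.div_le_div_right hX').trans (Nat.div_le_div_left h11.le hk₀1)
              omega, sum_filter]
          refine sum_congr rfl fun l _ => ?_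
          simp only [hz]
          by_cases hl : max v (X / k₂) < l ∧ l ≤ X' / k₁
          · rw [if_pos (by omega), if_pos (by omega), if_pos hl, e_sub]
          · rw [if_neg hl]
            by_cases hl2 : max v (X / k₂) < l ∧ l ≤ X' / k₂
            · rw [if_neg (by omega), zero_mul]
            · rw [if_neg hl2, map_zero, mul_zero]
        rw [heq]
        rcases lt_or_ge (X' / k₁) (max v (X / k₂)) with hab | hab
        · rw [Ioc_eq_empty (by omega), sum_empty, norm_zero]; positivity
        have hb := hbil g X V s ℓ k₀ k₁ k₂ _ _ hg hk₀1 h21'.le h21 (by omega) (by omega)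
          (by
            have h6 := Nat.lt_div_mul_add (a := X) (b := k₂) (by omega)
            have h7 : X / k₂ * k₂ ≤ max v (X / k₂) * k₂ := Nat.mul_le_mul_right _ (le_max_right _ _)
            rw [add_mul]; omega) ((Nat.div_mul_le_self _ _).trans hX') hab hℓ
        set D := (2 * X / k₀ : ℝ) with hD
        have hD0 : 0 < D := by positivity
        refine le_of_pow_le_pow_left₀ (n := p) (by omega) (by positivity) (hb.trans ?_)
        have hDp : D ^ p = D ^ (p - 1) * D := by rw [← pow_succ, Nat.sub_add_cancel hp1]
        have hr1 : (1 : ℝ) ≤ k₁ - k₂ := by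
          have : (k₂ : ℝ) + 1 ≤ k₁ := by exact_mod_cast h21
          linarith
        have hr2 : (k₁ - k₂ : ℝ) ≤ H := by
          have : (k₁ : ℝ) ≤ k₂ + H := by exact_mod_cast (by omega)
          linarith
        have h8 : ((k₁ - k₂ : ℝ) * V + 1 / ((k₁ - k₂ : ℝ) * V)) ≤ H * V + 1 / V := by
          gcongr
          nlinarith
        have hk₀Z : (k₀ : ℝ) ≤ Z := by exact_mod_cast (by omega)
        rw [div_pow D, hDp, le_div_iff₀ (by positivity)]
        calc C * ℓ ^ q * D ^ (p - 1) * ((k₁ - k₂ : ℝ) * V + 1 / ((k₁ - k₂ : ℝ) * V)) * H ^ p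
            ≤ C * ℓ ^ q * D ^ (p - 1) * (H * V + 1 / V) * H ^ p := by gcongr
          _ = D ^ (p - 1) * (C * ℓ ^ q * (H * V + 1 / V) * H ^ p) := by ring
          _ ≤ D ^ (p - 1) * D := by
            gcongr
            rw [hD, le_div_iff₀ (by linarith)]
            calc C * ℓ ^ q * (H * V + 1 / V) * H ^ p * k₀
                ≤ C * ℓ ^ q * (H * V + 1 / V) * H ^ p * Z := by gcongr
              _ ≤ 2 * X := by linarith)
    refine hmain.trans (le_of_eq ?_)
    have hs0 : 0 < √(H : ℝ) := Real.sqrt_pos.2 (by linarith)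
    rw [hk₀]; push_cast
    field_simp
    rw [Real.sq_sqrt (by linarith)]; ring
  refine (norm_sum_le _ _).trans ((sum_le_sum hblock).trans ?_)
  rw [← mul_sum]
  have hZH : Z / H ≤ Z := Nat.div_le_self _ _
  have := (sum_Ico_one_div_le (Z / H + 1) (2 * X) (by omega)).trans
    (by push_cast; exact hℓ)
  calc 4 * A * B * X / √H * ∑ i ∈ Ico 1 (Z / H + 1), 1 / (i : ℝ)
      ≤ 4 * A * B * X / √H * ℓ := by gcongr
    _ = _ := by ring

end ThinPrimes
end

noncomputable section
open Finset
namespace ThinPrimes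

/-! ### The divisor bound, Vaughan's identity and sums over the von Mangoldt function. -/

lemma natCast_add_one_le_two_rpow {ε : ℝ} (hε : 0 < ε) (v : ℕ) :
    (v + 1 : ℝ) ≤ (1 + 1 / (ε * Real.log 2)) * (2 : ℝ) ^ (ε * v) := by
  have hl : 0 < Real.log 2 := Real.log_pos (by norm_num)
  have h1 : 1 + ε * v * Real.log 2 ≤ (2 : ℝ) ^ (ε * v) := by
    rw [Real.rpow_def_of_pos (by norm_num)]
    have := Real.add_one_le_exp (Real.log 2 * (ε * v))
    linarith
  have h0 : 0 < 1 / (ε * Real.log 2) := by positivity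
  have h2 : (v : ℝ) = 1 / (ε * Real.log 2) * (ε * v * Real.log 2) := by field_simp
  have h3 : 0 ≤ ε * v * Real.log 2 := by positivity
  nlinarith

/-- Compare ∏(v+1) with ∏ p^(εv) prime by prime. If p ≥ 2^(1/ε), then p^(εv) ≥ 2^v ≥ v + 1. Each of
the boundedly many smaller primes costs at most a factor K. -/
lemma exists_card_divisors_le {ε : ℝ} (hε : 0 < ε) :
    ∃ C : ℝ, 1 ≤ C ∧ ∀ n : ℕ, 1 ≤ n → (n.divisors.card : ℝ) ≤ C * (n : ℝ) ^ ε := by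
  set K := 1 + 1 / (ε * Real.log 2) with hK
  have hK1 : 1 ≤ K := by
    have : 0 < 1 / (ε * Real.log 2) := by
      have := Real.log_pos (by norm_num : (1 : ℝ) < 2); positivity
    linarith
  obtain ⟨P, hP⟩ := exists_nat_ge ((2 : ℝ) ^ (1 / ε))
  refine ⟨K ^ P, one_le_pow₀ hK1, fun n hn => ?_⟩
  have hn0 : n ≠ 0 := by omega
  have hprod : (n : ℝ) ^ ε = ∏ p ∈ n.primeFactors, ((p : ℝ) ^ (n.factorization p)) ^ ε := by
    conv_lhs => rw [← Nat.prod_factorization_pow_eq_self hn0]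
    rw [Finsupp.prod, Nat.support_factorization]
    push_cast
    rw [Real.finsetProd_rpow]
    exact fun p _ => by positivity
  have hKP : ∏ p ∈ n.primeFactors, (if p < P then K else 1) ≤ K ^ P := by
    rw [← prod_filter, prod_const]
    refine pow_le_pow_right₀ hK1 ?_
    calc _ ≤ (range P).card := card_le_card fun p hp => by
            rw [mem_filter] at hp; exact mem_range.2 hp.2
      _ = P := card_range P
  rw [Nat.card_divisors hn0, hprod]
  push_cast
  refine le_trans ?_ (mul_le_mul_of_nonneg_right hKP (prod_nonneg fun p _ => by positivity))
  rw [← prod_mul_distrib]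
  refine prod_le_prod (fun p _ => by positivity) fun p hp => ?_
  have hp2 : 2 ≤ p := (Nat.prime_of_mem_primeFactors hp).two_le
  have hp2' : (2 : ℝ) ≤ p := by exact_mod_cast hp2
  set v := n.factorization p
  have hpow : ((p : ℝ) ^ v) ^ ε = ((p : ℝ) ^ ε) ^ v := by
    rw [← Real.rpow_natCast, ← Real.rpow_natCast, ← Real.rpow_mul (by positivity),
      ← Real.rpow_mul (by positivity), mul_comm]
  rw [hpow]
  split_ifs with h
  · refine (natCast_add_one_le_two_rpow hε v).trans ?_
    rw [Real.rpow_mul (by norm_num), Real.rpow_natCast, hK]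
    gcongr
  · rw [one_mul]
    push Not at h
    have h1 : (2 : ℝ) ≤ (p : ℝ) ^ ε := by
      have h2 : (2 : ℝ) ^ (1 / ε) ≤ p := hP.trans (by exact_mod_cast h)
      have h3 := Real.rpow_le_rpow (by positivity) h2 hε.le
      rwa [← Real.rpow_mul (by norm_num), one_div_mul_cancel hε.ne', Real.rpow_one] at h3
    have h4 : (v + 1 : ℝ) ≤ 2 ^ v := by exact_mod_cast Nat.lt_two_pow_self (n := v)
    exact h4.trans (by gcongr)

open ArithmeticFunction

/-- The truncation of an arithmetic function to `[1, H]`. -/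
def truncate (f : ArithmeticFunction ℝ) (H : ℕ) : ArithmeticFunction ℝ :=
  ⟨fun n => if n ≤ H then f n else 0, by simp⟩

lemma truncate_apply (f : ArithmeticFunction ℝ) (H n : ℕ) :
    truncate f H n = if n ≤ H then f n else 0 := rfl

/-- Expand the last product, using Λ * ζ = log and μ * ζ = 1. -/
lemma vaughan_identity (H : ℕ) :
    (vonMangoldt : ArithmeticFunction ℝ) = truncate vonMangoldt H +
      truncate (↑moebius) H * ArithmeticFunction.log
      - (truncate (↑moebius) H * truncate vonMangoldt H) * ↑zeta
      + (((↑moebius : ArithmeticFunction ℝ) - truncate (↑moebius) H) * ↑zeta) *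
        (vonMangoldt - truncate vonMangoldt H) := by
  have h1 : (vonMangoldt : ArithmeticFunction ℝ) * ↑zeta = ArithmeticFunction.log :=
    vonMangoldt_mul_zeta
  have h2 : (↑moebius : ArithmeticFunction ℝ) * ↑zeta = 1 := coe_moebius_mul_coe_zeta
  linear_combination truncate (↑moebius) H * h1 - (vonMangoldt - truncate vonMangoldt H) * h2

lemma sum_Ioc_mul_eq (f g : ArithmeticFunction ℝ) (E : ℕ → ℂ) (X X' : ℕ) :
    ∑ n ∈ Ioc X X', ((f * g) n : ℂ) * E n =
      ∑ k ∈ Ioc 0 X', (f k : ℂ) * ∑ l ∈ Ioc (X / k) (X' / k), (g l : ℂ) * E (l * k) := by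
  have h1 : ∀ n ∈ Ioc X X', ((f * g) n : ℂ) * E n =
      ∑ x ∈ {x ∈ {x ∈ Ioc 0 X' ×ˢ Ioc 0 X' | X < x.1 * x.2 ∧ x.1 * x.2 ≤ X'} | x.1 * x.2 = n},
        (f x.1 : ℂ) * ((g x.2 : ℂ) * E (x.2 * x.1)) := by
    intro n hn
    rw [mem_Ioc] at hn
    rw [ArithmeticFunction.mul_apply, Nat.divisorsAntidiagonal_eq_prod_filter_of_le (by omega) hn.2]
    push_cast
    rw [sum_mul, filter_filter]
    refine sum_congr ?_ fun x hx => ?_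
    · ext x
      simp only [mem_filter]
      constructor
      · rintro ⟨h, h2⟩; exact ⟨h, ⟨by omega, by omega⟩, h2⟩
      · rintro ⟨h, _, h2⟩; exact ⟨h, h2⟩
    · rw [mem_filter] at hx
      rw [← hx.2.2, mul_comm x.2 x.1]; ring
  rw [sum_congr rfl h1, sum_fiberwise_of_maps_to (fun x hx => by
    rw [mem_filter] at hx; exact mem_Ioc.2 hx.2)]
  rw [sum_filter, sum_product]
  refine sum_congr rfl fun k hk => ?_
  rw [mem_Ioc] at hk
  dsimp only
  rw [← sum_filter, ← mul_sum]
  congr 1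
  refine sum_congr ?_ fun _ _ => rfl
  ext l
  simp only [mem_filter, mem_Ioc]
  rw [Nat.div_lt_iff_lt_mul hk.1, Nat.le_div_iff_mul_le hk.1, mul_comm l k]
  constructor
  · rintro ⟨_, h⟩; exact h
  · rintro ⟨h, h'⟩
    refine ⟨⟨?_, ?_⟩, h, h'⟩
    · rcases Nat.eq_zero_or_pos l with h0 | h0
      · subst h0; simp at h
      · exact h0
    · exact (Nat.le_mul_of_pos_left l hk.1).trans h'

lemma arithmeticFunction_sub_apply (f g : ArithmeticFunction ℝ) (n : ℕ) :
    (f - g) n = f n - g n := rfl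

lemma abs_moebius_sub_truncate_le (H n : ℕ) :
    |((↑moebius : ArithmeticFunction ℝ) - truncate (↑moebius) H) n| ≤ 1 := by
  have h : |((↑moebius : ArithmeticFunction ℝ) n)| ≤ 1 := by
    rw [intCoe_apply]; exact_mod_cast abs_moebius_le_one
  rw [arithmeticFunction_sub_apply, truncate_apply]
  split_ifs
  · simp
  · simpa using h

lemma abs_moebiusTail_mul_zeta_le (H n : ℕ) :
    |(((↑moebius : ArithmeticFunction ℝ) - truncate (↑moebius) H) * ↑zeta) n| ≤
      n.divisors.card := by
  rw [coe_mul_zeta_apply]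
  refine (abs_sum_le_sum_abs _ _).trans ?_
  refine (sum_le_sum fun d _ => abs_moebius_sub_truncate_le H d).trans ?_
  simp

lemma moebiusTail_mul_zeta_eq_zero (H n : ℕ) (hn : n ≤ H) :
    (((↑moebius : ArithmeticFunction ℝ) - truncate (↑moebius) H) * ↑zeta) n = 0 := by
  rw [coe_mul_zeta_apply]
  refine sum_eq_zero fun d hd => ?_
  rw [arithmeticFunction_sub_apply, truncate_apply, if_pos ((Nat.divisor_le hd).trans hn), sub_self]

/-- Partial summation: the logarithm is increasing, so its variation telescopes. -/
lemma norm_log_mul_sum_le (z : ℕ → ℂ) (a b : ℕ) (U ℓ : ℝ) (hab : a ≤ b)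
    (hU : ∀ y, a ≤ y → y ≤ b → ‖∑ n ∈ Ioc a y, z n‖ ≤ U) (hℓ : Real.log b ≤ ℓ) :
    ‖∑ n ∈ Ioc a b, ((Real.log n : ℝ) : ℂ) * z n‖ ≤ U * (2 * ℓ) := by
  have hU0 : 0 ≤ U := (norm_nonneg _).trans (hU a le_rfl hab)
  have hlog : ∀ n : ℕ, 0 ≤ Real.log n := fun n => Real.log_natCast_nonneg n
  refine (norm_sum_Ioc_mul_le (fun n => ((Real.log n : ℝ) : ℂ)) z a b hab U hU).trans ?_
  refine mul_le_mul_of_nonneg_left ?_ hU0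
  have h1 : ∀ n ∈ Ico (a + 1) b, ‖((Real.log ((n + 1 : ℕ) : ℝ) : ℝ) : ℂ) - ((Real.log n : ℝ) : ℂ)‖ =
      Real.log ((n + 1 : ℕ) : ℝ) - Real.log n := by
    intro n hn
    rw [mem_Ico] at hn
    rw [← Complex.ofReal_sub, Complex.norm_real, Real.norm_eq_abs, abs_of_nonneg]
    have h0 : (0 : ℝ) < n := by exact_mod_cast (by omega)
    have := Real.log_le_log h0 (by push_cast; linarith : (n : ℝ) ≤ ((n + 1 : ℕ) : ℝ))
    linarith
  rw [sum_congr rfl h1, Complex.norm_real, Real.norm_eq_abs, abs_of_nonneg (hlog b)]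
  rcases Nat.lt_or_ge b (a + 1) with h | h
  · rw [Ico_eq_empty (by omega), sum_empty]
    linarith [hlog b]
  · rw [sum_Ico_sub (fun n : ℕ => Real.log n) h]
    linarith [hlog (a + 1)]

-- Vaughan's identity gives linear sums with k ≤ H and k ≤ H², and a bilinear sum in which both
-- variables exceed H. In the latter the smaller variable is at most √(2X), which allows
-- `norm_bilinearSum_le` after a hyperbola splitting. The second conclusion is the linear bound with
-- k = 1; it serves the Fejér kernels.
set_option maxHeartbeats 2000000 in
theorem norm_vonMangoldtSum_le (q : ℕ) (hq : 1 ≤ q) (c₁ c₂ : ℝ) (hc₁ : 0 < c₁) (hc₂ : c₁ ≤ c₂) :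
    ∃ C : ℝ, 1 ≤ C ∧ ∀ (g : ℕ → ℝ → ℝ) (X X' H : ℕ) (V s ℓ τ : ℝ),
    PhaseBounds q c₁ c₂ X V s g → X ≤ X' → X' ≤ 2 * X → 1 ≤ X → 1 ≤ H →
    1 + Real.log (2 * X) ≤ ℓ → C * ℓ ^ q * (H * V + 1 / V) * H ^ (2 ^ q) ≤ √X →
    (∀ n : ℕ, 1 ≤ n → n ≤ 2 * X → (n.divisors.card : ℝ) ≤ τ) →
    ‖∑ n ∈ Ioc X X', (vonMangoldt n : ℂ) * e (g 0 n)‖ ≤ 20 * τ * ℓ ^ 2 * X / √H ∧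
    ‖∑ n ∈ Ioc X X', e (g 0 n)‖ ≤ 2 * X / √H := by
  obtain ⟨C₁, hC₁, hlin⟩ := norm_linearSum_le q hq c₁ c₂ hc₁ hc₂
  obtain ⟨C₂, hC₂, hbil⟩ := norm_bilinearSum_le q hq c₁ c₂ hc₁ hc₂
  refine ⟨2 * (C₁ + C₂) + 2, by linarith, ?_⟩
  intro g X X' H V s ℓ τ hg hXX' hX' hX hH hℓ hcond hτ
  have hV := hg.V_pos
  have hH' : (1 : ℝ) ≤ H := by exact_mod_cast hH
  have hXr : (1 : ℝ) ≤ X := by exact_mod_cast hX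
  have hsX : 1 ≤ √(X : ℝ) := Real.one_le_sqrt.2 hXr
  have hlog0 : 0 ≤ Real.log (2 * X) := Real.log_nonneg (by linarith)
  have hℓ1 : 1 ≤ ℓ := by linarith
  have hℓq : 1 ≤ ℓ ^ q := one_le_pow₀ hℓ1
  set p := 2 ^ q with hp
  have hp2 : 2 ≤ p := by rw [hp]; exact Nat.le_self_pow (by omega) 2
  have hVV : 2 ≤ H * V + 1 / V := by
    have h1 : V ≤ H * V := by nlinarith
    have h2 : 2 ≤ V + 1 / V := by
      have : V + 1 / V - 2 = (V - 1) ^ 2 / V := by field_simp; ring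
      have : 0 ≤ (V - 1) ^ 2 / V := by positivity
      linarith
    linarith
  -- A product kl ≤ 2X has a factor at most Z, while Z ≤ 2√X turns the hypothesis involving √X into
  -- the condition with the factor Z.
  set Z := Nat.sqrt (2 * X) with hZ
  have hZ1 : Z * Z ≤ 2 * X := Nat.sqrt_le _
  have hZ2 : 2 * X < (Z + 1) * (Z + 1) := Nat.lt_succ_sqrt _
  have hZr : (Z : ℝ) ≤ 2 * √X := by
    have h1 : (Z : ℝ) * Z ≤ 2 * X := by exact_mod_cast hZ1
    have h2 : √(X : ℝ) * √X = X := Real.mul_self_sqrt (by positivity)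
    have h3 : 0 ≤ √(X : ℝ) := by positivity
    nlinarith
  have hcondC : ∀ C : ℝ, 0 ≤ C → 2 * C ≤ 2 * (C₁ + C₂) + 2 →
      C * ℓ ^ q * (H * V + 1 / V) * H ^ p * Z ≤ X := by
    intro C hC0 hCC
    calc C * ℓ ^ q * (H * V + 1 / V) * H ^ p * Z
        ≤ C * ℓ ^ q * (H * V + 1 / V) * H ^ p * (2 * √X) := by gcongr
      _ = (2 * C) * ℓ ^ q * (H * V + 1 / V) * H ^ p * √X := by ring
      _ ≤ (2 * (C₁ + C₂) + 2) * ℓ ^ q * (H * V + 1 / V) * H ^ p * √X := by gcongr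
      _ ≤ √X * √X := by gcongr
      _ = X := Real.mul_self_sqrt (by positivity)
  have hHX : 8 * (H : ℝ) ^ 2 ≤ √X := by
    refine le_trans ?_ hcond
    have h1 : (H : ℝ) ^ 2 ≤ H ^ p := pow_le_pow_right₀ hH' hp2
    have h4 : 4 ≤ (2 * (C₁ + C₂) + 2) * ℓ ^ q := by nlinarith
    calc 8 * (H : ℝ) ^ 2 = 4 * 2 * H ^ 2 := by ring
      _ ≤ (2 * (C₁ + C₂) + 2) * ℓ ^ q * (H * V + 1 / V) * H ^ p := by gcongr
  have hsXZ : √(X : ℝ) ≤ Z + 1 := by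
    refine Real.sqrt_le_iff.2 ⟨by positivity, ?_⟩
    have : (2 * X : ℝ) < (Z + 1) * (Z + 1) := by exact_mod_cast hZ2
    nlinarith
  have hHZ : H ^ 2 ≤ Z := by
    have : (H : ℝ) ^ 2 ≤ Z := by nlinarith
    exact_mod_cast this
  have h8 : 8 ≤ √(X : ℝ) := by nlinarith
  have hX64 : 64 ≤ X := by
    have : (64 : ℝ) ≤ X := by
      rw [← Real.mul_self_sqrt (by positivity : (0 : ℝ) ≤ X)]; nlinarith
    exact_mod_cast this
  have hZX : 2 * Z ≤ X := by
    by_contra hcon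
    push Not at hcon
    nlinarith
  have hHX2 : H ≤ X := by nlinarith [Nat.le_self_pow (show 2 ≠ 0 by norm_num) H]
  have hτ1 : 1 ≤ τ := by simpa using hτ 1 le_rfl (by omega)
  have hlinX : ∀ k a b : ℕ, 1 ≤ k → k ≤ H ^ 2 → X ≤ (a + 1) * k → b * k ≤ 2 * X →
      ‖∑ n ∈ Ioc a b, e (g 0 (n * k))‖ ≤ 2 * X / k / √H := fun k a b =>
    hlin g X H Z V s ℓ k a b hg hH hHZ hZX hℓ (hcondC C₁ (by linarith) (by linarith))
  have hbilX := fun (v : ℕ) (A B : ℝ) (α β : ℕ → ℂ) =>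
    hbil g X X' H Z v V s ℓ A B α β hg hH hHZ hZX hX' hℓ (hcondC C₂ (by linarith) (by linarith))
  have hdivlow : ∀ k, 1 ≤ k → X ≤ (X / k + 1) * k := fun k hk => by
    have := Nat.lt_div_mul_add (a := X) (b := k) hk
    rw [add_mul]; omega
  refine ⟨?_, ?_⟩
  swap
  · have := hlinX 1 X X' le_rfl (Nat.one_le_pow _ _ hH) (by omega) (by omega)
    simpa using this
  have hlogn : ∀ n : ℕ, n ≤ 2 * X → Real.log n ≤ ℓ := by
    intro n hn
    rcases Nat.eq_zero_or_pos n with h0 | h0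
    · subst h0; simp; linarith
    · have : Real.log n ≤ Real.log (2 * X) :=
        Real.log_le_log (by exact_mod_cast h0) (by exact_mod_cast hn)
      linarith
  have hsum_inv : ∀ N, N + 1 ≤ 2 * X → ∑ k ∈ Ioc 0 N, 1 / (k : ℝ) ≤ ℓ := by
    intro N hN
    rw [show Ioc 0 N = Ico 1 (N + 1) by ext; simp; omega]
    exact (sum_Ico_one_div_le (N + 1) (2 * X) hN).trans (by push_cast; exact hℓ)
  set E : ℕ → ℂ := fun n => e (g 0 n) with hE
  set T := X / √(H : ℝ) with hT
  have hT0 : 0 ≤ T := by positivity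
  set M₁ := truncate (↑moebius) H with hM₁
  set L₁ := truncate vonMangoldt H with hL₁
  have hM₁b : ∀ k, |M₁ k| ≤ 1 := by
    intro k
    have h : |((↑moebius : ArithmeticFunction ℝ) k)| ≤ 1 := by
      rw [intCoe_apply]; exact_mod_cast abs_moebius_le_one
    rw [hM₁, truncate_apply]; split_ifs
    · exact h
    · simp
  have hL₁b : ∀ k, 0 ≤ L₁ k ∧ L₁ k ≤ vonMangoldt k := by
    intro k
    rw [hL₁, truncate_apply]; split_ifs
    · exact ⟨vonMangoldt_nonneg, le_rfl⟩
    · exact ⟨le_rfl, vonMangoldt_nonneg⟩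
  -- the contribution of `M₁ * log`
  have hS1 : ‖∑ n ∈ Ioc X X', ((M₁ * ArithmeticFunction.log) n : ℂ) * E n‖ ≤ 4 * ℓ ^ 2 * T := by
    rw [sum_Ioc_mul_eq]
    refine (norm_sum_le _ _).trans ?_
    have hterm : ∀ k ∈ Ioc 0 X', ‖(M₁ k : ℂ) * ∑ l ∈ Ioc (X / k) (X' / k),
        (ArithmeticFunction.log l : ℂ) * E (l * k)‖ ≤
        if k ≤ H then 4 * ℓ * T * (1 / k) else 0 := by
      intro k hk
      rw [mem_Ioc] at hk
      split_ifs with hkH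
      · rw [norm_mul, Complex.norm_real, Real.norm_eq_abs]
        have hab : X / k ≤ X' / k := Nat.div_le_div_right hXX'
        have hin := norm_log_mul_sum_le (fun l => E (l * k)) (X / k) (X' / k) (2 * X / k / √H) ℓ hab
          (fun y _ hy => by
            have := hlinX k (X / k) y hk.1 (hkH.trans (Nat.le_self_pow (by norm_num) H))
              (hdivlow k hk.1) (((Nat.mul_le_mul_right k hy).trans (Nat.div_mul_le_self _ _)).trans hX')
            simpa [hE] using this) (hlogn _ ((Nat.div_le_self _ _).trans hX'))
        calc |M₁ k| * ‖∑ l ∈ Ioc (X / k) (X' / k), (ArithmeticFunction.log l : ℂ) * E (l * k)‖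
            ≤ 1 * (2 * X / k / √H * (2 * ℓ)) := by
              gcongr
              · exact hM₁b k
              · exact hin
          _ = _ := by rw [hT]; ring
      · rw [hM₁, truncate_apply, if_neg hkH]; simp
    refine (sum_le_sum hterm).trans ?_
    rw [← sum_filter, ← mul_sum]
    have : ∑ k ∈ Ioc 0 X' with k ≤ H, 1 / (k : ℝ) ≤ ℓ := by
      rw [show {k ∈ Ioc 0 X' | k ≤ H} = Ioc 0 H by
        ext; simp only [mem_filter, mem_Ioc]; omega]
      exact hsum_inv H (by omega)
    calc 4 * ℓ * T * ∑ k ∈ Ioc 0 X' with k ≤ H, 1 / (k : ℝ) ≤ 4 * ℓ * T * ℓ := by gcongr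
      _ = _ := by ring
  -- the contribution of `M₁ * L₁ * ζ`
  have hc : ∀ k, k ≤ 2 * X → |(M₁ * L₁) k| ≤ ℓ := by
    intro k hk
    rw [ArithmeticFunction.mul_apply]
    refine (abs_sum_le_sum_abs _ _).trans ?_
    have : ∀ x ∈ k.divisorsAntidiagonal, |M₁ x.1 * L₁ x.2| ≤ vonMangoldt x.2 := by
      intro x _
      rw [abs_mul, abs_of_nonneg (hL₁b x.2).1]
      have h1 := hM₁b x.1
      obtain ⟨h2, h3⟩ := hL₁b x.2
      nlinarith [abs_nonneg (M₁ x.1)]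
    refine (sum_le_sum this).trans ?_
    rw [Nat.sum_divisorsAntidiagonal' (fun _ y => vonMangoldt y), vonMangoldt_sum]
    exact hlogn k hk
  have hc0 : ∀ k, H ^ 2 < k → (M₁ * L₁) k = 0 := by
    intro k hk
    rw [ArithmeticFunction.mul_apply]
    refine sum_eq_zero fun x hx => ?_
    rw [Nat.mem_divisorsAntidiagonal] at hx
    rw [hM₁, hL₁, truncate_apply, truncate_apply]
    by_cases h1 : x.1 ≤ H
    · by_cases h2 : x.2 ≤ H
      · exfalso
        have := Nat.mul_le_mul h1 h2
        rw [hx.1] at this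
        rw [sq] at hk; omega
      · rw [if_neg h2, mul_zero]
    · rw [if_neg h1, zero_mul]
  have hS2 : ‖∑ n ∈ Ioc X X', (((M₁ * L₁) * ↑zeta : ArithmeticFunction ℝ) n : ℂ) * E n‖ ≤
      2 * ℓ ^ 2 * T := by
    rw [sum_Ioc_mul_eq]
    refine (norm_sum_le _ _).trans ?_
    have hterm : ∀ k ∈ Ioc 0 X', ‖((M₁ * L₁) k : ℂ) * ∑ l ∈ Ioc (X / k) (X' / k),
        ((↑zeta : ArithmeticFunction ℝ) l : ℂ) * E (l * k)‖ ≤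
        if k ≤ H ^ 2 then 2 * ℓ * T * (1 / k) else 0 := by
      intro k hk
      rw [mem_Ioc] at hk
      split_ifs with hkH
      · rw [norm_mul, Complex.norm_real, Real.norm_eq_abs]
        have hin := hlinX k (X / k) (X' / k) hk.1 hkH (hdivlow k hk.1)
          ((Nat.div_mul_le_self _ _).trans hX')
        have heq : ∑ l ∈ Ioc (X / k) (X' / k), ((↑zeta : ArithmeticFunction ℝ) l : ℂ) * E (l * k) =
            ∑ n ∈ Ioc (X / k) (X' / k), e (g 0 (n * k)) := by
          refine sum_congr rfl fun l hl => ?_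
          rw [mem_Ioc] at hl
          rw [natCoe_apply, zeta_apply_ne (Nat.ne_zero_of_lt hl.1)]
          simp [hE]
        rw [heq]
        calc |(M₁ * L₁) k| * ‖∑ n ∈ Ioc (X / k) (X' / k), e (g 0 (n * k))‖
            ≤ ℓ * (2 * X / k / √H) := by
              gcongr
              exact hc k (by omega)
          _ = _ := by rw [hT]; ring
      · rw [hc0 k (by omega)]; simp
    refine (sum_le_sum hterm).trans ?_
    rw [← sum_filter, ← mul_sum]
    have : ∑ k ∈ Ioc 0 X' with k ≤ H ^ 2, 1 / (k : ℝ) ≤ ℓ := by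
      rw [show {k ∈ Ioc 0 X' | k ≤ H ^ 2} = Ioc 0 (H ^ 2) by
        ext; simp only [mem_filter, mem_Ioc]; omega]
      exact hsum_inv (H ^ 2) (by omega)
    calc 2 * ℓ * T * ∑ k ∈ Ioc 0 X' with k ≤ H ^ 2, 1 / (k : ℝ) ≤ 2 * ℓ * T * ℓ := by gcongr
      _ = _ := by ring
  -- the bilinear contribution
  set b := ((↑moebius : ArithmeticFunction ℝ) - M₁) * ↑zeta with hb
  set a := vonMangoldt - L₁ with ha
  have haz : ∀ l, l ≤ H → a l = 0 := by
    intro l hl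
    rw [ha, arithmeticFunction_sub_apply, hL₁, truncate_apply, if_pos hl, sub_self]
  have hab : ∀ l, 1 ≤ l → l ≤ 2 * X → ‖(a l : ℂ)‖ ≤ ℓ := by
    intro l _ hl
    rw [Complex.norm_real, Real.norm_eq_abs, ha, arithmeticFunction_sub_apply]
    obtain ⟨h2, h3⟩ := hL₁b l
    rw [abs_of_nonneg (by linarith)]
    have := vonMangoldt_le_log (n := l)
    linarith [hlogn l hl]
  have hbb : ∀ l, 1 ≤ l → l ≤ 2 * X → ‖(b l : ℂ)‖ ≤ τ := by
    intro l hl hl'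
    rw [Complex.norm_real, Real.norm_eq_abs]
    exact (abs_moebiusTail_mul_zeta_le H l).trans (hτ l hl hl')
  have hS3 : ‖∑ n ∈ Ioc X X', ((b * a) n : ℂ) * E n‖ ≤ 8 * τ * ℓ ^ 2 * T := by
    rw [sum_Ioc_mul_eq]
    -- Either k ≤ Z, or k > Z and then l ≤ Z; in the second case the roles of the variables are
    -- exchanged and k > Z becomes the cutoff v = Z. Terms with k ≤ H or l ≤ H vanish.
    have hsplit : ∑ k ∈ Ioc 0 X', (b k : ℂ) * ∑ l ∈ Ioc (X / k) (X' / k), (a l : ℂ) * E (l * k) =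
        ∑ k ∈ Ioc H Z, (b k : ℂ) * ∑ l ∈ Ioc (max 0 (X / k)) (X' / k), (a l : ℂ) * e (g 0 (l * k)) +
        ∑ l ∈ Ioc H Z, (a l : ℂ) * ∑ k ∈ Ioc (max Z (X / l)) (X' / l), (b k : ℂ) * e (g 0 (k * l))
        := by
      have hZX' : Z ≤ X' := by omega
      rw [← sum_Ioc_consecutive _ (Nat.zero_le Z) hZX']
      congr 1
      · have hHZ' : H ≤ Z := (Nat.le_self_pow (by norm_num) H).trans hHZ
        rw [← sum_Ioc_consecutive _ (Nat.zero_le H) hHZ', sum_eq_zero, zero_add]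
        · refine sum_congr rfl fun k _ => ?_
          rw [Nat.zero_max]
          simp [hE]
        · intro k hk
          rw [mem_Ioc] at hk
          rw [hb, hM₁, moebiusTail_mul_zeta_eq_zero H k hk.2]; simp
      · have h1 : ∀ k ∈ Ioc Z X', (b k : ℂ) * ∑ l ∈ Ioc (X / k) (X' / k), (a l : ℂ) * E (l * k) =
            ∑ l ∈ Ioc H Z, if X < l * k ∧ l * k ≤ X' then
              (a l : ℂ) * ((b k : ℂ) * e (g 0 (k * l))) else 0 := by
          intro k hk
          rw [mem_Ioc] at hk
          rw [← sum_filter, mul_sum]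
          have hsub : {l ∈ Ioc H Z | X < l * k ∧ l * k ≤ X'} ⊆ Ioc (X / k) (X' / k) := by
            intro l hl
            rw [mem_filter] at hl
            rw [mem_Ioc, Nat.div_lt_iff_lt_mul (by omega), Nat.le_div_iff_mul_le (by omega)]
            exact hl.2
          rw [← sum_subset hsub]
          · refine sum_congr rfl fun l _ => ?_
            simp only [hE]; push_cast; rw [mul_comm (k : ℝ)]; ring
          · intro l hl hl'
            rw [mem_Ioc, Nat.div_lt_iff_lt_mul (by omega), Nat.le_div_iff_mul_le (by omega)] at hl
            have : l ≤ H := by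
              by_contra hcon
              refine hl' ?_
              rw [mem_filter, mem_Ioc]
              refine ⟨⟨by omega, ?_⟩, hl⟩
              by_contra hcon2
              have : (Z + 1) * (Z + 1) ≤ l * k := Nat.mul_le_mul (by omega) (by omega)
              omega
            rw [haz l this]; simp
        rw [sum_congr rfl h1, sum_comm]
        refine sum_congr rfl fun l hl => ?_
        rw [mem_Ioc] at hl
        rw [← sum_filter, mul_sum]
        refine sum_congr ?_ fun _ _ => rfl
        ext k
        rw [mem_filter, mem_Ioc, mem_Ioc, max_lt_iff, Nat.div_lt_iff_lt_mul (by omega),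
          Nat.le_div_iff_mul_le (by omega), mul_comm l k]
        constructor
        · rintro ⟨⟨h1, h2⟩, h3, h4⟩; exact ⟨⟨h1, h3⟩, h4⟩
        · rintro ⟨⟨h1, h3⟩, h4⟩
          exact ⟨⟨h1, (Nat.le_mul_of_pos_right k (by omega)).trans h4⟩, h3, h4⟩
    rw [hsplit]
    have t1 := hbilX 0 ℓ τ (fun l => (a l : ℂ)) (fun l => (b l : ℂ)) (by linarith) (by linarith)
      hab hbb
    have t2 := hbilX Z τ ℓ (fun l => (b l : ℂ)) (fun l => (a l : ℂ)) (by linarith) (by linarith)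
      hbb hab
    refine (norm_add_le _ _).trans ((add_le_add t1 t2).trans (le_of_eq ?_))
    rw [hT]; ring
  have hV : ∑ n ∈ Ioc X X', (vonMangoldt n : ℂ) * E n =
      ∑ n ∈ Ioc X X', ((M₁ * ArithmeticFunction.log) n : ℂ) * E n
      - ∑ n ∈ Ioc X X', (((M₁ * L₁) * ↑zeta : ArithmeticFunction ℝ) n : ℂ) * E n
      + ∑ n ∈ Ioc X X', ((b * a) n : ℂ) * E n := by
    rw [← sum_sub_distrib, ← sum_add_distrib]
    refine sum_congr rfl fun n hn => ?_
    rw [mem_Ioc] at hn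
    have h := congrArg (fun f : ArithmeticFunction ℝ => f n) (vaughan_identity H)
    simp only [ArithmeticFunction.add_apply, arithmeticFunction_sub_apply] at h
    rw [← hM₁, ← hL₁, ← hb, ← ha] at h
    -- The first term of Vaughan's identity is absent, as n > X ≥ H.
    have hz : L₁ n = 0 := by rw [hL₁, truncate_apply, if_neg (by omega)]
    rw [h, hz]
    push_cast; ring
  rw [hV]
  have h1 := norm_add_le (∑ n ∈ Ioc X X', ((M₁ * ArithmeticFunction.log) n : ℂ) * E n
      - ∑ n ∈ Ioc X X', (((M₁ * L₁) * ↑zeta : ArithmeticFunction ℝ) n : ℂ) * E n)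
      (∑ n ∈ Ioc X X', ((b * a) n : ℂ) * E n)
  have h2 := norm_sub_le (∑ n ∈ Ioc X X', ((M₁ * ArithmeticFunction.log) n : ℂ) * E n)
      (∑ n ∈ Ioc X X', (((M₁ * L₁) * ↑zeta : ArithmeticFunction ℝ) n : ℂ) * E n)
  have h3 : 0 ≤ ℓ ^ 2 * T := by positivity
  have h4 : ℓ ^ 2 * T ≤ τ * (ℓ ^ 2 * T) := by nlinarith
  calc _ ≤ 4 * ℓ ^ 2 * T + 2 * ℓ ^ 2 * T + 8 * τ * ℓ ^ 2 * T := by linarith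
    _ ≤ 20 * (τ * (ℓ ^ 2 * T)) := by linarith
    _ = _ := by rw [hT]; ring

end ThinPrimes
end

noncomputable section
open Finset
namespace ThinPrimes

/-! ### The sawtooth function: truncated Fourier series and a Fejér majorant of the error. -/

lemma sin_mul_dirichlet (M : ℕ) (x : ℝ) :
    Real.sin (Real.pi * x) * (1 + ∑ m ∈ Icc 1 M, 2 * Real.cos (2 * Real.pi * m * x)) =
      Real.sin ((2 * M + 1) * Real.pi * x) := by
  induction M with
  | zero => simp
  | succ M ih =>
    rw [sum_Icc_succ_top (by omega), ← add_assoc, mul_add, ih]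
    push_cast
    have h1 : (2 * M + 1) * Real.pi * x = 2 * Real.pi * (M + 1) * x - Real.pi * x := by ring
    have h2 : (2 * (M + 1) + 1) * Real.pi * x = 2 * Real.pi * (M + 1) * x + Real.pi * x := by ring
    rw [h1, h2, Real.sin_sub, Real.sin_add]; ring

/-- The error of the truncated Fourier expansion of the sawtooth function on `(0, 1)`. -/
def sawtoothError (M : ℕ) (x : ℝ) : ℝ :=
  x - 1 / 2 + ∑ m ∈ Icc 1 M, Real.sin (2 * Real.pi * m * x) / (Real.pi * m)

lemma hasDerivAt_sawtoothError (M : ℕ) (x : ℝ) :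
    HasDerivAt (sawtoothError M) (1 + ∑ m ∈ Icc 1 M, 2 * Real.cos (2 * Real.pi * m * x)) x := by
  unfold sawtoothError
  refine ((hasDerivAt_id' x).sub_const _).add (HasDerivAt.fun_sum fun m hm => ?_)
  rw [mem_Icc] at hm
  have hm0 : (m : ℝ) ≠ 0 := by exact_mod_cast (by omega)
  have h1 : HasDerivAt (fun x => 2 * Real.pi * m * x) (2 * Real.pi * m) x := by
    simpa using (hasDerivAt_id' x).const_mul (2 * Real.pi * m)
  refine ((h1.sin).div_const (Real.pi * m)).congr_deriv ?_
  field_simp [Real.pi_pos.ne']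

lemma sawtoothError_half (M : ℕ) : sawtoothError M (1 / 2) = 0 := by
  unfold sawtoothError
  rw [sum_eq_zero]
  · norm_num
  · intro m _
    rw [show 2 * Real.pi * m * (1 / 2) = m * Real.pi by ring, Real.sin_nat_mul_pi, zero_div]

lemma sawtoothError_one_sub (M : ℕ) (x : ℝ) : sawtoothError M (1 - x) = -sawtoothError M x := by
  unfold sawtoothError
  rw [neg_add, ← sum_neg_distrib]
  congr 1
  · ring
  · refine sum_congr rfl fun m _ => ?_
    rw [show 2 * Real.pi * m * (1 - x) = m * (2 * Real.pi) - 2 * Real.pi * m * x by ring,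
      Real.sin_nat_mul_two_pi_sub, neg_div]

/-- The derivative of the error is the Dirichlet kernel sin(kπt)/sin(πt) with k = 2M + 1, and the
error vanishes at 1/2. Integration by parts from x to 1/2 is carried out by adding the boundary term
to form G, whose derivative is at most 1/(4kt²) in absolute value; this is the derivative of
-1/(4kt). -/
lemma abs_sawtoothError_le (M : ℕ) (hM : 1 ≤ M) {x : ℝ} (hx : 0 < x) (hx2 : x ≤ 1 / 2) :
    |sawtoothError M x| ≤ 1 / (4 * M * x) := by
  have hM' : (1 : ℝ) ≤ M := by exact_mod_cast hM
  have hpi := Real.pi_pos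
  set k : ℝ := 2 * M + 1 with hk
  have hk0 : 0 < k := by positivity
  have hsin : ∀ t, 0 < t → t ≤ 1 / 2 → 2 * t ≤ Real.sin (Real.pi * t) := by
    intro t ht ht2
    have h := Real.mul_le_sin (x := Real.pi * t) (by positivity) (by nlinarith)
    rwa [show 2 / Real.pi * (Real.pi * t) = 2 * t by field_simp] at h
  set G : ℝ → ℝ := fun t => sawtoothError M t +
    Real.cos (k * Real.pi * t) / (k * Real.pi * Real.sin (Real.pi * t)) with hG
  have hGd : ∀ t, 0 < t → t ≤ 1 / 2 → HasDerivAt G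
      (-(Real.cos (k * Real.pi * t) * Real.cos (Real.pi * t) / (k * Real.sin (Real.pi * t) ^ 2))) t := by
    intro t ht ht2
    have hs : 0 < Real.sin (Real.pi * t) := by linarith [hsin t ht ht2]
    have h1 : HasDerivAt (fun t => k * Real.pi * t) (k * Real.pi) t := by
      simpa using (hasDerivAt_id' t).const_mul (k * Real.pi)
    have h2 : HasDerivAt (fun t => Real.pi * t) Real.pi t := by
      simpa using (hasDerivAt_id' t).const_mul Real.pi
    have h3 := (hasDerivAt_sawtoothError M t).add
      (h1.cos.div (h2.sin.const_mul (k * Real.pi)) (by positivity))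
    refine h3.congr_deriv ?_
    have h4 := sin_mul_dirichlet M t
    rw [← hk] at h4
    rw [← h4]
    generalize ∑ m ∈ Icc 1 M, 2 * Real.cos (2 * Real.pi * m * t) = D
    field_simp
    ring
  have hG0 : G (1 / 2) = 0 := by
    simp only [hG]
    rw [sawtoothError_half, hk, show (2 * (M : ℝ) + 1) * Real.pi * (1 / 2) =
      Real.pi / 2 + M * Real.pi by ring, Real.cos_add_nat_mul_pi, Real.cos_pi_div_two]
    simp
  have hGb : ∀ s : ℝ, (s = 1 ∨ s = -1) → s * G x ≤ 1 / (4 * k * x) := by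
    intro s hs
    rcases hx2.eq_or_lt with h | h
    · rw [h, hG0, mul_zero]; positivity
    obtain ⟨c, hc, hc'⟩ := exists_slope (f := fun t => 1 / (4 * k) * t⁻¹ - s * G t)
      (f' := fun t => 1 / (4 * k) * (-(t ^ 2)⁻¹) - s *
        (-(Real.cos (k * Real.pi * t) * Real.cos (Real.pi * t) / (k * Real.sin (Real.pi * t) ^ 2))))
      h (fun t ht => by
        have ht0 : 0 < t := hx.trans_le ht.1
        exact ((hasDerivAt_inv ht0.ne').const_mul _).sub ((hGd t ht0 ht.2).const_mul s))
    have hc0 : 0 < c := hx.trans_le hc.1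
    have hsc := hsin c hc0 hc.2
    have hb : |Real.cos (k * Real.pi * c) * Real.cos (Real.pi * c) / (k * Real.sin (Real.pi * c) ^ 2)|
        ≤ 1 / (4 * k) * (c ^ 2)⁻¹ := by
      rw [abs_div, abs_mul, abs_of_pos (by have := hsc.trans_lt' (by linarith : 0 < 2 * c); positivity :
        0 < k * Real.sin (Real.pi * c) ^ 2)]
      have e1 : |Real.cos (k * Real.pi * c)| * |Real.cos (Real.pi * c)| ≤ 1 :=
        mul_le_one₀ (Real.abs_cos_le_one _) (abs_nonneg _) (Real.abs_cos_le_one _)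
      have e2 : k * (2 * c) ^ 2 ≤ k * Real.sin (Real.pi * c) ^ 2 := by gcongr
      calc _ ≤ 1 / (k * (2 * c) ^ 2) := div_le_div₀ (by norm_num) e1 (by positivity) e2
        _ = _ := by field_simp; ring
    have hneg : 1 / (4 * k) * (-(c ^ 2)⁻¹) - s *
        (-(Real.cos (k * Real.pi * c) * Real.cos (Real.pi * c) / (k * Real.sin (Real.pi * c) ^ 2))) ≤ 0 := by
      have := abs_le.1 hb
      rcases hs with h | h <;> rw [h] <;> linarith
    have h5 : (1 / (4 * k) * (1 / 2 : ℝ)⁻¹ - s * G (1 / 2)) - (1 / (4 * k) * x⁻¹ - s * G x) ≤ 0 := by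
      rw [hc']
      exact mul_nonpos_of_nonpos_of_nonneg hneg (by linarith)
    rw [hG0, mul_zero] at h5
    have h6 : 0 < 1 / (4 * k) * (1 / 2 : ℝ)⁻¹ := by positivity
    have h7 : 1 / (4 * k * x) = 1 / (4 * k) * x⁻¹ := by field_simp
    rw [h7]; linarith
  have hsx := hsin x hx hx2
  have hcos : |Real.cos (k * Real.pi * x) / (k * Real.pi * Real.sin (Real.pi * x))| ≤
      1 / (6 * k * x) := by
    rw [abs_div, abs_of_pos (by have := hsx.trans_lt' (by linarith : 0 < 2 * x); positivity :
      0 < k * Real.pi * Real.sin (Real.pi * x))]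
    refine div_le_div₀ (by norm_num) (Real.abs_cos_le_one _) (by positivity) ?_
    have := Real.pi_gt_three
    calc 6 * k * x = k * 3 * (2 * x) := by ring
      _ ≤ k * Real.pi * Real.sin (Real.pi * x) := by gcongr
  have hR : sawtoothError M x = G x - Real.cos (k * Real.pi * x) / (k * Real.pi * Real.sin (Real.pi * x)) := by
    simp only [hG]; ring
  have h1 := hGb 1 (Or.inl rfl)
  have h2 := hGb (-1) (Or.inr rfl)
  have h3 := abs_le.1 hcos
  have h4 : 1 / (4 * k * x) + 1 / (6 * k * x) ≤ 1 / (4 * M * x) := by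
    have : 1 / (4 * k * x) + 1 / (6 * k * x) = 5 / (12 * k * x) := by field_simp; norm_num
    rw [this, div_le_div_iff₀ (by positivity) (by positivity), hk]
    nlinarith [mul_pos hx hk0]
  rw [hR, abs_le]
  constructor <;> linarith

/-- If Mx ≤ 1, each sine term is at most 2x and there are M of them; otherwise the bound 1/(4Mx) is
below 1/4. -/
lemma abs_sawtoothError_le_const (M : ℕ) (hM : 1 ≤ M) {x : ℝ} (hx : 0 ≤ x) (hx2 : x ≤ 1 / 2) :
    |sawtoothError M x| ≤ 5 / 2 := by
  have hM' : (1 : ℝ) ≤ M := by exact_mod_cast hM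
  by_cases h : M * x ≤ 1
  · unfold sawtoothError
    refine (abs_add_le _ _).trans ?_
    have h1 : |x - 1 / 2| ≤ 1 / 2 := by rw [abs_le]; constructor <;> linarith
    have h2 : |∑ m ∈ Icc 1 M, Real.sin (2 * Real.pi * m * x) / (Real.pi * m)| ≤ 2 := by
      refine (abs_sum_le_sum_abs _ _).trans ?_
      have : ∀ m ∈ Icc 1 M, |Real.sin (2 * Real.pi * m * x) / (Real.pi * m)| ≤ 2 * x := by
        intro m hm
        rw [mem_Icc] at hm
        have hm0 : (0 : ℝ) < m := by exact_mod_cast (by omega)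
        have hpi := Real.pi_pos
        rw [abs_div, abs_of_pos (by positivity : 0 < Real.pi * m), div_le_iff₀ (by positivity)]
        refine Real.abs_sin_le_abs.trans (le_of_eq ?_)
        rw [abs_of_nonneg (by positivity)]; ring
      refine (sum_le_sum this).trans ?_
      rw [sum_const, Nat.card_Icc, nsmul_eq_mul, Nat.add_sub_cancel]
      linarith
    linarith
  · push Not at h
    have hx0 : 0 < x := by
      by_contra hcon
      have : x = 0 := by linarith
      rw [this] at h; linarith
    refine (abs_sawtoothError_le M hM hx0 hx2).trans ?_
    rw [div_le_iff₀ (by positivity)]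
    linarith

/-- The Fejér kernel of order `N`. -/
def fejer (N : ℕ) (t : ℝ) : ℝ := ‖∑ k ∈ range N, e (k * t)‖ ^ 2 / N

lemma fejer_nonneg (N : ℕ) (t : ℝ) : 0 ≤ fejer N t := by unfold fejer; positivity

lemma fejer_add_int (N : ℕ) (t : ℝ) (n : ℤ) : fejer N (t + n) = fejer N t := by
  unfold fejer
  congr 3
  refine sum_congr rfl fun k _ => ?_
  rw [mul_add, show (k : ℝ) * n = ((k * n : ℤ) : ℝ) by push_cast; ring, e_add_int]

lemma fejer_neg (N : ℕ) (t : ℝ) : fejer N (-t) = fejer N t := by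
  unfold fejer
  congr 2
  rw [← RCLike.norm_conj, map_sum]
  congr 1
  refine sum_congr rfl fun k _ => ?_
  rw [← e_neg]; congr 1; ring

lemma le_fejer (N : ℕ) (hN : 1 ≤ N) {v : ℝ} (hv : |v| ≤ 1 / (8 * N)) : (N : ℝ) / 4 ≤ fejer N v := by
  have hN' : (1 : ℝ) ≤ N := by exact_mod_cast hN
  have hre : ∀ k ∈ range N, (1 / 2 : ℝ) ≤ (e (k * v)).re := by
    intro k hk
    rw [mem_range] at hk
    have hk' : (k : ℝ) ≤ N := by exact_mod_cast hk.le
    have h1 : (e (k * v)).re = Real.cos (2 * Real.pi * (k * v)) := by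
      rw [e, show (2 * Real.pi * Complex.I * ((k * v : ℝ) : ℂ) : ℂ) =
        ((2 * Real.pi * (k * v) : ℝ) : ℂ) * Complex.I by push_cast; ring, Complex.exp_ofReal_mul_I_re]
    rw [h1]
    have h2 := Real.one_sub_sq_div_two_le_cos (x := 2 * Real.pi * (k * v))
    have h3 : |2 * Real.pi * (k * v)| ≤ 1 := by
      rw [abs_mul (2 * Real.pi), abs_mul (k : ℝ), abs_of_pos (by positivity : 0 < 2 * Real.pi),
        Nat.abs_cast]
      have := Real.pi_le_four
      calc 2 * Real.pi * (k * |v|) ≤ 2 * 4 * (N * (1 / (8 * N))) := by gcongr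
        _ = 1 := by field_simp; norm_num
    have h4 : (2 * Real.pi * (k * v)) ^ 2 ≤ 1 := by
      rw [← sq_abs]; nlinarith [abs_nonneg (2 * Real.pi * (k * v))]
    linarith
  have h1 : (N : ℝ) / 2 ≤ ‖∑ k ∈ range N, e (k * v)‖ := by
    refine le_trans ?_ (Complex.re_le_norm _)
    rw [Complex.re_sum]
    refine le_trans (le_of_eq ?_) (sum_le_sum hre)
    rw [sum_const, card_range, nsmul_eq_mul]; ring
  unfold fejer
  rw [le_div_iff₀ (by positivity)]
  nlinarith

/-- The error is of order min(1, 1/(M‖t‖)), where ‖t‖ is the distance to the nearest integer. If ‖t‖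
has order 2^(-j) with 2^j ≤ M, the Fejér kernel of order 2^j is at least a multiple of 2^j there;
for smaller ‖t‖ the largest order serves. The majorant is a nonnegative trigonometric polynomial
with frequencies below M, so exponential sums control its average. -/
lemma abs_sawtooth_sub_le (M : ℕ) (hM : 1 ≤ M) (t : ℝ) :
    |Int.fract t - 1 / 2 + ∑ m ∈ Icc 1 M, Real.sin (2 * Real.pi * m * t) / (Real.pi * m)| ≤
      20 / M * ∑ j ∈ range (Nat.log 2 M + 1), fejer (2 ^ j) t := by
  have hM' : (1 : ℝ) ≤ M := by exact_mod_cast hM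
  have hsin : Int.fract t - 1 / 2 + ∑ m ∈ Icc 1 M, Real.sin (2 * Real.pi * m * t) / (Real.pi * m) =
      sawtoothError M (Int.fract t) := by
    unfold sawtoothError
    congr 1
    refine sum_congr rfl fun m _ => ?_
    congr 1
    conv_lhs => rw [← Int.fract_add_floor t]
    rw [show 2 * Real.pi * m * (Int.fract t + ⌊t⌋) = 2 * Real.pi * m * Int.fract t +
      ((m * ⌊t⌋ : ℤ) : ℝ) * (2 * Real.pi) by push_cast; ring, Real.sin_add_int_mul_two_pi]
  obtain ⟨v, n, hvn, hv2, hvc, hvs⟩ : ∃ (v : ℝ) (n : ℤ), t = v + n ∧ |v| ≤ 1 / 2 ∧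
      |sawtoothError M (Int.fract t)| ≤ 5 / 2 ∧
      (v ≠ 0 → |sawtoothError M (Int.fract t)| ≤ 1 / (4 * M * |v|)) := by
    have h0 := Int.fract_nonneg t
    have h1 := Int.fract_lt_one t
    rcases le_or_gt (Int.fract t) (1 / 2) with h | h
    · refine ⟨Int.fract t, ⌊t⌋, (Int.fract_add_floor t).symm, by rwa [abs_of_nonneg h0],
        abs_sawtoothError_le_const M hM h0 h, fun hne => ?_⟩
      rw [abs_of_nonneg h0]
      exact abs_sawtoothError_le M hM (lt_of_le_of_ne h0 (Ne.symm hne)) h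
    · have hs : |sawtoothError M (Int.fract t)| = |sawtoothError M (1 - Int.fract t)| := by
        rw [sawtoothError_one_sub, abs_neg]
      have habs : |Int.fract t - 1| = 1 - Int.fract t := by
        rw [abs_of_nonpos (by linarith)]; ring
      refine ⟨Int.fract t - 1, ⌊t⌋ + 1, ?_, by rw [habs]; linarith, ?_, fun _ => ?_⟩
      · push_cast
        linarith [Int.fract_add_floor t]
      · rw [hs]; exact abs_sawtoothError_le_const M hM (by linarith) (by linarith)
      · rw [hs, habs]; exact abs_sawtoothError_le M hM (by linarith) (by linarith)
  rw [hsin]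
  set S := ∑ j ∈ range (Nat.log 2 M + 1), fejer (2 ^ j) t with hS
  have hSj : ∀ j ≤ Nat.log 2 M, fejer (2 ^ j) v ≤ S := by
    intro j hj
    have : fejer (2 ^ j) v = fejer (2 ^ j) t := by rw [hvn, fejer_add_int]
    rw [this]
    exact single_le_sum (f := fun j => fejer (2 ^ j) t) (fun i _ => fejer_nonneg _ _)
      (mem_range.2 (by omega))
  set J := Nat.log 2 M with hJ
  have hJM : (M : ℝ) ≤ 2 * 2 ^ J := by
    have := Nat.lt_pow_succ_log_self (b := 2) (by norm_num) M
    rw [← hJ, pow_succ] at this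
    have h2 : (M : ℝ) < 2 ^ J * 2 := by exact_mod_cast this
    linarith
  rw [div_mul_eq_mul_div, le_div_iff₀ (by linarith)]
  by_cases hsmall : |v| ≤ 1 / (8 * 2 ^ J)
  · have := (le_fejer (2 ^ J) Nat.one_le_two_pow (v := v) (by push_cast; exact hsmall)).trans
      (hSj J le_rfl)
    push_cast at this
    nlinarith
  push Not at hsmall
  have hv0 : 0 < |v| := lt_trans (by positivity) hsmall
  have hvs := hvs (abs_pos.1 hv0)
  have hvM : |sawtoothError M (Int.fract t)| * M ≤ 1 / (4 * |v|) := by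
    calc _ ≤ 1 / (4 * M * |v|) * M := by gcongr
      _ = _ := by field_simp
  refine hvM.trans ?_
  have hex : ∃ j, 1 / (8 * 2 ^ j) < |v| := ⟨J, hsmall⟩
  classical
  -- The first dyadic scale below |v|: the kernel of the preceding order is large at v by
  -- minimality, and order 1 suffices if j = 0.
  set j := Nat.find hex with hj
  have hjJ : j ≤ J := Nat.find_min' hex hsmall
  have hjs : 1 / (8 * 2 ^ j) < |v| := Nat.find_spec hex
  rcases Nat.eq_zero_or_pos j with h0 | h0
  · have := (hSj 0 (Nat.zero_le _))
    rw [h0, pow_zero, mul_one] at hjs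
    have h1 : fejer (2 ^ 0) v = 1 := by simp [fejer, e_zero]
    rw [h1] at this
    rw [div_le_iff₀ (by positivity)]
    rw [div_lt_iff₀ (by positivity)] at hjs
    nlinarith
  · obtain ⟨i, hi⟩ : ∃ i, j = i + 1 := ⟨j - 1, by omega⟩
    have hnot := Nat.find_min hex (m := i) (by omega)
    push Not at hnot
    have h1 := (le_fejer (2 ^ i) Nat.one_le_two_pow (v := v) (by push_cast; exact hnot)).trans
      (hSj i (by omega))
    push_cast at h1
    rw [hi, pow_succ, div_lt_iff₀ (by positivity)] at hjs
    rw [div_le_iff₀ (by positivity)]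
    nlinarith

lemma sum_fejer_le (φ : ℕ → ℝ) (X Y N : ℕ) (hXY : X ≤ Y) (hN : 1 ≤ N) (V : ℝ)
    (hV : ∀ m : ℕ, 1 ≤ m → m < N → ‖∑ n ∈ Ioc X Y, e (m * φ n)‖ ≤ V) (hV0 : 0 ≤ V) :
    ∑ n ∈ Ioc X Y, fejer N (φ n) ≤ (Y - X : ℝ) + N * V := by
  have hN' : (1 : ℝ) ≤ N := by exact_mod_cast hN
  unfold fejer
  rw [← sum_div, div_le_iff₀ (by linarith)]
  have h := sum_norm_sq_le (Ioc X Y) (range N) (fun _ => 1) (fun k n => e (k * φ n))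
  simp only [one_mul, norm_one] at h
  refine h.trans ?_
  have hin : ∀ k₁ ∈ range N, ∀ k₂ ∈ range N,
      ‖∑ n ∈ Ioc X Y, e (k₁ * φ n) * (starRingEnd ℂ) (e (k₂ * φ n))‖ ≤
        V + if k₂ = k₁ then (Y - X : ℝ) else 0 := by
    intro k₁ h1 k₂ h2
    rw [mem_range] at h1 h2
    have hlt : ∀ a b : ℕ, a < N → b < a →
        ‖∑ n ∈ Ioc X Y, e (a * φ n) * (starRingEnd ℂ) (e (b * φ n))‖ ≤ V := by
      intro a b ha hba
      have := hV (a - b) (by omega) (by omega)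
      rw [Nat.cast_sub hba.le] at this
      simp_rw [← e_sub, ← sub_mul]
      exact this
    rcases lt_trichotomy k₂ k₁ with h3 | h3 | h3
    · rw [if_neg h3.ne, add_zero]; exact hlt k₁ k₂ h1 h3
    · subst h3
      rw [if_pos rfl]
      have : ‖∑ n ∈ Ioc X Y, e (k₂ * φ n) * (starRingEnd ℂ) (e (k₂ * φ n))‖ ≤ (Y - X : ℝ) := by
        simp_rw [← e_sub, sub_self, e_zero]
        rw [sum_const, Nat.card_Ioc, nsmul_eq_mul, mul_one, Complex.norm_natCast, Nat.cast_sub hXY]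
      linarith
    · rw [if_neg h3.ne', add_zero, ← RCLike.norm_conj, map_sum]
      simp_rw [map_mul, Complex.conj_conj]
      simp_rw [mul_comm ((starRingEnd ℂ) _)]
      exact hlt k₂ k₁ h2 h3
  refine (sum_le_sum fun k₁ h1 => sum_le_sum fun k₂ h2 => hin k₁ h1 k₂ h2).trans ?_
  have : ∀ k₁ ∈ range N, ∑ k₂ ∈ range N, (V + if k₂ = k₁ then (Y - X : ℝ) else 0) =
      N * V + (Y - X) := by
    intro k₁ h1
    rw [sum_add_distrib, sum_ite_eq' (range N) k₁, if_pos h1, sum_const, card_range, nsmul_eq_mul]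
  rw [sum_congr rfl this, sum_const, card_range, nsmul_eq_mul]
  linarith

end ThinPrimes
end

noncomputable section
open Finset
namespace ThinPrimes

/-! ### Weighted sums of sawtooth differences. -/

lemma le_last_of_le_succ {w : ℕ → ℝ} {X n : ℕ} (hXn : X < n) :
    ∀ {Y : ℕ}, (∀ k, X < k → k < Y → w k ≤ w (k + 1)) → n ≤ Y → w n ≤ w Y := by
  intro Y hw hnY
  induction Y, hnY using Nat.le_induction with
  | base => exact le_rfl
  | succ m hm ih =>
    exact (ih fun k hk hk' => hw k hk (by omega)).trans (hw m (by omega) (by omega))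

/-- With d(n) = φ(n+1) - φ(n), the difference of exponentials is e(μφ(n)) (e(μd(n)) - 1), and e(μd)
- 1 is of size |μ|d. As w increases and d decreases, the total variation of the weight w(n)(e(μd(n))
- 1) telescopes and is at most a multiple of |μ| w(X') d(X+1). For w = 1/φ' the product w(X') d(X+1)
is bounded, so the weight costs nothing but |μ|. -/
lemma norm_weightedSum_le (φ w : ℕ → ℝ) (a : ℕ → ℂ) (X X' : ℕ) (K U μ : ℝ) (hXX' : X < X')
    (hw0 : ∀ n, X < n → n ≤ X' → 0 ≤ w n) (hw : ∀ n, X < n → n < X' → w n ≤ w (n + 1))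
    (hd0 : ∀ n, X < n → n ≤ X' → 0 ≤ φ (n + 1) - φ n)
    (hd : ∀ n, X < n → n < X' → φ (n + 2) - φ (n + 1) ≤ φ (n + 1) - φ n)
    (hK : w X' * (φ (X + 2) - φ (X + 1)) ≤ K)
    (hU : ∀ y, X ≤ y → y ≤ X' → ‖∑ n ∈ Ioc X y, a n * e (μ * φ n)‖ ≤ U) :
    ‖∑ n ∈ Ioc X X', (w n : ℂ) * a n * (e (μ * φ (n + 1)) - e (μ * φ n))‖ ≤
      6 * Real.pi * |μ| * K * U := by
  set d : ℕ → ℝ := fun n => φ (n + 1) - φ n with hdd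
  set D := d (X + 1) with hD
  have hdle : ∀ n, X < n → n ≤ X' → d n ≤ D := by
    intro n hn
    induction n, hn using Nat.le_induction with
    | base => intro _; exact le_rfl
    | succ n hn ih =>
      intro h
      exact (hd n hn (by omega)).trans (ih (by omega))
  have hwle : ∀ n, n ≤ X' → X < n → w n ≤ w X' := fun n hn hn' => le_last_of_le_succ hn' hw hn
  have hD0 : 0 ≤ D := hd0 (X + 1) (by omega) (by omega)
  have hwX' : 0 ≤ w X' := hw0 X' hXX' le_rfl
  have hU0 : 0 ≤ U := (norm_nonneg _).trans (hU X le_rfl hXX'.le)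
  set W : ℕ → ℂ := fun n => (w n : ℂ) * (e (μ * d n) - 1) with hW
  have hpi := Real.pi_pos
  have heq : ∑ n ∈ Ioc X X', (w n : ℂ) * a n * (e (μ * φ (n + 1)) - e (μ * φ n)) =
      ∑ n ∈ Ioc X X', W n * (a n * e (μ * φ n)) := by
    refine sum_congr rfl fun n _ => ?_
    simp only [hW, hdd]
    rw [show μ * φ (n + 1) = μ * (φ (n + 1) - φ n) + μ * φ n by ring, e_add]; ring
  rw [heq]
  refine (norm_sum_Ioc_mul_le W _ X X' hXX'.le U hU).trans ?_
  have he : ∀ n, X < n → n ≤ X' → ‖e (μ * d n) - 1‖ ≤ 2 * Real.pi * |μ| * D := by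
    intro n hn hn'
    refine (norm_e_sub_one_le _).trans ?_
    rw [abs_mul, abs_of_nonneg (hd0 n hn hn'), mul_assoc (2 * Real.pi)]
    gcongr
    exact hdle n hn hn'
  have h1 : ‖W X'‖ ≤ w X' * (2 * Real.pi * |μ| * D) := by
    simp only [hW]
    rw [norm_mul, Complex.norm_real, Real.norm_eq_abs, abs_of_nonneg hwX']
    gcongr
    exact he X' hXX' le_rfl
  have h2 : ∀ n ∈ Ico (X + 1) X', ‖W (n + 1) - W n‖ ≤
      2 * Real.pi * |μ| * (D * (w (n + 1) - w n) + w X' * (d n - d (n + 1))) := by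
    intro n hn
    rw [mem_Ico] at hn
    have hid : W (n + 1) - W n = ((w (n + 1) - w n : ℝ) : ℂ) * (e (μ * d n) - 1) +
        (w (n + 1) : ℂ) * (e (μ * d (n + 1)) - e (μ * d n)) := by
      simp only [hW]; push_cast; ring
    rw [hid]
    refine (norm_add_le _ _).trans ?_
    have hw1 := hw n (by omega) hn.2
    rw [norm_mul, norm_mul, Complex.norm_real, Complex.norm_real, Real.norm_eq_abs,
      Real.norm_eq_abs, abs_of_nonneg (sub_nonneg.2 hw1),
      abs_of_nonneg (hw0 (n + 1) (by omega) (by omega))]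
    have e1 := he n (by omega) hn.2.le
    have e2 : ‖e (μ * d (n + 1)) - e (μ * d n)‖ ≤ 2 * Real.pi * |μ| * (d n - d (n + 1)) := by
      refine (norm_e_sub_e_le _ _).trans ?_
      rw [← mul_sub, abs_mul, abs_of_nonpos (sub_nonpos.2 (hd n (by omega) hn.2)),
        mul_assoc (2 * Real.pi)]
      simp only [hdd]
      refine le_of_eq ?_
      ring_nf
    have e3 := hwle (n + 1) (by omega) (by omega)
    calc _ ≤ (w (n + 1) - w n) * (2 * Real.pi * |μ| * D) +
          w X' * (2 * Real.pi * |μ| * (d n - d (n + 1))) := by gcongr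
      _ = _ := by ring
  have h3 : ∑ n ∈ Ico (X + 1) X', ‖W (n + 1) - W n‖ ≤ 2 * Real.pi * |μ| * (2 * (w X' * D)) := by
    refine (sum_le_sum h2).trans ?_
    rw [← mul_sum, sum_add_distrib, ← mul_sum, ← mul_sum, sum_Ico_sub _ (by omega : X + 1 ≤ X')]
    have h4 : ∑ n ∈ Ico (X + 1) X', (d n - d (n + 1)) = D - d X' := by
      have := sum_Ico_sub (fun n => -d n) (by omega : X + 1 ≤ X')
      rw [show D - d X' = -d X' - -d (X + 1) by rw [hD]; ring, ← this]
      exact sum_congr rfl fun _ _ => by ring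
    rw [h4]
    have h5 : 0 ≤ w (X + 1) := hw0 _ (by omega) (by omega)
    have h6 : 0 ≤ d X' := hd0 _ hXX' le_rfl
    refine mul_le_mul_of_nonneg_left ?_ (by positivity)
    have h7 : 0 ≤ D * w (X + 1) := by positivity
    have h8 : 0 ≤ w X' * d X' := by positivity
    linarith
  have hKD : w X' * D ≤ K := hK
  calc U * (‖W X'‖ + ∑ n ∈ Ico (X + 1) X', ‖W (n + 1) - W n‖)
      ≤ U * (w X' * (2 * Real.pi * |μ| * D) + 2 * Real.pi * |μ| * (2 * (w X' * D))) := by gcongr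
    _ = 6 * Real.pi * |μ| * (w X' * D) * U := by ring
    _ ≤ _ := by gcongr

/-- In the Fourier polynomial the coefficient 1/(πm) cancels the factor m from
`norm_weightedSum_le`, so each of the M frequencies costs a multiple of KU. The remainder is bounded
termwise by Fejér kernels, whose mean values need only the unweighted sums bounded by V. These run
to X' + 1 in order to cover both φ(n) and φ(n+1). -/
theorem norm_sawtoothSum_le (φ w : ℕ → ℝ) (a : ℕ → ℂ) (X X' M : ℕ) (A K U V : ℝ)
    (hXX' : X < X') (hM : 1 ≤ M)
    (hw0 : ∀ n, X < n → n ≤ X' → 0 ≤ w n) (hw : ∀ n, X < n → n < X' → w n ≤ w (n + 1))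
    (hd0 : ∀ n, X < n → n ≤ X' → 0 ≤ φ (n + 1) - φ n)
    (hd : ∀ n, X < n → n < X' → φ (n + 2) - φ (n + 1) ≤ φ (n + 1) - φ n)
    (hK : w X' * (φ (X + 2) - φ (X + 1)) ≤ K) (ha : ∀ n, X < n → n ≤ X' → ‖a n‖ ≤ A)
    (hU : ∀ m : ℕ, 1 ≤ m → m ≤ M → ∀ y, X ≤ y → y ≤ X' →
      ‖∑ n ∈ Ioc X y, a n * e (m * φ n)‖ ≤ U ∧ ‖∑ n ∈ Ioc X y, a n * e (-m * φ n)‖ ≤ U)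
    (hV : ∀ m : ℕ, 1 ≤ m → m ≤ M → ‖∑ n ∈ Ioc X (X' + 1), e (m * φ n)‖ ≤ V) :
    ‖∑ n ∈ Ioc X X', (w n : ℂ) * a n * ((Int.fract (-φ (n + 1)) - Int.fract (-φ n) : ℝ) : ℂ)‖ ≤
      6 * K * M * U +
        w X' * A * (40 / M) * ((Nat.log 2 M + 1) * (X' + 1 - X) + 2 * M * V) := by
  have hpi := Real.pi_pos
  have hM' : (1 : ℝ) ≤ M := by exact_mod_cast hM
  have hA0 : 0 ≤ A := (norm_nonneg _).trans (ha X' hXX' le_rfl)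
  have hwX' : 0 ≤ w X' := hw0 X' hXX' le_rfl
  have hV0 : 0 ≤ V := (norm_nonneg _).trans (hV 1 le_rfl hM)
  have hwle : ∀ n, n ≤ X' → X < n → w n ≤ w X' := fun n hn hn' => le_last_of_le_succ hn' hw hn
  set S : ℝ → ℝ := fun t => ∑ m ∈ Icc 1 M, Real.sin (2 * Real.pi * m * t) / (Real.pi * m) with hS
  set R : ℝ → ℝ := fun t => Int.fract t - 1 / 2 + S t with hR
  have hSneg : ∀ t, S (-t) = -S t := by
    intro t
    simp only [hS]
    rw [← sum_neg_distrib]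
    refine sum_congr rfl fun m _ => ?_
    rw [mul_neg, Real.sin_neg, neg_div]
  have hsplit : ∑ n ∈ Ioc X X', (w n : ℂ) * a n *
      ((Int.fract (-φ (n + 1)) - Int.fract (-φ n) : ℝ) : ℂ) =
      ∑ n ∈ Ioc X X', (w n : ℂ) * a n * ((S (φ (n + 1)) - S (φ n) : ℝ) : ℂ) +
      ∑ n ∈ Ioc X X', (w n : ℂ) * a n * ((R (-φ (n + 1)) - R (-φ n) : ℝ) : ℂ) := by
    rw [← sum_add_distrib]
    refine sum_congr rfl fun n _ => ?_
    rw [← mul_add, ← Complex.ofReal_add]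
    congr 2
    simp only [hR, hSneg]; ring
  rw [hsplit]
  refine (norm_add_le _ _).trans (add_le_add ?_ ?_)
  · have hsin : ∀ (m : ℕ) (t : ℝ), ((Real.sin (2 * Real.pi * m * t) / (Real.pi * m) : ℝ) : ℂ) =
        1 / (2 * Complex.I * (Real.pi * m)) * (e (m * t) - e (-m * t)) := by
      intro m t
      have h1 : e (m * t) - e (-m * t) = 2 * Complex.I * Real.sin (2 * Real.pi * m * t) := by
        simp only [e]
        rw [show (2 * Real.pi * Complex.I * ((m * t : ℝ) : ℂ) : ℂ) =
          ((2 * Real.pi * m * t : ℝ) : ℂ) * Complex.I by push_cast; ring,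
          show (2 * Real.pi * Complex.I * ((-m * t : ℝ) : ℂ) : ℂ) =
          -((2 * Real.pi * m * t : ℝ) : ℂ) * Complex.I by push_cast; ring]
        rw [Complex.ofReal_sin, Complex.sin]
        ring_nf
        rw [Complex.I_sq]; ring
      rw [h1]
      push_cast
      have := Complex.I_ne_zero
      rcases eq_or_ne m 0 with h0 | h0
      · subst h0; simp
      · have h2 : (Real.pi : ℂ) ≠ 0 := by exact_mod_cast hpi.ne'
        have h3 : (m : ℂ) ≠ 0 := by exact_mod_cast h0
        field_simp
    have hterm : ∑ n ∈ Ioc X X', (w n : ℂ) * a n * ((S (φ (n + 1)) - S (φ n) : ℝ) : ℂ) =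
        ∑ m ∈ Icc 1 M, 1 / (2 * Complex.I * (Real.pi * m)) *
          (∑ n ∈ Ioc X X', (w n : ℂ) * a n * (e ((m : ℝ) * φ (n + 1)) - e ((m : ℝ) * φ n)) -
           ∑ n ∈ Ioc X X', (w n : ℂ) * a n * (e (-(m : ℝ) * φ (n + 1)) - e (-(m : ℝ) * φ n))) := by
      simp_rw [← sum_sub_distrib, mul_sum]
      rw [sum_comm]
      refine sum_congr rfl fun n _ => ?_
      simp only [hS, ← sum_sub_distrib]
      rw [Complex.ofReal_sum, mul_sum]
      refine sum_congr rfl fun m _ => ?_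
      rw [Complex.ofReal_sub, hsin, hsin]; ring
    rw [hterm]
    refine (norm_sum_le _ _).trans ?_
    have hb : ∀ m ∈ Icc 1 M, ‖1 / (2 * Complex.I * (Real.pi * m)) *
          (∑ n ∈ Ioc X X', (w n : ℂ) * a n * (e ((m : ℝ) * φ (n + 1)) - e ((m : ℝ) * φ n)) -
           ∑ n ∈ Ioc X X', (w n : ℂ) * a n * (e (-(m : ℝ) * φ (n + 1)) - e (-(m : ℝ) * φ n)))‖ ≤
        6 * K * U := by
      intro m hm
      rw [mem_Icc] at hm
      have hm0 : (0 : ℝ) < m := by exact_mod_cast (by omega)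
      have h1 := norm_weightedSum_le φ w a X X' K U m hXX' hw0 hw hd0 hd hK
        (fun y hy hy' => (hU m hm.1 hm.2 y hy hy').1)
      have h2 := norm_weightedSum_le φ w a X X' K U (-m) hXX' hw0 hw hd0 hd hK
        (fun y hy hy' => (hU m hm.1 hm.2 y hy hy').2)
      rw [abs_neg] at h2
      rw [Nat.abs_cast] at h1 h2
      have h3 := (norm_sub_le _ _).trans (add_le_add h1 h2)
      rw [norm_mul]
      have h4 : ‖1 / (2 * Complex.I * (Real.pi * m))‖ = 1 / (2 * (Real.pi * m)) := by
        simp [abs_of_pos hpi]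
      rw [h4]
      calc _ ≤ 1 / (2 * (Real.pi * m)) * (6 * Real.pi * m * K * U + 6 * Real.pi * m * K * U) := by
            gcongr
        _ = _ := by field_simp; ring
    refine (sum_le_sum hb).trans (le_of_eq ?_)
    rw [sum_const, Nat.card_Icc, nsmul_eq_mul, Nat.add_sub_cancel]; ring
  · have hRle : ∀ t, |R (-t)| ≤ 20 / M * ∑ j ∈ range (Nat.log 2 M + 1), fejer (2 ^ j) t := by
      intro t
      have := abs_sawtooth_sub_le M hM (-t)
      simpa only [fejer_neg] using this
    have hsumR : ∑ n ∈ Ioc X (X' + 1), |R (-φ n)| ≤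
        20 / M * ((Nat.log 2 M + 1) * (X' + 1 - X) + 2 * M * V) := by
      refine (sum_le_sum fun n _ => hRle (φ n)).trans ?_
      rw [← mul_sum, sum_comm]
      refine mul_le_mul_of_nonneg_left ?_ (by positivity)
      have h1 : ∀ j ∈ range (Nat.log 2 M + 1), ∑ n ∈ Ioc X (X' + 1), fejer (2 ^ j) (φ n) ≤
          (X' + 1 - X : ℝ) + 2 ^ j * V := by
        intro j hj
        rw [mem_range] at hj
        have h2 : 2 ^ j ≤ M :=
          (Nat.pow_le_pow_right (by norm_num) (by omega)).trans (Nat.pow_log_le_self 2 (by omega))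
        have := sum_fejer_le φ X (X' + 1) (2 ^ j) (by omega) Nat.one_le_two_pow V
          (fun m hm hm' => hV m hm (by omega)) hV0
        push_cast at this
        exact this
      refine (sum_le_sum h1).trans ?_
      rw [sum_add_distrib, sum_const, card_range, nsmul_eq_mul, ← sum_mul]
      have h3 : ∑ j ∈ range (Nat.log 2 M + 1), (2 : ℝ) ^ j ≤ 2 * M := by
        rw [geom_sum_eq (by norm_num)]
        have : (2 : ℝ) ^ Nat.log 2 M ≤ M := by
          exact_mod_cast Nat.pow_log_le_self 2 (by omega : M ≠ 0)
        rw [pow_succ]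
        norm_num
        linarith
      push_cast
      gcongr
    have hR1 : ∑ n ∈ Ioc X X', |R (-φ n)| ≤ ∑ n ∈ Ioc X (X' + 1), |R (-φ n)| :=
      sum_le_sum_of_subset_of_nonneg (Ioc_subset_Ioc le_rfl (by omega)) fun _ _ _ => abs_nonneg _
    have hR2 : ∑ n ∈ Ioc X X', |R (-φ (n + 1))| ≤ ∑ n ∈ Ioc X (X' + 1), |R (-φ n)| := by
      rw [← Finset.sum_image (s := Ioc X X') (g := fun n => n + 1) (f := fun n => |R (-φ n)|)
        (fun x _ y _ h => by simpa using h)]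
      refine sum_le_sum_of_subset_of_nonneg (fun n hn => ?_) fun _ _ _ => abs_nonneg _
      rw [mem_image] at hn
      obtain ⟨k, hk, rfl⟩ := hn
      rw [mem_Ioc] at *; omega
    refine (norm_sum_le _ _).trans ?_
    have hb : ∀ n ∈ Ioc X X', ‖(w n : ℂ) * a n * ((R (-φ (n + 1)) - R (-φ n) : ℝ) : ℂ)‖ ≤
        w X' * A * (|R (-φ (n + 1))| + |R (-φ n)|) := by
      intro n hn
      rw [mem_Ioc] at hn
      rw [norm_mul, norm_mul, Complex.norm_real, Complex.norm_real, Real.norm_eq_abs,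
        Real.norm_eq_abs, abs_of_nonneg (hw0 n hn.1 hn.2)]
      have := ha n hn.1 hn.2
      have h2 := hwle n hn.2 hn.1
      have h3 := hw0 n hn.1 hn.2
      gcongr
      exact abs_sub _ _
    refine (sum_le_sum hb).trans ?_
    rw [← mul_sum, sum_add_distrib]
    calc _ ≤ w X' * A * (20 / M * ((Nat.log 2 M + 1) * (X' + 1 - X) + 2 * M * V) +
          20 / M * ((Nat.log 2 M + 1) * (X' + 1 - X) + 2 * M * V)) := by
          gcongr
          · exact hR2.trans hsumR
          · exact hR1.trans hsumR
      _ = _ := by ring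

end ThinPrimes
end

noncomputable section
open Filter Topology
namespace ThinPrimes

/-- `u` tends to `l` at infinity, and the first `n` iterates of the Euler operator `y * d/dy`
applied to `u` tend to `0`. -/
def Slow : ℕ → (ℝ → ℝ) → ℝ → Prop
  | 0, u, l => Tendsto u atTop (𝓝 l)
  | n + 1, u, l => Tendsto u atTop (𝓝 l) ∧ (∀ᶠ y in atTop, DifferentiableAt ℝ u y) ∧
      Slow n (fun y => y * deriv u y) 0

/-! ### Calculus of the Euler operator and regularly varying functions. -/

lemma eventually_atTop_nhds {p : ℝ → Prop} (h : ∀ᶠ y in atTop, p y) :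
    ∀ᶠ y in atTop, ∀ᶠ z in 𝓝 y, p z := by
  obtain ⟨A, hA⟩ := eventually_atTop.1 h
  filter_upwards [eventually_gt_atTop A] with y hy
  filter_upwards [lt_mem_nhds hy] with z hz
  exact hA z hz.le

namespace Slow

lemma tendsto {n : ℕ} {u : ℝ → ℝ} {l : ℝ} (h : Slow n u l) : Tendsto u atTop (𝓝 l) := by
  cases n with
  | zero => exact h
  | succ n => exact h.1

lemma congr {n : ℕ} : ∀ {u v : ℝ → ℝ} {l : ℝ}, Slow n u l → u =ᶠ[atTop] v → Slow n v l := by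
  induction n with
  | zero => intro u v l h huv; exact Tendsto.congr' huv h
  | succ n ih =>
    intro u v l h huv
    have hn := eventually_atTop_nhds huv
    refine ⟨h.1.congr' huv, ?_, ih h.2.2 ?_⟩
    · filter_upwards [hn, h.2.1] with y h1 h2
      exact h2.congr_of_eventuallyEq (h1.mono fun z hz => hz.symm)
    · filter_upwards [hn] with y h1
      rw [EventuallyEq.deriv_eq h1]

lemma succ_of {n : ℕ} {u v : ℝ → ℝ} {l : ℝ} (hu : Tendsto u atTop (𝓝 l))
    (hd : ∀ᶠ y in atTop, HasDerivAt u (v y / y) y) (hv : Slow n v 0) : Slow (n + 1) u l := by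
  refine ⟨hu, hd.mono fun y h => h.differentiableAt, hv.congr ?_⟩
  filter_upwards [hd, eventually_gt_atTop 0] with y h1 h2
  rw [h1.deriv, mul_div_cancel₀ _ h2.ne']

lemma hasDerivAt {n : ℕ} {u : ℝ → ℝ} {l : ℝ} (h : Slow (n + 1) u l) :
    ∀ᶠ y in atTop, HasDerivAt u (y * deriv u y / y) y := by
  filter_upwards [h.2.1, eventually_gt_atTop 0] with y h1 h2
  rw [mul_div_cancel_left₀ _ h2.ne']
  exact h1.hasDerivAt

lemma of_succ {n : ℕ} : ∀ {u : ℝ → ℝ} {l : ℝ}, Slow (n + 1) u l → Slow n u l := by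
  induction n with
  | zero => intro u l h; exact h.1
  | succ n ih => intro u l h; exact ⟨h.1, h.2.1, ih h.2.2⟩

lemma const (n : ℕ) : ∀ l : ℝ, Slow n (fun _ => l) l := by
  induction n with
  | zero => intro l; exact tendsto_const_nhds
  | succ n ih =>
    intro l
    refine succ_of (v := fun _ => 0) tendsto_const_nhds (Eventually.of_forall fun y => ?_) (ih 0)
    rw [zero_div]; exact hasDerivAt_const y l

lemma add {n : ℕ} : ∀ {u v : ℝ → ℝ} {l m : ℝ}, Slow n u l → Slow n v m →
    Slow n (fun y => u y + v y) (l + m) := by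
  induction n with
  | zero => intro u v l m hu hv; exact Tendsto.add hu hv
  | succ n ih =>
    intro u v l m hu hv
    have h := ih hu.2.2 hv.2.2
    rw [add_zero] at h
    refine succ_of (hu.1.add hv.1) ?_ h
    filter_upwards [hu.hasDerivAt, hv.hasDerivAt] with y h1 h2
    exact (h1.fun_add h2).congr_deriv (by rw [add_div])

lemma mul {n : ℕ} : ∀ {u v : ℝ → ℝ} {l m : ℝ}, Slow n u l → Slow n v m →
    Slow n (fun y => u y * v y) (l * m) := by
  induction n with
  | zero => intro u v l m hu hv; exact Tendsto.mul hu hv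
  | succ n ih =>
    intro u v l m hu hv
    have h := (ih hu.2.2 hv.of_succ).add (ih hu.of_succ hv.2.2)
    rw [mul_zero, zero_mul, add_zero] at h
    refine succ_of (hu.1.mul hv.1) ?_ h
    filter_upwards [hu.hasDerivAt, hv.hasDerivAt] with y h1 h2
    exact (h1.fun_mul h2).congr_deriv (by rw [add_div]; ring)

lemma const_mul {n : ℕ} {u : ℝ → ℝ} {l : ℝ} (a : ℝ) (hu : Slow n u l) :
    Slow n (fun y => a * u y) (a * l) := (const n a).mul hu

lemma inv {n : ℕ} : ∀ {u : ℝ → ℝ} {l : ℝ}, Slow n u l → l ≠ 0 →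
    Slow n (fun y => (u y)⁻¹) l⁻¹ := by
  induction n with
  | zero => intro u l hu hl; exact Tendsto.inv₀ hu hl
  | succ n ih =>
    intro u l hu hl
    have hi := ih hu.of_succ hl
    have h := ((hu.2.2.mul hi).mul hi).const_mul (-1)
    rw [zero_mul, zero_mul, mul_zero] at h
    refine succ_of (hu.1.inv₀ hl) ?_ h
    filter_upwards [hu.hasDerivAt, hu.1.eventually_ne hl] with y h1 h2
    refine (h1.fun_inv h2).congr_deriv ?_
    field_simp

/-- The Euler operator applied to u∘φ is (xu')∘φ times (c + ϑ∘φ)⁻¹. Induction over all u at once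
handles both factors, the second through ϑ itself. -/
lemma comp {φ ϑ : ℝ → ℝ} {c : ℝ} (hc : c ≠ 0) (hφ : Tendsto φ atTop atTop)
    (hd : ∀ᶠ y in atTop, HasDerivAt φ (φ y * (c + ϑ (φ y))⁻¹ / y) y)
    (hϑ : ∀ n, Slow n ϑ 0) {n : ℕ} : ∀ {u : ℝ → ℝ} {l : ℝ}, Slow n u l →
    Slow n (fun y => u (φ y)) l := by
  induction n with
  | zero => intro u l hu; exact Tendsto.comp hu hφ
  | succ n ih =>
    intro u l hu
    have h1 := ih hu.2.2
    have h2 := (const n c).add (ih (hϑ n))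
    rw [add_zero] at h2
    have h3 := h1.mul (h2.inv hc)
    rw [zero_mul] at h3
    refine succ_of (hu.1.comp hφ) ?_ h3
    filter_upwards [hd, hφ.eventually hu.2.1, hφ.eventually (eventually_gt_atTop 0)] with y e1 e2 e3
    refine (e2.hasDerivAt.comp y e1).congr_deriv ?_
    ring

end Slow

/-- A Potter bound: the logarithmic derivative of u(t) t^(-β) is (p(t) - β)/t, which is eventually
positive. -/
lemma exists_le_of_regular {u p : ℝ → ℝ} {α β : ℝ} (hu : ∀ᶠ y in atTop, 0 < u y)
    (hd : ∀ᶠ y in atTop, HasDerivAt u (u y * p y / y) y) (hp : Tendsto p atTop (𝓝 α)) (hβ : β < α) :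
    ∀ᶠ A in atTop, ∀ x, A ≤ x → ∀ y, x ≤ y → u x * (y / x) ^ β ≤ u y := by
  obtain ⟨A₀, hA₀⟩ := eventually_atTop.1 ((hu.and hd).and
    ((hp.eventually (lt_mem_nhds hβ)).and (eventually_gt_atTop 0)))
  filter_upwards [eventually_ge_atTop A₀] with A hA x hx y hxy
  have hx0 : 0 < x := (hA₀ x (hA.trans hx)).2.2
  have hder : ∀ t, x ≤ t → HasDerivAt (fun t => u t * t ^ (-β))
      (u t * p t / t * t ^ (-β) + u t * (-β * t ^ (-β - 1))) t := fun t ht => by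
    obtain ⟨⟨h1, h2⟩, h3, h4⟩ := hA₀ t (hA.trans (hx.trans ht))
    exact h2.fun_mul (Real.hasDerivAt_rpow_const (Or.inl h4.ne'))
  have hmono : MonotoneOn (fun t => u t * t ^ (-β)) (Set.Ici x) := by
    refine monotoneOn_of_deriv_nonneg (convex_Ici x)
      (fun t ht => (hder t ht).continuousAt.continuousWithinAt)
      (fun t ht => (hder t (interior_subset ht)).differentiableAt.differentiableWithinAt)
      fun t ht => ?_
    have ht' : x ≤ t := interior_subset ht
    obtain ⟨⟨h1, h2⟩, h3, h4⟩ := hA₀ t (hA.trans (hx.trans ht'))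
    rw [(hder t ht').deriv, Real.rpow_sub_one h4.ne']
    have : u t * p t / t * t ^ (-β) + u t * (-β * (t ^ (-β) / t)) =
        u t * t ^ (-β) / t * (p t - β) := by ring
    rw [this]
    exact mul_nonneg (by positivity) (by linarith)
  have h := hmono (Set.mem_Ici.2 le_rfl) (Set.mem_Ici.2 hxy) hxy
  simp only [] at h
  have hy0 : 0 < y := hx0.trans_le hxy
  rw [Real.rpow_neg hx0.le, Real.rpow_neg hy0.le, ← div_eq_mul_inv, ← div_eq_mul_inv,
    div_le_div_iff₀ (by positivity) (by positivity)] at h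
  rw [Real.div_rpow hy0.le hx0.le, mul_div_assoc', div_le_iff₀ (by positivity)]
  exact h

lemma exists_ge_of_regular {u p : ℝ → ℝ} {α β : ℝ} (hu : ∀ᶠ y in atTop, 0 < u y)
    (hd : ∀ᶠ y in atTop, HasDerivAt u (u y * p y / y) y) (hp : Tendsto p atTop (𝓝 α)) (hβ : α < β) :
    ∀ᶠ A in atTop, ∀ x, A ≤ x → ∀ y, x ≤ y → u y ≤ u x * (y / x) ^ β := by
  have h := exists_le_of_regular (u := fun y => (u y)⁻¹) (p := fun y => -p y) (α := -α) (β := -β)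
    (hu.mono fun y hy => by positivity) (by
      filter_upwards [hu, hd] with y h1 h2
      refine (h2.fun_inv h1.ne').congr_deriv ?_
      field_simp) hp.neg (by linarith)
  obtain ⟨A₀, hA₀⟩ := eventually_atTop.1 (hu.and (eventually_gt_atTop 0))
  filter_upwards [h, eventually_ge_atTop A₀] with A hA hA' x hx y hxy
  have h1 := hA x hx y hxy
  obtain ⟨h2, h3⟩ := hA₀ x (hA'.trans hx)
  obtain ⟨h4, h5⟩ := hA₀ y (hA'.trans (hx.trans hxy))
  rw [Real.rpow_neg (by positivity), ← mul_inv] at h1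
  exact (inv_le_inv₀ (by positivity) (by positivity)).1 h1

lemma eventually_rpow_le_of_regular {u p : ℝ → ℝ} {α β : ℝ} (hu : ∀ᶠ y in atTop, 0 < u y)
    (hd : ∀ᶠ y in atTop, HasDerivAt u (u y * p y / y) y) (hp : Tendsto p atTop (𝓝 α)) (hβ : β < α) :
    ∀ᶠ y in atTop, y ^ β ≤ u y := by
  obtain ⟨δ, hδ1, hδ2⟩ := exists_between hβ
  obtain ⟨A, ⟨hA, hA0⟩, hAu⟩ := ((exists_le_of_regular hu hd hp hδ2).and
    (eventually_gt_atTop 0) |>.and hu).exists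
  have ht : Tendsto (fun y : ℝ => y ^ (δ - β)) atTop atTop := tendsto_rpow_atTop (by linarith)
  filter_upwards [eventually_ge_atTop A, ht.eventually_ge_atTop (A ^ δ / u A)] with y hy hy2
  have hy0 : 0 < y := hA0.trans_le hy
  refine le_trans ?_ (hA A le_rfl y hy)
  rw [Real.div_rpow hy0.le hA0.le, mul_div_assoc', le_div_iff₀ (by positivity)]
  rw [div_le_iff₀ hAu, Real.rpow_sub hy0, div_mul_eq_mul_div, le_div_iff₀ (by positivity)] at hy2
  linarith

lemma eventually_le_rpow_of_regular {u p : ℝ → ℝ} {α β : ℝ} (hu : ∀ᶠ y in atTop, 0 < u y)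
    (hd : ∀ᶠ y in atTop, HasDerivAt u (u y * p y / y) y) (hp : Tendsto p atTop (𝓝 α)) (hβ : α < β) :
    ∀ᶠ y in atTop, u y ≤ y ^ β := by
  have h := eventually_rpow_le_of_regular (u := fun y => (u y)⁻¹) (p := fun y => -p y) (α := -α)
    (β := -β) (hu.mono fun y hy => by positivity) (by
      filter_upwards [hu, hd] with y h1 h2
      refine (h2.fun_inv h1.ne').congr_deriv ?_
      field_simp) hp.neg (by linarith)
  filter_upwards [h, hu, eventually_gt_atTop 0] with y h1 h2 h3
  rw [Real.rpow_neg h3.le] at h1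
  exact (inv_le_inv₀ (by positivity) h2).1 h1

end ThinPrimes
end

noncomputable section
open Filter Topology
namespace ThinPrimes

/-- The analytic properties of the inverse function `φ`, of which `ph` lists the derivatives, that
are needed for the exponential sum estimates.  The function `Φ` is regularly varying of index
`-a` and measures the size of the derivatives of `φ` of order at least two. -/
structure InverseData (q : ℕ) (a : ℝ) (φ : ℝ → ℝ) (ph : ℕ → ℝ → ℝ) (Φ : ℝ → ℝ)
    (c₁ c₂ s y₁ : ℝ) : Prop where
  one_le : 1 ≤ y₁
  zero : ph 0 = φ
  c₁_pos : 0 < c₁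
  c₁_le : c₁ ≤ c₂
  deriv : ∀ j ≤ q + 2, ∀ y, y₁ ≤ y → HasDerivAt (ph j) (ph (j + 1) y) y
  bounds : ∀ X : ℕ, y₁ ≤ X → PhaseBounds q c₁ c₂ X (Φ X) s ph
  lower : ∀ ε, 0 < ε → ∀ᶠ y in atTop, y ^ (-a - ε) ≤ Φ y
  upper : ∀ ε, 0 < ε → ∀ᶠ y in atTop, Φ y ≤ y ^ (-a + ε)
  deriv_pos : ∀ y, y₁ ≤ y → 0 < ph 1 y
  deriv_anti : AntitoneOn (ph 1) (Set.Ici y₁)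
  deriv_double : ∀ y, y₁ ≤ y → ∀ y', y ≤ y' → y' ≤ 3 * y → ph 1 y ≤ c₂ * ph 1 y'
  deriv_lower : ∀ ε, 0 < ε → ∀ᶠ y in atTop, y ^ (-a - ε) ≤ ph 1 y
  deriv_zero : Tendsto (ph 1) atTop (𝓝 0)
  second : ∀ y, y₁ ≤ y → |ph 2 y| * y ≤ c₂ * ph 1 y

/-- The factors `G_k` in `y ^ (k + 2) * φ⁽ᵏ⁺²⁾ = φ * σ * G_k`. -/
def eulerSeq (g w G : ℝ → ℝ) : ℕ → ℝ → ℝ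
  | 0 => G
  | k + 1 => fun y => (g y + w y + (-(k + 2) : ℝ)) * eulerSeq g w G k y
      + y * _root_.deriv (eulerSeq g w G k) y

/-! ### Derivatives of the inverse function, from its logarithmic derivative. -/

def eulerLim (γ e₂ : ℝ) : ℕ → ℝ
  | 0 => e₂
  | k + 1 => (γ + 0 + (-(k + 2) : ℝ)) * eulerLim γ e₂ k + 0

/-- Each step multiplies by γ - (k + 2), which is negative since γ ≤ 1. The added zeros in the
recursion match the limits produced by `Slow.add`. -/
lemma eulerLim_ne_zero {γ e₂ : ℝ} (hγ : γ ≤ 1) (he : e₂ ≠ 0) (k : ℕ) : eulerLim γ e₂ k ≠ 0 := by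
  induction k with
  | zero => exact he
  | succ k ih =>
    rw [eulerLim, add_zero]
    refine mul_ne_zero ?_ ih
    have : (0 : ℝ) ≤ k := by positivity
    linarith

lemma slow_eulerSeq {γ e₂ : ℝ} {g w G : ℝ → ℝ} (hg : ∀ n, Slow n g γ) (hw : ∀ n, Slow n w 0)
    (hG : ∀ n, Slow n G e₂) (k : ℕ) : ∀ n, Slow n (eulerSeq g w G k) (eulerLim γ e₂ k) := by
  induction k with
  | zero => exact hG
  | succ k ih =>
    intro n
    exact ((((hg n).add (hw n)).add (Slow.const n _)).mul (ih n)).add (ih (n + 1)).2.2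

/-- The successive derivatives of `φ` in terms of `g`, `σ` and the factors `eulerSeq`. -/
def derivTower (φ g σ w G : ℝ → ℝ) : ℕ → ℝ → ℝ
  | 0 => φ
  | 1 => fun y => φ y * g y / y
  | k + 2 => fun y => φ y * σ y * eulerSeq g w G k y / y ^ (k + 2)

-- With Φ = φσ/y, the quantity y^(k+2) φ⁽ᵏ⁺²⁾ is yΦ times a factor with nonzero limit, and Φ varies
-- regularly with index γ - 1. All size conditions hold eventually, so y₁ is taken beyond every
-- threshold and c₁, c₂ are crude numerical enlargements of the limits.
set_option maxHeartbeats 2000000 in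
theorem exists_inverseData {q : ℕ} (hq : 1 ≤ q) {γ e₂ : ℝ} (hγ0 : 0 < γ) (hγ1 : γ ≤ 1)
    {φ g σ w G : ℝ → ℝ} (hφ : ∀ᶠ y in atTop, 0 < φ y) (hσ : ∀ᶠ y in atTop, 0 < σ y)
    (hdφ : ∀ᶠ y in atTop, HasDerivAt φ (φ y * g y / y) y)
    (hdφ' : ∀ᶠ y in atTop, HasDerivAt (fun y => φ y * g y / y) (φ y * σ y * G y / y ^ 2) y)
    (hdσ : ∀ᶠ y in atTop, HasDerivAt σ (σ y * w y / y) y)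
    (hg : ∀ n, Slow n g γ) (hw : ∀ n, Slow n w 0) (hG : ∀ n, Slow n G e₂) (he₂ : e₂ < 0)
    (hσG : Tendsto (fun y => σ y * G y) atTop (𝓝 ((γ - 1) * γ)))
    (hφy : Tendsto (fun y => φ y / y) atTop (𝓝 0)) :
    ∃ (ph : ℕ → ℝ → ℝ) (Φ : ℝ → ℝ) (c₁ c₂ s y₁ : ℝ),
      InverseData q (1 - γ) φ ph Φ c₁ c₂ s y₁ := by
  set ph := derivTower φ g σ w G with hph
  set Gs := eulerSeq g w G with hGs
  set el := eulerLim γ e₂ with hel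
  have hsl := slow_eulerSeq hg hw hG
  have hphk : ∀ k y, ph (k + 2) y = φ y * σ y * Gs k y / y ^ (k + 2) := fun k y => rfl
  have hderiv : ∀ j, ∀ᶠ y in atTop, HasDerivAt (ph j) (ph (j + 1) y) y := by
    intro j
    match j with
    | 0 => exact hdφ
    | 1 => exact hdφ'
    | k + 2 =>
      filter_upwards [hdφ, hdσ, (hsl k 1).hasDerivAt, eventually_gt_atTop 0] with y h1 h2 h3 h4
      have h5 := ((h1.fun_mul h2).fun_mul h3).fun_div (hasDerivAt_pow (k + 2) y) (by positivity)
      refine h5.congr_deriv ?_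
      rw [show k + 2 + 1 = (k + 1) + 2 by ring, hphk, hGs]
      simp only [eulerSeq]
      push_cast
      field_simp
      ring
  -- the regularly varying functions `Φ` and `φ'`
  set Φ : ℝ → ℝ := fun y => φ y * σ y / y with hΦ
  have hΦpos : ∀ᶠ y in atTop, 0 < Φ y := by
    filter_upwards [hφ, hσ, eventually_gt_atTop 0] with y h1 h2 h3
    simp only [hΦ]; positivity
  have hΦd : ∀ᶠ y in atTop, HasDerivAt Φ (Φ y * (g y + w y - 1) / y) y := by
    filter_upwards [hdφ, hdσ, eventually_gt_atTop 0] with y h1 h2 h3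
    refine ((h1.fun_mul h2).fun_div (hasDerivAt_id' y) h3.ne').congr_deriv ?_
    simp only [hΦ]; field_simp
  have hΦp : Tendsto (fun y => g y + w y - 1) atTop (𝓝 (γ - 1)) := by
    have := ((hg 0).tendsto.add (hw 0).tendsto).sub_const 1
    rwa [add_zero] at this
  have hgpos : ∀ᶠ y in atTop, γ / 2 < g y := (hg 0).tendsto.eventually (lt_mem_nhds (by linarith))
  have hd1pos : ∀ᶠ y in atTop, 0 < ph 1 y := by
    filter_upwards [hφ, hgpos, eventually_gt_atTop 0] with y h1 h2 h3
    have : 0 < g y := by linarith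
    change 0 < φ y * g y / y
    positivity
  have hd1d : ∀ᶠ y in atTop, HasDerivAt (ph 1) (ph 1 y * (σ y * G y * (g y)⁻¹) / y) y := by
    filter_upwards [hdφ', hgpos, eventually_gt_atTop 0] with y h1 h2 h3
    refine h1.congr_deriv ?_
    change _ = φ y * g y / y * (σ y * G y * (g y)⁻¹) / y
    have : g y ≠ 0 := by linarith
    field_simp
  have hd1p : Tendsto (fun y => σ y * G y * (g y)⁻¹) atTop (𝓝 (γ - 1)) := by
    have := hσG.mul ((hg 0).tendsto.inv₀ hγ0.ne')
    rwa [mul_inv_cancel_right₀ hγ0.ne'] at this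
  -- The derivative of order q + 1 = i + 2 is governed by the i-th Euler factor, and s is the sign
  -- of its limit E.
  obtain ⟨i, rfl⟩ : ∃ i, q = i + 1 := ⟨q - 1, by omega⟩
  set E := el i with hE
  have hE0 : E ≠ 0 := eulerLim_ne_zero hγ1 he₂.ne i
  set s : ℝ := if 0 < E then 1 else -1 with hs
  have hs1 : s = 1 ∨ s = -1 := by rw [hs]; split_ifs <;> simp
  have hsE : s * E = |E| := by
    rw [hs]; split_ifs with h
    · rw [one_mul, abs_of_pos h]
    · rw [abs_of_nonpos (not_lt.1 h)]; ring
  have hE' : 0 < |E| := abs_pos.2 hE0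
  have hG0 : ∀ᶠ y in atTop, |E| / 2 < s * Gs i y ∧ s * Gs i y < 2 * |E| := by
    have h := (hsl i 0).tendsto.const_mul s
    rw [← hel, ← hE, hsE] at h
    exact (h.eventually (lt_mem_nhds (by linarith))).and
      (h.eventually (gt_mem_nhds (by linarith)))
  have hGi : ∀ k, ∀ᶠ y in atTop, |Gs k y| < |el k| + 1 := by
    intro k
    exact (hsl k 0).tendsto.abs.eventually (gt_mem_nhds (by rw [← hel]; linarith))
  -- The bracket governs the derivative of y^(q+1) φ⁽q+1⁾. Its limit is (i+2)E + (γ - i - 2)E = γE,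
  -- nonzero because γ > 0.
  have hG1 : ∀ᶠ y in atTop, γ * |E| / 2 < s * ((i + 2 : ℝ) * Gs i y + Gs (i + 1) y) ∧
      s * ((i + 2 : ℝ) * Gs i y + Gs (i + 1) y) < 2 * |E| := by
    have h := (((hsl i 0).tendsto.const_mul (i + 2 : ℝ)).add (hsl (i + 1) 0).tendsto).const_mul s
    have h2 : s * ((i + 2 : ℝ) * eulerLim γ e₂ i + eulerLim γ e₂ (i + 1)) = γ * |E| := by
      rw [← hsE, hE, hel, eulerLim]; ring
    rw [h2] at h
    have h3 : 0 < γ * |E| := by positivity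
    exact (h.eventually (lt_mem_nhds (by linarith))).and
      (h.eventually (gt_mem_nhds (by nlinarith)))
  -- The exponents -2 and 1 are convenient numbers on either side of the indices; over [X, 4X] they
  -- give Φ(X)/16 ≤ Φ(y) ≤ 4Φ(X).
  have hΦ1 := exists_le_of_regular hΦpos hΦd hΦp (show -2 < γ - 1 by linarith)
  have hΦ2 := exists_ge_of_regular hΦpos hΦd hΦp (show γ - 1 < 1 by linarith)
  have hd1 := exists_le_of_regular hd1pos hd1d hd1p (show -2 < γ - 1 by linarith)
  have hneg : ∀ᶠ y in atTop, G y < 0 := (hG 0).tendsto.eventually (gt_mem_nhds he₂)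
  have hσGb : ∀ᶠ y in atTop, |σ y * G y * (g y)⁻¹| < 2 := by
    have h2 : |γ - 1| < 2 := by rw [abs_lt]; constructor <;> linarith
    exact hd1p.abs.eventually (gt_mem_nhds h2)
  have hall := (Filter.eventually_all_finset (Finset.range (i + 4))).2 fun j _ => hderiv j
  set c₂ := 1000 * ((i + 4 : ℝ) * (|E| + |el (i + 1)| + |el (i + 2)| + 2)) with hc₂
  set c₁ := min (γ * |E| / 1000) (1 / 1000) with hc₁
  have hall2 := (hall.and (hΦpos.and (hd1pos.and (hG0.and (hG1.and ((hGi (i + 1)).and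
    ((hGi (i + 2)).and (hneg.and (hσGb.and (hφ.and (hσ.and (hd1d.and (eventually_ge_atTop 1)))))))))))))
  obtain ⟨A, hA⟩ := eventually_atTop.1 hall2
  obtain ⟨y₁, ⟨⟨hy1, hy2⟩, hy3⟩, hyA⟩ := (((hΦ1.and hΦ2).and hd1).and (eventually_ge_atTop A)).exists
  have hi0 : (0 : ℝ) ≤ i := by positivity
  have hc₁pos : 0 < c₁ := by rw [hc₁]; exact lt_min (by positivity) (by norm_num)
  have hc₂big : 2000 ≤ c₂ := by
    rw [hc₂]
    have : (1 : ℝ) * 2 ≤ (i + 4 : ℝ) * (|E| + |el (i + 1)| + |el (i + 2)| + 2) := by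
      have := abs_nonneg (el (i + 1))
      have := abs_nonneg (el (i + 2))
      exact mul_le_mul (by linarith) (by linarith) (by norm_num) (by linarith)
    linarith
  refine ⟨ph, Φ, c₁, c₂, s, y₁, ?_⟩
  have hget := fun y (hy : y₁ ≤ y) => hA y (hyA.trans hy)
  refine ⟨(hget y₁ le_rfl).2.2.2.2.2.2.2.2.2.2.2.2, rfl, hc₁pos, ?_, ?_, ?_, ?_, ?_, ?_, ?_, ?_, ?_, ?_, ?_⟩
  · refine (min_le_right _ _).trans ?_; linarith
  · intro j hj y hy
    exact (hget y hy).1 j (Finset.mem_range.2 (by omega))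
  · intro X hX
    have hX1 : (1 : ℝ) ≤ X := ((hget y₁ le_rfl).2.2.2.2.2.2.2.2.2.2.2.2).trans hX
    have hΦX : 0 < Φ X := (hget X hX).2.1
    have hΦlow : ∀ y ∈ Set.Icc (X : ℝ) (4 * X), Φ X / 16 ≤ Φ y := by
      intro y hy
      have h := hy1 X hX y hy.1
      refine le_trans ?_ h
      rw [div_eq_mul_inv]
      refine mul_le_mul_of_nonneg_left ?_ hΦX.le
      have hyX : y / X ≤ 4 := by rw [div_le_iff₀ (by linarith)]; exact hy.2
      have hyX0 : 0 < y / X := div_pos (by linarith [hy.1]) (by linarith)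
      rw [Real.rpow_neg hyX0.le]
      refine inv_anti₀ (by positivity) ?_
      rw [Real.rpow_two]; nlinarith
    have hΦup : ∀ y ∈ Set.Icc (X : ℝ) (4 * X), Φ y ≤ 4 * Φ X := by
      intro y hy
      have h := hy2 X hX y hy.1
      refine h.trans ?_
      have hyX : y / X ≤ 4 := by rw [div_le_iff₀ (by linarith)]; exact hy.2
      rw [Real.rpow_one]; nlinarith
    have hlowgen : ∀ y ∈ Set.Icc (X : ℝ) (4 * X), ∀ T, |E| / 2 * γ ≤ T → c₁ * Φ X ≤ Φ y * T := by
      intro y hy T hT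
      have h1 := hΦlow y hy
      have h2 : c₁ ≤ γ * |E| / 1000 := min_le_left _ _
      have h3 : 0 < γ * |E| := by positivity
      calc c₁ * Φ X ≤ γ * |E| / 1000 * Φ X := by gcongr
        _ ≤ Φ X / 16 * (|E| / 2 * γ) := by nlinarith [mul_pos h3 hΦX]
        _ ≤ Φ y * T := by
          have h4 : 0 ≤ Φ y := by linarith
          gcongr
    have hupgen : ∀ y ∈ Set.Icc (X : ℝ) (4 * X), ∀ T, T ≤ c₂ / 100 → Φ y * T ≤ c₂ / 20 * Φ X := by
      intro y hy T hT
      have h1 := hΦup y hy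
      have h2 := hΦlow y hy
      calc Φ y * T ≤ Φ y * (c₂ / 100) := by gcongr; linarith
        _ ≤ (4 * Φ X) * (c₂ / 100) := by gcongr
        _ ≤ _ := by nlinarith
    have hid1 : ∀ y ∈ Set.Icc (X : ℝ) (4 * X), ∀ k, y ^ (k + 2) * ph (k + 2) y = y * (Φ y * Gs k y) := by
      intro y hy k
      have hy0 : y ≠ 0 := by linarith [hy.1]
      rw [hphk]; simp only [hΦ]; field_simp
    have hid2 : ∀ y ∈ Set.Icc (X : ℝ) (4 * X), ∀ k : ℕ, (k + 2 : ℝ) * y ^ (k + 1) * ph (k + 2) y +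
        y ^ (k + 2) * ph (k + 3) y = Φ y * ((k + 2 : ℝ) * Gs k y + Gs (k + 1) y) := by
      intro y hy k
      have hy0 : y ≠ 0 := by linarith [hy.1]
      rw [show k + 3 = (k + 1) + 2 by ring, hphk, hphk]; simp only [hΦ]; field_simp; ring
    have hγE : |E| / 2 * γ ≤ |E| / 2 := by nlinarith
    have hE2 : 2 * |E| ≤ c₂ / 100 := by
      rw [hc₂]
      have h1 := abs_nonneg (el (i + 1)); have h2 := abs_nonneg (el (i + 2))
      nlinarith
    have hab1 : |el (i + 1)| + 1 ≤ c₂ / 100 := by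
      rw [hc₂]
      have h1 := abs_nonneg (el (i + 1)); have h2 := abs_nonneg (el (i + 2))
      nlinarith
    have hXy : ∀ y ∈ Set.Icc (X : ℝ) (4 * X), y₁ ≤ y := fun y hy => hX.trans hy.1
    refine ⟨hΦX, hs1, fun j hj y hy => (hget y (hXy y hy)).1 j (Finset.mem_range.2 (by omega)),
      ?_, ?_, ?_, ?_, ?_, ?_⟩
    · intro y hy
      obtain ⟨-, -, -, ⟨h1, -⟩, -⟩ := hget y (hXy y hy)
      rw [show i + 1 + 1 = i + 2 by ring, hid1 y hy i]
      have h2 := hlowgen y hy (s * Gs i y) (by linarith)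
      have h3 : 0 ≤ c₁ * Φ X := by positivity
      calc c₁ * (X * Φ X) = X * (c₁ * Φ X) := by ring
        _ ≤ y * (Φ y * (s * Gs i y)) := by
          have hy0 : 0 ≤ y := by linarith [hy.1]
          have := hy.1
          gcongr
        _ = _ := by ring
    · intro y hy
      obtain ⟨-, -, -, ⟨-, h1⟩, -⟩ := hget y (hXy y hy)
      rw [show i + 1 + 1 = i + 2 by ring, hid1 y hy i]
      have h2 := hupgen y hy (s * Gs i y) (by linarith)
      have hy0 : 0 ≤ y := by linarith [hy.1]
      calc s * (y * (Φ y * Gs i y)) = y * (Φ y * (s * Gs i y)) := by ring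
        _ ≤ y * (c₂ / 20 * Φ X) := by gcongr
        _ ≤ (4 * X) * (c₂ / 20 * Φ X) := by
          have : 0 ≤ c₂ / 20 * Φ X := by positivity
          have := hy.2
          gcongr
        _ ≤ c₂ * (X * Φ X) := by
          have : 0 ≤ c₂ * (X * Φ X) := by positivity
          nlinarith
    · intro y hy
      obtain ⟨-, hp, -, -, -, h1, -⟩ := hget y (hXy y hy)
      rw [show i + 1 + 2 = (i + 1) + 2 by ring, hid1 y hy (i + 1)]
      have h2 := hupgen y hy (|Gs (i + 1) y|) (by linarith)
      have hy0 : 0 ≤ y := by linarith [hy.1]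
      rw [abs_mul, abs_mul, abs_of_nonneg hy0, abs_of_pos hp]
      calc y * (Φ y * |Gs (i + 1) y|) ≤ y * (c₂ / 20 * Φ X) := by gcongr
        _ ≤ (4 * X) * (c₂ / 20 * Φ X) := by
          have : 0 ≤ c₂ / 20 * Φ X := by positivity
          have := hy.2
          gcongr
        _ ≤ c₂ * (X * Φ X) := by
          have : 0 ≤ c₂ * (X * Φ X) := by positivity
          nlinarith
    · intro y hy
      obtain ⟨-, -, -, -, ⟨h1, -⟩, -⟩ := hget y (hXy y hy)
      have h3 := hid2 y hy i
      rw [show (((i + 1 : ℕ) : ℝ) + 1) = (i + 2 : ℝ) by push_cast; ring]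
      change c₁ * Φ X ≤ s * ((i + 2 : ℝ) * y ^ (i + 1) * ph (i + 2) y + y ^ (i + 2) * ph (i + 3) y)
      rw [h3]
      have h2 := hlowgen y hy (s * ((i + 2 : ℝ) * Gs i y + Gs (i + 1) y)) (by linarith)
      linarith
    · intro y hy
      obtain ⟨-, -, -, -, ⟨-, h1⟩, -⟩ := hget y (hXy y hy)
      have h3 := hid2 y hy i
      rw [show (((i + 1 : ℕ) : ℝ) + 1) = (i + 2 : ℝ) by push_cast; ring]
      change s * ((i + 2 : ℝ) * y ^ (i + 1) * ph (i + 2) y + y ^ (i + 2) * ph (i + 3) y) ≤ c₂ * Φ X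
      rw [h3]
      have h2 := hupgen y hy (s * ((i + 2 : ℝ) * Gs i y + Gs (i + 1) y)) (by linarith)
      have : 0 ≤ c₂ * Φ X := by positivity
      linarith
    · intro y hy
      obtain ⟨-, hp, -, -, -, h1, h1', -⟩ := hget y (hXy y hy)
      have h3 := hid2 y hy (i + 1)
      rw [show (((i + 1 : ℕ) : ℝ) + 2) = (((i + 1 : ℕ) : ℝ) + 2 : ℝ) by push_cast; ring]
      change |(((i + 1 : ℕ) : ℝ) + 2) * y ^ (i + 1 + 1) * ph (i + 1 + 2) y
        + y ^ (i + 1 + 2) * ph (i + 1 + 3) y| ≤ c₂ * Φ X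
      rw [h3, abs_mul, abs_of_pos hp]
      have h4 : |(((i + 1 : ℕ) : ℝ) + 2) * Gs (i + 1) y + Gs (i + 1 + 1) y| ≤ c₂ / 100 := by
        refine (abs_add_le _ _).trans ?_
        rw [abs_mul, abs_of_nonneg (by positivity : (0 : ℝ) ≤ ((i + 1 : ℕ) : ℝ) + 2)]
        push_cast
        have e1 : (i + 1 + 2 : ℝ) * |Gs (i + 1) y| ≤ (i + 1 + 2) * (|el (i + 1)| + 1) := by gcongr
        have e2 : |Gs (i + 1 + 1) y| ≤ |el (i + 2)| + 1 := h1'.le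
        rw [hc₂]
        have h1 := abs_nonneg (el (i + 1)); have h2 := abs_nonneg (el (i + 2))
        nlinarith [mul_nonneg hi0 h1, mul_nonneg hi0 h2, mul_nonneg hi0 hE'.le]
      have h2 := hupgen y hy _ h4
      have : 0 ≤ c₂ * Φ X := by positivity
      linarith
  · intro ε hε
    exact eventually_rpow_le_of_regular hΦpos hΦd hΦp (by linarith)
  · intro ε hε
    exact eventually_le_rpow_of_regular hΦpos hΦd hΦp (by linarith)
  · intro y hy
    exact (hget y hy).2.2.1
  · refine antitoneOn_of_deriv_nonpos (convex_Ici y₁)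
      (fun t ht => ((hget t ht).1 1 (Finset.mem_range.2 (by omega))).continuousAt.continuousWithinAt)
      (fun t ht => ((hget t (interior_subset ht)).1 1
        (Finset.mem_range.2 (by omega))).differentiableAt.differentiableWithinAt) fun t ht => ?_
    obtain ⟨h1, -, -, -, -, -, -, h2, -, h3, h4, -, h5⟩ := hget t (interior_subset ht)
    rw [(h1 1 (Finset.mem_range.2 (by omega))).deriv, hphk 0 t]
    have : φ t * σ t * Gs 0 t = -(φ t * σ t * (-G t)) := by
      change φ t * σ t * G t = _
      ring
    rw [this, neg_div]
    have h6 : 0 < -G t := by linarith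
    have h7 : 0 < t := by linarith
    have : 0 < φ t * σ t * (-G t) / t ^ (0 + 2) := by positivity
    linarith
  · intro y hy y' hyy' hy'
    have h := hy3 y hy y' hyy'
    have hy0 : 1 ≤ y := (hget y hy).2.2.2.2.2.2.2.2.2.2.2.2
    have h1 : 0 < ph 1 y' := (hget y' (hy.trans hyy')).2.2.1
    have hyX : y' / y ≤ 3 := by rw [div_le_iff₀ (by linarith)]; exact hy'
    have hyX0 : 0 < y' / y := div_pos (by linarith) (by linarith)
    rw [Real.rpow_neg hyX0.le, Real.rpow_two, mul_inv_le_iff₀ (by positivity)] at h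
    refine h.trans ?_
    have : (y' / y) ^ 2 ≤ 9 := by nlinarith
    calc ph 1 y' * (y' / y) ^ 2 ≤ ph 1 y' * 9 := by gcongr
      _ ≤ c₂ * ph 1 y' := by nlinarith
  · intro ε hε
    exact eventually_rpow_le_of_regular hd1pos hd1d hd1p (by linarith)
  · have := hφy.mul (hg 0).tendsto
    rw [zero_mul] at this
    refine this.congr fun y => ?_
    change _ = φ y * g y / y
    ring
  · intro y hy
    obtain ⟨h1, -, hp, -, -, -, -, -, h2, -, -, h3, h5⟩ := hget y hy
    have h4 := (h1 1 (Finset.mem_range.2 (by omega))).unique h3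
    have hy0 : 0 < y := by linarith
    change |ph (1 + 1) y| * y ≤ _
    rw [h4, abs_div, abs_mul, abs_of_pos hp, abs_of_pos hy0, div_mul_cancel₀ _ hy0.ne']
    nlinarith

end ThinPrimes
end

noncomputable section
open Filter Topology
namespace ThinPrimes

/-! ### The inverse of a member of 𝓕_c. -/

lemma MemF.exists_hasDerivAt {c x₀ : ℝ} {h : ℝ → ℝ} (hh : MemF c x₀ h) :
    ∃ ϑ : ℝ → ℝ, IsCorrection c x₀ ϑ ∧
      ∀ x, x₀ < x → HasDerivAt h (h x * (c + ϑ x) / x) x := by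
  obtain ⟨ϑ, C, hϑ, hC, hform⟩ := hh.exists_correction
  refine ⟨ϑ, hϑ, fun x hx => ?_⟩
  have hx0 : 0 < x := by linarith [hh.one_le_x₀]
  have hcont : ContinuousOn (fun t => ϑ t / t) (Set.Ici x₀) := by
    refine hϑ.smooth.continuousOn.div continuousOn_id fun t ht => ?_
    have : x₀ ≤ t := ht
    have := hh.one_le_x₀
    exact ne_of_gt (by linarith : 0 < t)
  have hint : HasDerivAt (fun u => ∫ t in x₀..u, ϑ t / t) (ϑ x / x) x := by
    refine intervalIntegral.integral_hasDerivAt_right ?_ ?_ ?_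
    · refine (hcont.mono ?_).intervalIntegrable
      rw [Set.uIcc_of_le hx.le]
      exact Set.Icc_subset_Ici_self
    · exact (hcont.mono Set.Ioi_subset_Ici_self).stronglyMeasurableAtFilter isOpen_Ioi x hx
    · exact hcont.continuousAt (Ici_mem_nhds hx)
  have h1 := ((Real.hasDerivAt_rpow_const (p := c) (Or.inl hx0.ne')).const_mul C).fun_mul hint.exp
  have h2 : h =ᶠ[𝓝 x] fun x => C * x ^ c * Real.exp (∫ t in x₀..x, ϑ t / t) := by
    filter_upwards [lt_mem_nhds hx] with z hz
    exact hform z hz.le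
  refine (h1.congr_of_eventuallyEq h2).congr_deriv ?_
  rw [hform x hx.le, Real.rpow_sub_one hx0.ne']
  field_simp

lemma MemF.strictMonoOn {c x₀ : ℝ} {h : ℝ → ℝ} (hh : MemF c x₀ h) :
    StrictMonoOn h (Set.Ici x₀) := by
  refine strictMonoOn_of_deriv_pos (convex_Ici x₀) hh.smooth.continuousOn fun x hx => ?_
  rw [interior_Ici] at hx
  rw [← derivWithin_of_mem_nhds (Ici_mem_nhds hx)]
  exact hh.deriv_pos x (le_of_lt hx)

section inverse

variable {c x₀ : ℝ} {h φ : ℝ → ℝ}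

lemma IsInverse.strictMonoOn (hφ : IsInverse x₀ h φ) (hh : MemF c x₀ h) :
    StrictMonoOn φ (Set.Ici (h x₀)) := by
  intro y hy z hz hyz
  by_contra hcon
  have h1 := hh.strictMonoOn.monotoneOn (hφ.1 hz) (hφ.1 hy) (not_lt.1 hcon)
  rw [hφ.2.2 hy, hφ.2.2 hz] at h1
  linarith

lemma IsInverse.lt_apply (hφ : IsInverse x₀ h φ) (hh : MemF c x₀ h) {y : ℝ} (hy : h x₀ < y) :
    x₀ < φ y := by
  have h1 := hφ.strictMonoOn hh Set.self_mem_Ici hy.le hy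
  rwa [hφ.2.1 Set.self_mem_Ici] at h1

lemma IsInverse.tendsto_atTop (hφ : IsInverse x₀ h φ) (hh : MemF c x₀ h) :
    Tendsto φ atTop atTop := by
  refine Filter.tendsto_atTop.2 fun b => ?_
  have hx : max b x₀ ∈ Set.Ici x₀ := Set.mem_Ici.2 (le_max_right _ _)
  have h1 : h x₀ ≤ h (max b x₀) :=
    hh.strictMonoOn.monotoneOn Set.self_mem_Ici hx (le_max_right _ _)
  filter_upwards [eventually_ge_atTop (h (max b x₀))] with y hy
  have h2 := (hφ.strictMonoOn hh).monotoneOn (show h (max b x₀) ∈ Set.Ici (h x₀) from h1)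
    (show y ∈ Set.Ici (h x₀) from h1.trans hy) hy
  rw [hφ.2.1 hx] at h2
  exact (le_max_left _ _).trans h2

lemma IsInverse.continuousAt (hφ : IsInverse x₀ h φ) (hh : MemF c x₀ h) {y : ℝ} (hy : h x₀ < y) :
    ContinuousAt φ y := by
  refine (hφ.strictMonoOn hh).continuousAt_of_image_mem_nhds (Ici_mem_nhds hy) ?_
  refine mem_of_superset (Ici_mem_nhds (hφ.lt_apply hh hy)) fun x hx => ?_
  exact ⟨h x, hh.strictMonoOn.monotoneOn Set.self_mem_Ici hx hx, hφ.2.1 hx⟩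

lemma IsInverse.hasDerivAt (hφ : IsInverse x₀ h φ) (hh : MemF c x₀ h) {ϑ : ℝ → ℝ}
    (hd : ∀ x, x₀ < x → HasDerivAt h (h x * (c + ϑ x) / x) x) {y : ℝ} (hy : h x₀ < y) :
    HasDerivAt φ (φ y * (c + ϑ (φ y))⁻¹ / y) y := by
  have h1 := hφ.lt_apply hh hy
  have h2 := hd _ h1
  have h3 := hh.deriv_pos _ h1.le
  rw [derivWithin_of_mem_nhds (Ici_mem_nhds h1), h2.deriv] at h3
  have h4 := HasDerivAt.of_local_left_inverse (hφ.continuousAt hh hy) h2 h3.ne'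
    (by filter_upwards [lt_mem_nhds hy] with z hz; exact hφ.2.2 hz.le)
  refine h4.congr_deriv ?_
  rw [hφ.2.2 hy.le, inv_div, div_eq_mul_inv, mul_inv]
  ring

end inverse

/-- A family of functions, closed under the Euler operator in a suitable sense, all of whose
members tend to `0`, consists of slowly varying functions. -/
lemma slow_of_euler {r : ℕ → ℝ → ℝ} {b : ℝ} (hr : ∀ j, 1 ≤ j → Tendsto (r j) atTop (𝓝 0))
    (hd : ∀ j, 1 ≤ j → ∀ᶠ x in atTop,
      HasDerivAt (r j) ((j * r j x + r (j + 1) x + -b * (r j x * r 1 x)) / x) x) (n : ℕ) :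
    ∀ j, 1 ≤ j → Slow n (r j) 0 := by
  -- The induction treats all j together, since the Euler operator takes the j-th function to an
  -- expression in the j-th, the (j+1)-st and the first.
  induction n with
  | zero => exact hr
  | succ n ih =>
    intro j hj
    refine Slow.succ_of (hr j hj) (hd j hj) ?_
    have h1 := (((ih j hj).const_mul (j : ℝ)).add (ih (j + 1) (by omega))).add
      (((ih j hj).mul (ih 1 le_rfl)).const_mul (-b))
    simpa using h1

lemma slow_of_log_deriv {τ u : ℝ → ℝ} {l : ℝ} (hτ : Tendsto τ atTop (𝓝 l))
    (hd : ∀ᶠ x in atTop, HasDerivAt τ (τ x * u x / x) x) (hu : ∀ n, Slow n u 0) (n : ℕ) :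
    Slow n τ l := by
  induction n with
  | zero => exact hτ
  | succ n ih =>
    refine Slow.succ_of hτ hd ?_
    simpa using ih.mul (hu n)

lemma IsCorrection.hasDerivAt {c x₀ : ℝ} {ϑ : ℝ → ℝ} (hϑ : IsCorrection c x₀ ϑ) (j : ℕ) {x : ℝ}
    (hx : x₀ < x) : HasDerivAt (iteratedDerivWithin j ϑ (Set.Ici x₀))
      (iteratedDerivWithin (j + 1) ϑ (Set.Ici x₀) x) x := by
  have h1 := hϑ.smooth.differentiableOn_iteratedDerivWithin (m := j)
    (by exact_mod_cast WithTop.coe_lt_top _) (uniqueDiffOn_Ici x₀)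
  rw [iteratedDerivWithin_succ]
  exact ((h1 x hx.le).hasDerivWithinAt).hasDerivAt (Ici_mem_nhds hx)

/-- With g = (c + ϑ∘φ)⁻¹ one has yφ'/φ = g and y²φ''/φ = g² - g + yg'. The decay conditions on ϑ say
that x^j ϑ⁽ʲ⁾/τ tends to 0, and this family is closed under the Euler operator, so every function
involved is `Slow` and remains so after composition with φ. -/
theorem MemF.exists_inverseData {q : ℕ} (hq : 1 ≤ q) {c x₀ : ℝ} {h φ : ℝ → ℝ} (hh : MemF c x₀ h)
    (hφ : IsInverse x₀ h φ) :
    ∃ (ph : ℕ → ℝ → ℝ) (Φ : ℝ → ℝ) (c₁ c₂ s y₁ : ℝ),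
      InverseData q (1 - c⁻¹) φ ph Φ c₁ c₂ s y₁ := by
  obtain ⟨ϑ, hϑ, hd⟩ := hh.exists_hasDerivAt
  have hc := hh.one_le_c
  have hc0 : c ≠ 0 := by linarith
  have hγ0 : 0 < c⁻¹ := by positivity
  have hγ1 : c⁻¹ ≤ 1 := inv_le_one_of_one_le₀ hc
  set D : ℕ → ℝ → ℝ := fun j x => iteratedDerivWithin j ϑ (Set.Ici x₀) x with hD
  have hDd : ∀ j, ∀ᶠ x in atTop, HasDerivAt (D j) (D (j + 1) x) x := fun j => by
    filter_upwards [eventually_gt_atTop x₀] with x hx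
    exact hϑ.hasDerivAt j hx
  have hϑd : ∀ᶠ x in atTop, HasDerivAt ϑ (D 1 x) x := by
    have := hDd 0
    simpa [hD, iteratedDerivWithin_zero] using this
  have hcϑ : ∀ᶠ x in atTop, 0 < c + ϑ x := by
    have h1 : Tendsto (fun x => c + ϑ x) atTop (𝓝 (c + 0)) := hϑ.tendsto_zero.const_add c
    exact h1.eventually (lt_mem_nhds (by linarith))
  have hpos := eventually_gt_atTop (0 : ℝ)
  -- the normalising function `τ`
  obtain ⟨τ, b, l, K, e₂, hτpos, hτl, hτd, hrz, hKτ, he₂, hK⟩ : ∃ (τ : ℝ → ℝ) (b l : ℝ)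
      (K : ℝ → ℝ) (e₂ : ℝ), (∀ᶠ x in atTop, 0 < τ x) ∧ Tendsto τ atTop (𝓝 l) ∧
      (∀ᶠ x in atTop, HasDerivAt τ (b * D 1 x) x) ∧
      (∀ j, 1 ≤ j → Tendsto (fun x => x ^ j * D j x / τ x) atTop (𝓝 0)) ∧
      (∀ᶠ x in atTop, τ x * K x = ((c + ϑ x)⁻¹) ^ 2 - (c + ϑ x)⁻¹) ∧ e₂ < 0 ∧
      ((∀ n, Slow n ϑ 0) → ∀ n, Slow n K e₂) := by
    -- For c > 1 the limit c⁻² - c⁻¹ of g² - g is negative and τ = 1 will do. For c = 1 it vanishes,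
    -- but then g² - g = -ϑg² with ϑ and g taken at the same point, so dividing by τ = ϑ leaves the
    -- limit -1.
    rcases hc.eq_or_lt with rfl | hc1
    · refine ⟨ϑ, 1, 0, fun x => -1 * ((1 + ϑ x)⁻¹ * (1 + ϑ x)⁻¹), -1, ?_, hϑ.tendsto_zero, ?_,
        hϑ.deriv_of_eq_one rfl, ?_, by norm_num, ?_⟩
      · filter_upwards [eventually_ge_atTop x₀] with x hx
        exact hϑ.pos_of_eq_one rfl x hx
      · simpa using hϑd
      · filter_upwards [hcϑ] with x hx
        field_simp
        ring
      · intro hs n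
        have h1 := ((Slow.const n 1).add (hs n)).inv (by norm_num)
        have h2 := (h1.mul h1).const_mul (-1)
        norm_num at h2
        simpa using h2
    · refine ⟨fun _ => 1, 0, 1, fun x => (c + ϑ x)⁻¹ * (c + ϑ x)⁻¹ + -1 * (c + ϑ x)⁻¹,
        (c + 0)⁻¹ * (c + 0)⁻¹ + -1 * (c + 0)⁻¹, ?_, tendsto_const_nhds, ?_, ?_, ?_, ?_, ?_⟩
      · exact Eventually.of_forall fun x => one_pos
      · exact Eventually.of_forall fun x => by simpa using hasDerivAt_const x (1 : ℝ)
      · intro j hj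
        simpa using hϑ.deriv_of_one_lt hc1 j hj
      · exact Eventually.of_forall fun x => by ring
      · have : c⁻¹ < 1 := inv_lt_one_of_one_lt₀ hc1
        rw [add_zero]; nlinarith
      · intro hs n
        have h1 := ((Slow.const n c).add (hs n)).inv (by simpa using hc0)
        exact (h1.mul h1).add (h1.const_mul (-1))
  set r : ℕ → ℝ → ℝ := fun j x => x ^ j * D j x / τ x with hr
  have hrd : ∀ j, 1 ≤ j → ∀ᶠ x in atTop,
      HasDerivAt (r j) ((j * r j x + r (j + 1) x + -b * (r j x * r 1 x)) / x) x := by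
    intro j hj
    filter_upwards [hτd, hτpos, hDd j, hpos] with x h1 h2 h3 h4
    refine (((hasDerivAt_pow j x).fun_mul h3).fun_div h1 h2.ne').congr_deriv ?_
    obtain ⟨k, rfl⟩ : ∃ k, j = k + 1 := ⟨j - 1, by omega⟩
    simp only [hr, Nat.add_sub_cancel]
    field_simp
    ring
  have hrs : ∀ n, ∀ j, 1 ≤ j → Slow n (r j) 0 := slow_of_euler hrz hrd
  have hτd' : ∀ᶠ x in atTop, HasDerivAt τ (τ x * (b * r 1 x) / x) x := by
    filter_upwards [hτd, hτpos, hpos] with x h1 h2 h3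
    refine h1.congr_deriv ?_
    simp only [hr]
    field_simp
  have hbr : ∀ n, Slow n (fun x => b * r 1 x) 0 := fun n => by
    simpa using (hrs n 1 le_rfl).const_mul b
  have hτs : ∀ n, Slow n τ l := slow_of_log_deriv hτl hτd' hbr
  have hϑs : ∀ n, Slow n ϑ 0 := by
    intro n
    cases n with
    | zero => exact hϑ.tendsto_zero
    | succ n =>
      refine Slow.succ_of hϑ.tendsto_zero (v := fun x => τ x * r 1 x) ?_ ?_
      · filter_upwards [hϑd, hτpos, hpos] with x h1 h2 h3
        refine h1.congr_deriv ?_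
        simp only [hr]
        field_simp
      · simpa using (hτs n).mul (hrs n 1 le_rfl)
  have hKs := hK hϑs
  -- composition with `φ`
  have hφt := hφ.tendsto_atTop hh
  have hdφ : ∀ᶠ y in atTop, HasDerivAt φ (φ y * (c + ϑ (φ y))⁻¹ / y) y := by
    filter_upwards [eventually_gt_atTop (h x₀)] with y hy
    exact hφ.hasDerivAt hh hd hy
  have hcomp : ∀ {u : ℝ → ℝ} {m : ℝ}, (∀ n, Slow n u m) → ∀ n, Slow n (fun y => u (φ y)) m :=
    fun hu n => Slow.comp hc0 hφt hdφ hϑs (hu n)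
  have hg0 : ∀ n, Slow n (fun x => (c + ϑ x)⁻¹) c⁻¹ := fun n => by
    simpa using ((Slow.const n c).add (hϑs n)).inv (by simpa using hc0)
  have hφpos : ∀ᶠ y in atTop, 0 < φ y := hφt.eventually (eventually_gt_atTop 0)
  have hdg : ∀ᶠ y in atTop, HasDerivAt (fun y => (c + ϑ (φ y))⁻¹)
      (-((c + ϑ (φ y))⁻¹ ^ 3 * (φ y * D 1 (φ y))) / y) y := by
    filter_upwards [hdφ, hφt.eventually hϑd, hφt.eventually hcϑ, hpos] with y h1 h2 h3 h4
    refine (((h2.comp y h1).const_add c).fun_inv h3.ne').congr_deriv ?_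
    simp only [Function.comp]
    field_simp
  refine ThinPrimes.exists_inverseData (e₂ := e₂) hq hγ0 hγ1 (g := fun y => (c + ϑ (φ y))⁻¹)
    (σ := fun y => τ (φ y)) (w := fun y => b * r 1 (φ y) * (c + ϑ (φ y))⁻¹)
    (G := fun y => K (φ y) + -1 * ((c + ϑ (φ y))⁻¹ * (c + ϑ (φ y))⁻¹ * (c + ϑ (φ y))⁻¹
      * r 1 (φ y))) hφpos (hφt.eventually hτpos) hdφ ?_ ?_ (hcomp hg0) ?_ ?_ he₂ ?_ ?_
  · filter_upwards [hdφ, hdg, hφt.eventually hKτ, hφt.eventually hτpos, hpos] with y h1 h2 h3 h4 h5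
    refine ((h1.fun_mul h2).fun_div (hasDerivAt_id' y) h5.ne').congr_deriv ?_
    have h6 : φ y * D 1 (φ y) = τ (φ y) * r 1 (φ y) := by
      simp only [hr]; field_simp
    rw [h6]
    have h7 : φ y * τ (φ y) * (K (φ y) + -1 * ((c + ϑ (φ y))⁻¹ * (c + ϑ (φ y))⁻¹ *
        (c + ϑ (φ y))⁻¹ * r 1 (φ y))) = φ y * (τ (φ y) * K (φ y)) - φ y * (c + ϑ (φ y))⁻¹ ^ 3 *
        (τ (φ y) * r 1 (φ y)) := by ring
    rw [h7, h3]
    generalize (c + ϑ (φ y))⁻¹ = g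
    field_simp
    ring
  · filter_upwards [hdφ, hφt.eventually hτd', hφt.eventually hpos] with y h1 h2 h3
    refine (h2.comp y h1).congr_deriv ?_
    field_simp
  · exact fun n => by
      simpa using (hcomp hbr n).mul (hcomp hg0 n)
  · intro n
    have h1 := hcomp hg0 n
    simpa using (hcomp hKs n).add
      ((((h1.mul h1).mul h1).mul (hcomp (fun n => hrs n 1 le_rfl) n)).const_mul (-1))
  · have h1 : Tendsto (fun x => ((c + ϑ x)⁻¹) ^ 2 - (c + ϑ x)⁻¹ -
        ((c + ϑ x)⁻¹) ^ 3 * (τ x * r 1 x)) atTop (𝓝 ((c⁻¹) ^ 2 - c⁻¹ - (c⁻¹) ^ 3 * (l * 0))) := by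
      have h2 := (hg0 0).tendsto
      exact ((h2.pow 2).sub h2).sub ((h2.pow 3).mul (hτl.mul (hrz 1 le_rfl)))
    rw [show (c⁻¹) ^ 2 - c⁻¹ - (c⁻¹) ^ 3 * (l * 0) = (c⁻¹ - 1) * c⁻¹ by ring] at h1
    refine (h1.comp hφt).congr' ?_
    filter_upwards [hφt.eventually hKτ] with y h3
    simp only [Function.comp]
    rw [← h3]
    ring
  -- That φ(y)/y tends to 0 is the assumption x/h(x) → 0 if c = 1; if c > 1 it follows from the
  -- index c⁻¹ < 1 of φ.
  · rcases hc.eq_or_lt with rfl | hc1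
    · refine ((hh.div_tendsto_of_eq_one rfl).comp hφt).congr' ?_
      filter_upwards [eventually_ge_atTop (h x₀)] with y hy
      simp only [Function.comp]
      rw [hφ.2.2 hy]
    · have h1 : c⁻¹ < 1 := inv_lt_one_of_one_lt₀ hc1
      have h2 := eventually_le_rpow_of_regular hφpos hdφ (hcomp hg0 0).tendsto
        (show c⁻¹ < (c⁻¹ + 1) / 2 by linarith)
      have h3 : Tendsto (fun y : ℝ => y ^ (-((1 - c⁻¹) / 2))) atTop (𝓝 0) :=
        tendsto_rpow_neg_atTop (by linarith)
      refine tendsto_of_tendsto_of_tendsto_of_le_of_le' tendsto_const_nhds h3 ?_ ?_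
      · filter_upwards [hφpos, hpos] with y h4 h5
        positivity
      · filter_upwards [h2, hpos] with y h4 h5
        rw [div_le_iff₀ h5, ← Real.rpow_add_one h5.ne']
        refine h4.trans (le_of_eq ?_)
        congr 1
        ring

end ThinPrimes
end

noncomputable section
open Filter Topology
namespace ThinPrimes

/-! ### Exponential sums with the phases ±mφ + ξW: choice of parameters. -/

lemma PhaseBounds.add_polynomial {q : ℕ} {c₁ c₂ : ℝ} {X : ℕ} {V s : ℝ} {g : ℕ → ℝ → ℝ}
    (hg : PhaseBounds q c₁ c₂ X V s g) {P : Polynomial ℝ} (hP : P.natDegree ≤ q) {t σ : ℝ}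
    (ht : 0 < t) (hσ : σ = 1 ∨ σ = -1) (ξ : ℝ) :
    PhaseBounds q c₁ c₂ X (t * V) (σ * s)
      (fun j y => σ * t * g j y + ξ * (Polynomial.derivative^[j] P).eval y) := by
  have hz : ∀ j, q + 1 ≤ j → ∀ y, ξ * (Polynomial.derivative^[j] P).eval y = 0 := by
    intro j hj y
    rw [Polynomial.iterate_derivative_eq_zero (by omega), Polynomial.eval_zero, mul_zero]
  have hσσ : σ * σ = 1 := by rcases hσ with h | h <;> rw [h] <;> norm_num
  have hσa : |σ| = 1 := by rcases hσ with h | h <;> rw [h] <;> norm_num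
  have hscale : ∀ {u v : ℝ}, u ≤ v → t * u ≤ t * v := fun h => mul_le_mul_of_nonneg_left h ht.le
  refine ⟨mul_pos ht hg.V_pos, ?_, ?_, ?_, ?_, ?_, ?_, ?_, ?_⟩
  · rcases hσ with h | h <;> rcases hg.sign with h' | h' <;> rw [h, h'] <;> norm_num
  · intro j hj y hy
    refine ((hg.deriv j hj y hy).const_mul (σ * t)).fun_add (HasDerivAt.const_mul ξ ?_)
    rw [Function.iterate_succ_apply']
    exact Polynomial.hasDerivAt _ y
  · intro y hy
    simp only [hz (q + 1) le_rfl, add_zero]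
    calc c₁ * (X * (t * V)) = t * (c₁ * (X * V)) := by ring
      _ ≤ t * _ := hscale (hg.lower y hy)
      _ = (σ * σ) * (t * (s * (y ^ (q + 1) * g (q + 1) y))) := by rw [hσσ, one_mul]
      _ = _ := by ring
  · intro y hy
    simp only [hz (q + 1) le_rfl, add_zero]
    calc _ = (σ * σ) * (t * (s * (y ^ (q + 1) * g (q + 1) y))) := by ring
      _ = t * (s * (y ^ (q + 1) * g (q + 1) y)) := by rw [hσσ, one_mul]
      _ ≤ t * _ := hscale (hg.upper y hy)
      _ = _ := by ring
  · intro y hy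
    simp only [hz (q + 2) (by omega), add_zero]
    rw [show y ^ (q + 2) * (σ * t * g (q + 2) y) = σ * t * (y ^ (q + 2) * g (q + 2) y) by ring,
      abs_mul, abs_mul, hσa, one_mul, abs_of_pos ht]
    refine (hscale (hg.upper' y hy)).trans (le_of_eq ?_)
    ring
  · intro y hy
    simp only [hz (q + 1) le_rfl, hz (q + 2) (by omega), add_zero]
    calc c₁ * (t * V) = t * (c₁ * V) := by ring
      _ ≤ t * _ := hscale (hg.deriv_lower y hy)
      _ = (σ * σ) * (t * (s * ((q + 1) * y ^ q * g (q + 1) y + y ^ (q + 1) * g (q + 2) y))) := by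
        rw [hσσ, one_mul]
      _ = _ := by ring
  · intro y hy
    simp only [hz (q + 1) le_rfl, hz (q + 2) (by omega), add_zero]
    calc _ = (σ * σ) * (t * (s * ((q + 1) * y ^ q * g (q + 1) y + y ^ (q + 1) * g (q + 2) y))) := by
          ring
      _ = t * (s * ((q + 1) * y ^ q * g (q + 1) y + y ^ (q + 1) * g (q + 2) y)) := by
        rw [hσσ, one_mul]
      _ ≤ t * _ := hscale (hg.deriv_upper y hy)
      _ = _ := by ring
  · intro y hy
    simp only [hz (q + 3) (by omega), hz (q + 2) (by omega), add_zero]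
    rw [show (q + 2) * y ^ (q + 1) * (σ * t * g (q + 2) y) + y ^ (q + 2) * (σ * t * g (q + 3) y) =
      σ * t * ((q + 2) * y ^ (q + 1) * g (q + 2) y + y ^ (q + 2) * g (q + 3) y) by ring,
      abs_mul, abs_mul, hσa, one_mul, abs_of_pos ht]
    refine (hscale (hg.deriv_upper' y hy)).trans (le_of_eq ?_)
    ring

/-- This and the next lemma absorb constants and logarithms into small powers x^η. -/
lemma eventually_const_le_rpow (K : ℝ) {ε : ℝ} (hε : 0 < ε) : ∀ᶠ x : ℝ in atTop, K ≤ x ^ ε :=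
  (tendsto_rpow_atTop hε).eventually_ge_atTop K

lemma eventually_log_pow_le_rpow (K : ℝ) (hK : 0 ≤ K) (k : ℕ) {ε : ℝ} (hε : 0 < ε) :
    ∀ᶠ x : ℝ in atTop, K * (1 + Real.log (2 * x)) ^ k ≤ x ^ ε := by
  set δ := ε / (2 * (k + 1)) with hδ
  have hδ0 : 0 < δ := by positivity
  set B := 1 + 2 ^ δ / δ with hB
  filter_upwards [eventually_const_le_rpow (K * B ^ k) (half_pos hε), eventually_ge_atTop 1]
    with x h1 hx
  have hx0 : 0 < x := by linarith
  have h2 : 1 + Real.log (2 * x) ≤ B * x ^ δ := by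
    have h3 := Real.log_le_rpow_div (show 0 ≤ 2 * x by linarith) hδ0
    rw [Real.mul_rpow (by norm_num) hx0.le] at h3
    have h4 : 1 ≤ x ^ δ := Real.one_le_rpow hx hδ0.le
    calc 1 + Real.log (2 * x) ≤ x ^ δ + 2 ^ δ * x ^ δ / δ := by linarith
      _ = _ := by rw [hB]; ring
  have h5 : 0 ≤ 1 + Real.log (2 * x) := by
    have := Real.log_nonneg (show 1 ≤ 2 * x by linarith)
    linarith
  calc K * (1 + Real.log (2 * x)) ^ k ≤ K * (B * x ^ δ) ^ k := by gcongr
    _ = (K * B ^ k) * x ^ (δ * k) := by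
      rw [mul_pow, ← Real.rpow_natCast (x ^ δ), ← Real.rpow_mul hx0.le]; ring
    _ ≤ x ^ (ε / 2) * x ^ (ε / 2) := by
      have h6 : δ * k ≤ ε / 2 := by
        rw [hδ, div_mul_eq_mul_div, div_le_iff₀ (by positivity)]
        nlinarith
      gcongr
    _ = x ^ ε := by rw [← Real.rpow_add hx0, add_halves]

/-- `PhaseBounds.add_polynomial` makes ξW invisible, so `norm_vonMangoldtSum_le` applies with V =
mΦ(X) uniformly in ξ. -/
theorem eventually_norm_expSum_le {q : ℕ} (hq : 1 ≤ q) {a χ η : ℝ} (ha : 0 ≤ a) (hχ : 0 < χ)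
    (hη : 0 < η) (hcond : (2 ^ q + 1) * (2 * (a + 2 * χ) + 24 * η) + χ + 8 * η ≤ 1 / 2)
    {φ : ℝ → ℝ} {ph : ℕ → ℝ → ℝ} {Φ : ℝ → ℝ} {c₁ c₂ s y₁ : ℝ}
    (D : InverseData q a φ ph Φ c₁ c₂ s y₁) {P : Polynomial ℝ} (hP : P.natDegree ≤ q) :
    ∀ᶠ X : ℕ in atTop, ∀ X' : ℕ, X ≤ X' → X' ≤ 2 * X → ∀ m : ℕ, 1 ≤ m →
      (m : ℝ) ≤ 2 * (X : ℝ) ^ (a + χ + 5 * η) →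
      (∀ σ ξ : ℝ, σ = 1 ∨ σ = -1 → ‖∑ n ∈ Finset.Ioc X X',
        (ArithmeticFunction.vonMangoldt n : ℂ) * e (σ * m * φ n + ξ * P.eval (n : ℝ))‖ ≤
          (X : ℝ) ^ (1 - a - 2 * χ - 9 * η)) ∧
      ‖∑ n ∈ Finset.Ioc X (X' + 1), e (m * φ n)‖ ≤ (X : ℝ) ^ (1 - a - 2 * χ - 9 * η) := by
  obtain ⟨C, hC, hmain⟩ := norm_vonMangoldtSum_le q hq c₁ c₂ D.c₁_pos D.c₁_le
  obtain ⟨T, hT, hdiv⟩ := exists_card_divisors_le (half_pos hη)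
  -- With H near x^κ the saving √H is x^(a+2χ+12η); of the surplus, 3η pays for divisors, logarithms
  -- and constants.
  set κ := 2 * (a + 2 * χ) + 24 * η with hκ
  have hκ0 : 0 < κ := by positivity
  have h2q : (2 : ℝ) ≤ 2 ^ q := by
    calc (2 : ℝ) = 2 ^ 1 := by norm_num
      _ ≤ 2 ^ q := pow_le_pow_right₀ (by norm_num) hq
  have hκ1 : κ ≤ 1 / 2 := by nlinarith
  filter_upwards [tendsto_natCast_atTop_atTop.eventually (eventually_ge_atTop y₁),
    tendsto_natCast_atTop_atTop.eventually (eventually_ge_atTop (1 : ℝ)),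
    tendsto_natCast_atTop_atTop.eventually (D.lower η hη),
    tendsto_natCast_atTop_atTop.eventually (D.upper η hη),
    tendsto_natCast_atTop_atTop.eventually
      (eventually_const_le_rpow (T * 2 ^ (η / 2)) (half_pos hη)),
    tendsto_natCast_atTop_atTop.eventually (eventually_const_le_rpow 5 hη),
    tendsto_natCast_atTop_atTop.eventually
      (eventually_log_pow_le_rpow (3 * C) (by positivity) q hη),
    tendsto_natCast_atTop_atTop.eventually
      (eventually_log_pow_le_rpow 40 (by norm_num) 2 hη)] with X f1 f2 f3 f4 f5 f6 f7 f8
  intro X' hXX' hX' m hm hmM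
  set x : ℝ := (X : ℝ) with hx
  have hx0 : 0 < x := by linarith
  have hX1 : 1 ≤ X := by rw [hx] at f2; exact_mod_cast f2
  have hmono : ∀ {u v : ℝ}, u ≤ v → x ^ u ≤ x ^ v := fun h => Real.rpow_le_rpow_of_exponent_le f2 h
  have hm1 : (1 : ℝ) ≤ m := by exact_mod_cast hm
  set ℓ := 1 + Real.log (2 * x) with hℓ
  have hℓ1 : 1 ≤ ℓ := by
    have := Real.log_nonneg (show 1 ≤ 2 * x by linarith)
    linarith
  set H := ⌊x ^ κ⌋₊ with hH
  have hxκ : 1 ≤ x ^ κ := Real.one_le_rpow f2 hκ0.le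
  have hH1 : 1 ≤ H := Nat.le_floor (by exact_mod_cast hxκ)
  have hH1' : (1 : ℝ) ≤ H := by exact_mod_cast hH1
  have hHle : (H : ℝ) ≤ x ^ κ := Nat.floor_le (by positivity)
  have hHge : x ^ κ ≤ 2 * H := by
    have := Nat.lt_floor_add_one (x ^ κ)
    linarith
  have hsq : x ^ (κ / 2) / 2 ≤ √(H : ℝ) := by
    refine Real.le_sqrt_of_sq_le ?_
    rw [div_pow, ← Real.rpow_natCast, ← Real.rpow_mul hx0.le]
    rw [show κ / 2 * ((2 : ℕ) : ℝ) = κ by push_cast; ring]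
    linarith
  have hsq0 : 0 < √(H : ℝ) := Real.sqrt_pos.2 (by linarith)
  have hxs : x / √(H : ℝ) ≤ 2 * x ^ (1 - κ / 2) := by
    rw [div_le_iff₀ hsq0]
    calc x = 2 * x ^ (1 - κ / 2) * (x ^ (κ / 2) / 2) := by
          rw [show 2 * x ^ (1 - κ / 2) * (x ^ (κ / 2) / 2) = x ^ (1 - κ / 2) * x ^ (κ / 2) by ring,
            ← Real.rpow_add hx0, sub_add_cancel, Real.rpow_one]
      _ ≤ _ := by gcongr
  have hΦ : 0 < Φ x := lt_of_lt_of_le (by positivity) f3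
  have hV1 : (m * Φ x) ≤ 2 * x ^ (χ + 6 * η) := by
    calc m * Φ x ≤ (2 * x ^ (a + χ + 5 * η)) * x ^ (-a + η) := by gcongr
      _ = 2 * x ^ (χ + 6 * η) := by
        rw [mul_assoc, ← Real.rpow_add hx0]; congr 2; ring
  have hV2 : 1 / (m * Φ x) ≤ x ^ (a + η) := by
    have h1 : x ^ (-a - η) ≤ m * Φ x := by nlinarith
    calc 1 / (m * Φ x) ≤ 1 / x ^ (-a - η) := one_div_le_one_div_of_le (by positivity) h1
      _ = x ^ (a + η) := by rw [one_div, ← Real.rpow_neg hx0.le]; congr 1; ring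
  -- The left side is at most x raised to (2^q + 1)κ + χ + 7η, so the assumption `hcond` is what
  -- makes it at most √x.
  have hcondH : C * ℓ ^ q * (H * (m * Φ x) + 1 / (m * Φ x)) * (H : ℝ) ^ (2 ^ q) ≤ √x := by
    have h1 : H * (m * Φ x) + 1 / (m * Φ x) ≤ 3 * x ^ (κ + χ + 6 * η) := by
      have h2 : (H : ℝ) * (m * Φ x) ≤ x ^ κ * (2 * x ^ (χ + 6 * η)) := by gcongr
      have h3 : x ^ κ * (2 * x ^ (χ + 6 * η)) = 2 * x ^ (κ + χ + 6 * η) := by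
        rw [mul_left_comm, ← Real.rpow_add hx0]; congr 2; ring
      have h4 : x ^ (a + η) ≤ x ^ (κ + χ + 6 * η) := hmono (by linarith)
      linarith
    have h2 : (H : ℝ) ^ (2 ^ q) ≤ x ^ (κ * 2 ^ q) := by
      calc (H : ℝ) ^ (2 ^ q) ≤ (x ^ κ) ^ (2 ^ q) := by gcongr
        _ = x ^ (κ * 2 ^ q) := by
          rw [← Real.rpow_natCast, ← Real.rpow_mul hx0.le]; push_cast; rfl
    calc C * ℓ ^ q * (H * (m * Φ x) + 1 / (m * Φ x)) * (H : ℝ) ^ (2 ^ q)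
        ≤ C * ℓ ^ q * (3 * x ^ (κ + χ + 6 * η)) * x ^ (κ * 2 ^ q) := by gcongr
      _ = (3 * C * ℓ ^ q) * (x ^ (κ + χ + 6 * η) * x ^ (κ * 2 ^ q)) := by ring
      _ ≤ x ^ η * (x ^ (κ + χ + 6 * η) * x ^ (κ * 2 ^ q)) := by gcongr
      _ = x ^ (η + (κ + χ + 6 * η + κ * 2 ^ q)) := by rw [← Real.rpow_add hx0, ← Real.rpow_add hx0]
      _ ≤ x ^ (1 / 2 : ℝ) := hmono (by linarith)
      _ = √x := (Real.sqrt_eq_rpow x).symm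
  have hτ : ∀ n : ℕ, 1 ≤ n → n ≤ 2 * X → (n.divisors.card : ℝ) ≤ x ^ η := by
    intro n hn hn'
    have hnx : (n : ℝ) ≤ 2 * x := by rw [hx]; exact_mod_cast hn'
    calc (n.divisors.card : ℝ) ≤ T * (n : ℝ) ^ (η / 2) := hdiv n hn
      _ ≤ T * (2 * x) ^ (η / 2) := by gcongr
      _ = (T * 2 ^ (η / 2)) * x ^ (η / 2) := by rw [Real.mul_rpow (by norm_num) hx0.le]; ring
      _ ≤ x ^ (η / 2) * x ^ (η / 2) := by gcongr
      _ = x ^ η := by rw [← Real.rpow_add hx0, add_halves]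
  have hphase := fun (σ ξ : ℝ) (hσ : σ = 1 ∨ σ = -1) =>
    hmain _ X X' H (m * Φ x) (σ * s) ℓ (x ^ η)
      ((D.bounds X f1).add_polynomial hP (show (0 : ℝ) < m by linarith) hσ ξ) hXX' hX' hX1 hH1
      le_rfl hcondH hτ
  simp only [D.zero, Function.iterate_zero, id] at hphase
  refine ⟨fun σ ξ hσ => (hphase σ ξ hσ).1.trans ?_, ?_⟩
  · calc 20 * x ^ η * ℓ ^ 2 * x / √(H : ℝ) = 20 * x ^ η * ℓ ^ 2 * (x / √(H : ℝ)) := by ring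
      _ ≤ 20 * x ^ η * ℓ ^ 2 * (2 * x ^ (1 - κ / 2)) := by gcongr
      _ = (40 * ℓ ^ 2) * (x ^ η * x ^ (1 - κ / 2)) := by ring
      _ ≤ x ^ η * (x ^ η * x ^ (1 - κ / 2)) := by gcongr
      _ = x ^ (η + (η + (1 - κ / 2))) := by rw [← Real.rpow_add hx0, ← Real.rpow_add hx0]
      _ ≤ _ := hmono (by rw [hκ]; linarith)
  · have h1 := (hphase 1 0 (Or.inl rfl)).2
    simp only [one_mul, zero_mul, add_zero] at h1
    rw [Finset.sum_Ioc_succ_top (by omega)]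
    refine (norm_add_le _ _).trans ?_
    rw [norm_e]
    have h2 : 1 ≤ x ^ (1 - κ / 2) := Real.one_le_rpow f2 (by linarith)
    calc _ ≤ 2 * x / √(H : ℝ) + 1 := by gcongr
      _ = 2 * (x / √(H : ℝ)) + 1 := by ring
      _ ≤ 5 * x ^ (1 - κ / 2) := by linarith
      _ ≤ x ^ η * x ^ (1 - κ / 2) := by gcongr
      _ = x ^ (η + (1 - κ / 2)) := by rw [← Real.rpow_add hx0]
      _ ≤ _ := hmono (by rw [hκ]; linarith)

end ThinPrimes
end

noncomputable section
open Filter Topology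
namespace ThinPrimes

section blocks

variable {q : ℕ} {a χ η : ℝ} {φ : ℝ → ℝ} {ph : ℕ → ℝ → ℝ} {Φ : ℝ → ℝ} {c₁ c₂ s y₁ : ℝ}

/-! ### The contribution of a dyadic block. -/

lemma InverseData.exists_sub_eq (D : InverseData q a φ ph Φ c₁ c₂ s y₁) {y : ℝ} (hy : y₁ ≤ y) :
    ∃ ζ, y ≤ ζ ∧ ζ ≤ y + 1 ∧ φ (y + 1) - φ y = ph 1 ζ := by
  have hd : ∀ z ∈ Set.Icc y (y + 1), HasDerivAt φ (ph 1 z) z := fun z hz => by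
    have := D.deriv 0 (by omega) z (hy.trans hz.1)
    rwa [D.zero] at this
  obtain ⟨ζ, h1, h2⟩ := exists_hasDerivAt_eq_slope φ (ph 1) (show y < y + 1 by linarith)
    (fun z hz => (hd z hz).continuousAt.continuousWithinAt)
    fun z hz => hd z (Set.Ioo_subset_Icc_self hz)
  refine ⟨ζ, h1.1.le, h1.2.le, ?_⟩
  rw [h2]; ring

lemma InverseData.abs_sub_sub_le (D : InverseData q a φ ph Φ c₁ c₂ s y₁) {y : ℝ} (hy : y₁ ≤ y) :
    |φ (y + 1) - φ y - ph 1 y| ≤ c₂ * ph 1 y / y := by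
  have hy0 : 0 < y := by linarith [D.one_le]
  have hc₂ : 0 < c₂ := D.c₁_pos.trans_le D.c₁_le
  obtain ⟨ζ, h1, h2, h3⟩ := D.exists_sub_eq hy
  rw [h3]
  have hb : ∀ z ∈ Set.Icc y (y + 1), ‖ph 2 z‖ ≤ c₂ * ph 1 y / y := fun z hz => by
    have hz1 := hy.trans hz.1
    have hz0 : 0 < z := by linarith [hz.1]
    have h4 := D.second z hz1
    have h5 := D.deriv_anti hy hz1 hz.1
    have h6 := D.deriv_pos z hz1
    rw [Real.norm_eq_abs, le_div_iff₀ hy0]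
    calc |ph 2 z| * y ≤ |ph 2 z| * z := by gcongr; exact hz.1
      _ ≤ c₂ * ph 1 z := h4
      _ ≤ c₂ * ph 1 y := by gcongr
  have h7 := Convex.norm_image_sub_le_of_norm_hasDerivWithin_le
    (fun z hz => (D.deriv 1 (by omega) z (hy.trans hz.1)).hasDerivWithinAt) hb
    (convex_Icc y (y + 1)) (Set.left_mem_Icc.2 (by linarith)) (Set.mem_Icc.2 ⟨h1, h2⟩)
  rw [Real.norm_eq_abs, Real.norm_eq_abs] at h7
  refine h7.trans ?_
  have h8 : |ζ - y| ≤ 1 := by rw [abs_of_nonneg (by linarith)]; linarith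
  have h9 : 0 ≤ c₂ * ph 1 y / y := by have := D.deriv_pos y hy; positivity
  nlinarith

/-- `norm_sawtoothSum_le` with w = 1/φ', for which w is increasing and the increments of φ are
decreasing because φ' is decreasing. -/
theorem eventually_norm_sawtoothSum_le (hq : 1 ≤ q) (ha : 0 ≤ a) (hχ : 0 < χ)
    (hη : 0 < η) (hcond : (2 ^ q + 1) * (2 * (a + 2 * χ) + 24 * η) + χ + 8 * η ≤ 1 / 2)
    (D : InverseData q a φ ph Φ c₁ c₂ s y₁) {P : Polynomial ℝ} (hP : P.natDegree ≤ q) :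
    ∀ᶠ X : ℕ in atTop, ∀ X' : ℕ, X < X' → X' ≤ 2 * X → ∀ ξ : ℝ,
      ‖∑ n ∈ Finset.Ioc X X', (((ph 1 n)⁻¹ : ℝ) : ℂ) *
        ((ArithmeticFunction.vonMangoldt n : ℂ) * e (ξ * P.eval (n : ℝ))) *
        ((Int.fract (-φ ((n + 1 : ℕ) : ℝ)) - Int.fract (-φ n) : ℝ) : ℂ)‖ ≤
          (X : ℝ) ^ (1 - χ - 3 * η) := by
  have hc₂ : 0 < c₂ := D.c₁_pos.trans_le D.c₁_le
  have h2q : (2 : ℝ) ≤ 2 ^ q := by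
    calc (2 : ℝ) = 2 ^ 1 := by norm_num
      _ ≤ 2 ^ q := pow_le_pow_right₀ (by norm_num) hq
  have hsmall : 6 * a + 13 * χ + 72 * η ≤ 1 / 2 := by nlinarith
  filter_upwards [eventually_norm_expSum_le hq ha hχ hη hcond D hP,
    tendsto_natCast_atTop_atTop.eventually (eventually_ge_atTop y₁),
    tendsto_natCast_atTop_atTop.eventually (eventually_ge_atTop (1 : ℝ)),
    tendsto_natCast_atTop_atTop.eventually (D.deriv_lower η hη),
    tendsto_natCast_atTop_atTop.eventually
      (eventually_log_pow_le_rpow (252 * c₂) (by positivity) 2 hη)] with X hE f1 f2 f3 f4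
  intro X' hXX' hX' ξ
  set x : ℝ := (X : ℝ) with hx
  have hx0 : 0 < x := by linarith
  have hmono : ∀ {u v : ℝ}, u ≤ v → x ^ u ≤ x ^ v := fun h => Real.rpow_le_rpow_of_exponent_le f2 h
  set ℓ := 1 + Real.log (2 * x) with hℓ
  have hlog0 := Real.log_nonneg (show 1 ≤ 2 * x by linarith)
  have hℓ1 : 1 ≤ ℓ := by linarith
  have hX'x : (X' : ℝ) ≤ 2 * x := by rw [hx]; exact_mod_cast hX'
  have hxX' : x + 1 ≤ X' := by rw [hx]; exact_mod_cast hXX'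
  have hge : ∀ n : ℕ, X < n → y₁ ≤ (n : ℝ) := fun n hn => by
    have : x ≤ n := by rw [hx]; exact_mod_cast hn.le
    linarith
  -- The weight is at most a multiple of x^(a+η), so the mean error wX/M is of order x^(1-χ-4η). The
  -- sum MU over the frequencies has the same order, which balances the two contributions.
  set M := ⌈x ^ (a + χ + 5 * η)⌉₊ with hM
  have hxM : 1 ≤ x ^ (a + χ + 5 * η) := Real.one_le_rpow f2 (by linarith)
  have hMge : x ^ (a + χ + 5 * η) ≤ M := Nat.le_ceil _
  have hM1' : (1 : ℝ) ≤ M := hxM.trans hMge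
  have hM1 : 1 ≤ M := by exact_mod_cast hM1'
  have hMle : (M : ℝ) ≤ 2 * x ^ (a + χ + 5 * η) := by
    have := Nat.ceil_lt_add_one (show 0 ≤ x ^ (a + χ + 5 * η) by positivity)
    linarith
  set U := x ^ (1 - a - 2 * χ - 9 * η) with hU
  have hU0 : 0 < U := by positivity
  have hstep : ∀ n : ℕ, X < n → ∃ ζ, (n : ℝ) ≤ ζ ∧ ζ ≤ n + 1 ∧
      φ ((n + 1 : ℕ) : ℝ) - φ n = ph 1 ζ := fun n hn => by
    rw [Nat.cast_add_one]
    exact D.exists_sub_eq (hge n hn)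
  have hmain := norm_sawtoothSum_le (fun n => φ n) (fun n => (ph 1 n)⁻¹)
    (fun n => (ArithmeticFunction.vonMangoldt n : ℂ) * e (ξ * P.eval (n : ℝ))) X X' M ℓ c₂ U U
    hXX' hM1 ?_ ?_ ?_ ?_ ?_ ?_ ?_ ?_
  · refine hmain.trans ?_
    have hw : (ph 1 X')⁻¹ ≤ c₂ * x ^ (a + η) := by
      have h1 := D.deriv_double x f1 X' (by linarith) (by linarith)
      have h2 := D.deriv_pos X' (hge X' hXX')
      have h3 : x ^ (-a - η) ≤ c₂ * ph 1 X' := f3.trans h1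
      rw [inv_le_iff_one_le_mul₀ h2]
      calc (1 : ℝ) = x ^ (a + η) * x ^ (-a - η) := by
            rw [← Real.rpow_add hx0, show a + η + (-a - η) = 0 by ring, Real.rpow_zero]
        _ ≤ x ^ (a + η) * (c₂ * ph 1 X') := by gcongr
        _ = _ := by ring
    have hw0 : 0 ≤ (ph 1 X')⁻¹ := inv_nonneg.2 (D.deriv_pos X' (hge X' hXX')).le
    have hL : (Nat.log 2 M : ℝ) + 1 ≤ 2 * ℓ := by
      have h1 : (Nat.log 2 M : ℝ) ≤ Real.logb 2 M := by exact_mod_cast Real.natLog_le_logb M 2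
      have h2 : Real.log M ≤ Real.log (2 * x) := by
        refine Real.log_le_log (by linarith) (hMle.trans ?_)
        have : x ^ (a + χ + 5 * η) ≤ x ^ (1 : ℝ) := hmono (by linarith)
        rw [Real.rpow_one] at this
        linarith
      have h3 : Real.logb 2 M ≤ 2 * Real.log M := by
        have h4 := Real.log_nonneg hM1'
        have h5 := Real.log_two_gt_d9
        rw [Real.logb, div_le_iff₀ (by linarith)]
        nlinarith
      linarith
    have hMU : M * U ≤ 2 * x ^ (1 - χ - 4 * η) := by
      calc M * U ≤ (2 * x ^ (a + χ + 5 * η)) * U := by gcongr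
        _ = 2 * x ^ (1 - χ - 4 * η) := by
          rw [hU, mul_assoc, ← Real.rpow_add hx0]; congr 2; ring
    have hwU : (ph 1 X')⁻¹ * U ≤ c₂ * x ^ (1 - χ - 4 * η) := by
      calc (ph 1 X')⁻¹ * U ≤ (c₂ * x ^ (a + η)) * U := by gcongr
        _ = c₂ * x ^ (a + η + (1 - a - 2 * χ - 9 * η)) := by
          rw [hU, mul_assoc, ← Real.rpow_add hx0]
        _ ≤ _ := by gcongr c₂ * ?_; exact hmono (by linarith)
    have hwM : (ph 1 X')⁻¹ * (X' + 1 - x) / M ≤ 2 * c₂ * x ^ (1 - χ - 4 * η) := by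
      rw [div_le_iff₀ (by linarith)]
      calc (ph 1 X')⁻¹ * (X' + 1 - x) ≤ (c₂ * x ^ (a + η)) * (2 * x ^ (1 : ℝ)) := by
            rw [Real.rpow_one]
            exact mul_le_mul hw (by linarith) (by linarith) (by positivity)
        _ = 2 * c₂ * x ^ (1 - χ - 4 * η) * x ^ (a + χ + 5 * η) := by
          rw [show c₂ * x ^ (a + η) * (2 * x ^ (1 : ℝ)) = 2 * c₂ * (x ^ (a + η) * x ^ (1 : ℝ)) by
            ring, ← Real.rpow_add hx0, mul_assoc (2 * c₂), ← Real.rpow_add hx0]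
          congr 2; ring
        _ ≤ _ := by gcongr
    have hY : 0 ≤ x ^ (1 - χ - 4 * η) := by positivity
    set Y := x ^ (1 - χ - 4 * η) with hYdef
    calc _ = 6 * c₂ * (M * U) + 80 * ℓ * ((ph 1 X')⁻¹ * U) + 40 * ℓ * ((Nat.log 2 M : ℝ) + 1) *
          ((ph 1 X')⁻¹ * (X' + 1 - x) / M) := by field_simp; ring
      _ ≤ 6 * c₂ * (2 * Y) + 80 * ℓ * (c₂ * Y) + 40 * ℓ * (2 * ℓ) * (2 * c₂ * Y) := by
        have h0 : 0 ≤ (ph 1 X')⁻¹ * (X' + 1 - x) / M := by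
          have : 0 ≤ X' + 1 - x := by linarith
          positivity
        gcongr
      _ = (12 + 80 * ℓ + 160 * ℓ ^ 2) * (c₂ * Y) := by ring
      _ ≤ (252 * ℓ ^ 2) * (c₂ * Y) := by
        gcongr
        nlinarith
      _ = (252 * c₂ * ℓ ^ 2) * Y := by ring
      _ ≤ x ^ η * Y := by gcongr
      _ = x ^ (1 - χ - 3 * η) := by rw [hYdef, ← Real.rpow_add hx0]; congr 1; ring
  · intro n hn _
    exact inv_nonneg.2 (D.deriv_pos n (hge n hn)).le
  · intro n hn _
    have h1 : (n : ℝ) ≤ ((n + 1 : ℕ) : ℝ) := by push_cast; linarith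
    exact inv_anti₀ (D.deriv_pos _ (hge _ (by omega)))
      (D.deriv_anti (hge n hn) (hge (n + 1) (by omega)) h1)
  · intro n hn _
    obtain ⟨ζ, h1, -, h2⟩ := hstep n hn
    simp only [h2]
    exact (D.deriv_pos ζ ((hge n hn).trans h1)).le
  · intro n hn _
    obtain ⟨ζ, h1, h1', h2⟩ := hstep n hn
    obtain ⟨ζ', h3, -, h4⟩ := hstep (n + 1) (by omega)
    simp only [h2]
    refine le_trans (le_of_eq h4) ?_
    have h5 : ζ ≤ ζ' := by push_cast at h3; linarith
    exact D.deriv_anti ((hge n hn).trans h1) (((hge n hn).trans h1).trans h5) h5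
  · obtain ⟨ζ, h1, h1', h2⟩ := hstep (X + 1) (by omega)
    have h3 := hge (X + 1) (by omega)
    have h4 := D.deriv_anti h3 (h3.trans h1) h1
    have h5 := D.deriv_double _ h3 X' (by exact_mod_cast hXX') (by push_cast; linarith)
    have h6 := D.deriv_pos X' (hge X' hXX')
    calc (ph 1 X')⁻¹ * (φ ((X + 1 + 1 : ℕ) : ℝ) - φ ((X + 1 : ℕ) : ℝ)) = (ph 1 X')⁻¹ * ph 1 ζ := by
          rw [h2]
      _ ≤ (ph 1 X')⁻¹ * (c₂ * ph 1 X') := by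
        gcongr
        exact h4.trans h5
      _ = c₂ := by field_simp
  · intro n hn hn'
    rw [norm_mul, norm_e, mul_one, Complex.norm_real, Real.norm_eq_abs,
      abs_of_nonneg ArithmeticFunction.vonMangoldt_nonneg]
    refine ArithmeticFunction.vonMangoldt_le_log.trans ?_
    have h1 : (n : ℝ) ≤ 2 * x := by
      have : (n : ℝ) ≤ X' := by exact_mod_cast hn'
      linarith
    have h2 : (0 : ℝ) < n := by exact_mod_cast (by omega : 0 < n)
    have := Real.log_le_log h2 h1
    linarith
  · intro m hm hmM y hy hy'
    have hmM' : (m : ℝ) ≤ M := by exact_mod_cast hmM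
    have h1 := (hE y hy (hy'.trans hX') m hm (hmM'.trans hMle)).1
    constructor
    · refine (le_of_eq (congrArg _ (Finset.sum_congr rfl fun n _ => ?_))).trans (h1 1 ξ (Or.inl rfl))
      rw [e_add, one_mul]; ring
    · refine (le_of_eq (congrArg _ (Finset.sum_congr rfl fun n _ => ?_))).trans
        (h1 (-1) ξ (Or.inr rfl))
      rw [e_add, neg_one_mul]; ring
  · intro m hm hmM
    have hmM' : (m : ℝ) ≤ M := by exact_mod_cast hmM
    exact (hE X' hXX'.le hX' m hm (hmM'.trans hMle)).2

/-- The contribution of the primes in a dyadic block. -/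
theorem eventually_norm_primeBlock_le (hq : 1 ≤ q) (ha : 0 ≤ a) (hχ : 0 < χ)
    (hη : 0 < η) (hcond : (2 ^ q + 1) * (2 * (a + 2 * χ) + 24 * η) + χ + 8 * η ≤ 1 / 2)
    (D : InverseData q a φ ph Φ c₁ c₂ s y₁) {P : Polynomial ℝ} (hP : P.natDegree ≤ q) :
    ∀ᶠ X : ℕ in atTop, ∀ X' : ℕ, X < X' → X' ≤ 2 * X → ∀ ξ : ℝ,
      ‖∑ n ∈ (Finset.Ioc X X').filter Nat.Prime, (((ph 1 n)⁻¹ * (φ ((n + 1 : ℕ) : ℝ) - φ n +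
        (Int.fract (-φ ((n + 1 : ℕ) : ℝ)) - Int.fract (-φ n))) - 1 : ℝ) : ℂ) *
        ((Real.log n : ℂ) * e (ξ * P.eval (n : ℝ)))‖ ≤ (X : ℝ) ^ (1 - χ - 2 * η) := by
  have hc₂ : 0 < c₂ := D.c₁_pos.trans_le D.c₁_le
  have h2q : (2 : ℝ) ≤ 2 ^ q := by
    calc (2 : ℝ) = 2 ^ 1 := by norm_num
      _ ≤ 2 ^ q := pow_le_pow_right₀ (by norm_num) hq
  have hsmall : 6 * a + 13 * χ + 72 * η ≤ 1 / 2 := by nlinarith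
  filter_upwards [eventually_norm_sawtoothSum_le hq ha hχ hη hcond D hP,
    tendsto_natCast_atTop_atTop.eventually (eventually_ge_atTop y₁),
    tendsto_natCast_atTop_atTop.eventually (eventually_ge_atTop (1 : ℝ)),
    tendsto_natCast_atTop_atTop.eventually (D.deriv_lower η hη),
    tendsto_natCast_atTop_atTop.eventually (eventually_const_le_rpow 3 hη),
    tendsto_natCast_atTop_atTop.eventually
      (eventually_log_pow_le_rpow (4 * c₂) (by positivity) 1 hη)] with X hS f1 f2 f3 f4 f5
  intro X' hXX' hX' ξ
  specialize hS X' hXX' hX' ξ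
  rw [pow_one] at f5
  set x : ℝ := (X : ℝ) with hx
  have hx0 : 0 < x := by linarith
  have hmono : ∀ {u v : ℝ}, u ≤ v → x ^ u ≤ x ^ v := fun h => Real.rpow_le_rpow_of_exponent_le f2 h
  set ℓ := 1 + Real.log (2 * x) with hℓ
  have hlog0 := Real.log_nonneg (show 1 ≤ 2 * x by linarith)
  have hX'x : (X' : ℝ) ≤ 2 * x := by rw [hx]; exact_mod_cast hX'
  have hge : ∀ n : ℕ, X < n → y₁ ≤ (n : ℝ) := fun n hn => by
    have : x ≤ n := by rw [hx]; exact_mod_cast hn.le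
    linarith
  set f : ℕ → ℝ := fun n => Int.fract (-φ ((n + 1 : ℕ) : ℝ)) - Int.fract (-φ n) with hf
  have hf1 : ∀ n, |f n| ≤ 1 := fun n => by
    have h1 := Int.fract_nonneg (-φ ((n + 1 : ℕ) : ℝ))
    have h2 := Int.fract_nonneg (-φ n)
    have h3 := Int.fract_lt_one (-φ ((n + 1 : ℕ) : ℝ))
    have h4 := Int.fract_lt_one (-φ n)
    rw [abs_le]
    constructor <;> simp only [hf] <;> linarith
  set t : ℕ → ℂ := fun n => (((ph 1 n)⁻¹ : ℝ) : ℂ) *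
    ((ArithmeticFunction.vonMangoldt n : ℂ) * e (ξ * P.eval (n : ℝ))) * ((f n : ℝ) : ℂ) with ht
  set r : ℕ → ℂ := fun n => (((ph 1 n)⁻¹ * (φ ((n + 1 : ℕ) : ℝ) - φ n) - 1 : ℝ) : ℂ) *
    ((Real.log n : ℂ) * e (ξ * P.eval (n : ℝ))) with hr
  -- The smooth part r is O(log n / n) per term. The sawtooth part over primes is the sum over Λ
  -- less the prime powers, of which there are so few that they contribute about x^(a+1/2).
  have hsplit : ∑ n ∈ (Finset.Ioc X X').filter Nat.Prime, (((ph 1 n)⁻¹ *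
      (φ ((n + 1 : ℕ) : ℝ) - φ n + f n) - 1 : ℝ) : ℂ) *
      ((Real.log n : ℂ) * e (ξ * P.eval (n : ℝ))) =
      ∑ n ∈ (Finset.Ioc X X').filter Nat.Prime, r n + (∑ n ∈ Finset.Ioc X X', t n -
        ∑ n ∈ (Finset.Ioc X X').filter (fun n => ¬ n.Prime), t n) := by
    rw [← Finset.sum_filter_add_sum_filter_not (Finset.Ioc X X') Nat.Prime t, add_sub_cancel_right,
      ← Finset.sum_add_distrib]
    refine Finset.sum_congr rfl fun n hn => ?_
    rw [Finset.mem_filter] at hn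
    simp only [hr, ht, ArithmeticFunction.vonMangoldt_apply_prime hn.2]
    push_cast
    ring
  have hlogn : ∀ n ∈ Finset.Ioc X X', 0 ≤ Real.log n ∧ Real.log n ≤ ℓ := fun n hn => by
    rw [Finset.mem_Ioc] at hn
    have h1 : (n : ℝ) ≤ 2 * x := by
      have : (n : ℝ) ≤ X' := by exact_mod_cast hn.2
      linarith
    have h2 : (0 : ℝ) < n := by exact_mod_cast (by omega : 0 < n)
    have := Real.log_le_log h2 h1
    exact ⟨Real.log_natCast_nonneg n, by linarith⟩
  have hrb : ‖∑ n ∈ (Finset.Ioc X X').filter Nat.Prime, r n‖ ≤ x ^ (1 - χ - 3 * η) := by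
    have h1 : ∀ n ∈ (Finset.Ioc X X').filter Nat.Prime, ‖r n‖ ≤ c₂ * ℓ / x := by
      intro n hn
      rw [Finset.mem_filter] at hn
      have h2 := Finset.mem_Ioc.1 hn.1
      have h3 := D.abs_sub_sub_le (hge n h2.1)
      have h4 := D.deriv_pos n (hge n h2.1)
      have h5 : x ≤ n := by rw [hx]; exact_mod_cast h2.1.le
      have h6 : |(ph 1 n)⁻¹ * (φ ((n + 1 : ℕ) : ℝ) - φ n) - 1| ≤ c₂ / x := by
        rw [show (ph 1 n)⁻¹ * (φ ((n + 1 : ℕ) : ℝ) - φ n) - 1 =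
          (ph 1 n)⁻¹ * (φ ((n : ℝ) + 1) - φ n - ph 1 n) by push_cast; field_simp, abs_mul,
          abs_of_pos (inv_pos.2 h4)]
        calc (ph 1 n)⁻¹ * |φ ((n : ℝ) + 1) - φ n - ph 1 n| ≤ (ph 1 n)⁻¹ * (c₂ * ph 1 n / n) := by
              gcongr
          _ = c₂ / n := by field_simp
          _ ≤ c₂ / x := by gcongr
      obtain ⟨h7, h8⟩ := hlogn n hn.1
      simp only [hr]
      rw [norm_mul, norm_mul, norm_e, mul_one, Complex.norm_real, Complex.norm_real,
        Real.norm_eq_abs, Real.norm_eq_abs, abs_of_nonneg h7]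
      calc _ ≤ c₂ / x * ℓ := by gcongr
        _ = _ := by ring
    refine (norm_sum_le_of_le _ h1).trans ?_
    rw [Finset.sum_const, nsmul_eq_mul]
    have h2 : (((Finset.Ioc X X').filter Nat.Prime).card : ℝ) ≤ x := by
      have h3 := Finset.card_filter_le (Finset.Ioc X X') Nat.Prime
      rw [Nat.card_Ioc] at h3
      rw [hx]
      exact_mod_cast h3.trans (by omega)
    calc _ ≤ x * (c₂ * ℓ / x) := by gcongr
      _ = c₂ * ℓ := by field_simp
      _ ≤ 4 * c₂ * ℓ := by nlinarith [mul_pos hc₂ (show 0 < ℓ by linarith)]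
      _ ≤ x ^ η := f5
      _ ≤ _ := hmono (by linarith)
  have htb : ‖∑ n ∈ (Finset.Ioc X X').filter (fun n => ¬ n.Prime), t n‖ ≤
      x ^ (1 - χ - 3 * η) := by
    have h1 : ∀ n ∈ (Finset.Ioc X X').filter (fun n => ¬ n.Prime),
        ‖t n‖ ≤ c₂ * x ^ (a + η) * ArithmeticFunction.vonMangoldt n := by
      intro n hn
      rw [Finset.mem_filter, Finset.mem_Ioc] at hn
      have h5 : x ≤ n := by rw [hx]; exact_mod_cast hn.1.1.le
      have h6 : (n : ℝ) ≤ 2 * x := by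
        have : (n : ℝ) ≤ X' := by exact_mod_cast hn.1.2
        linarith
      have hw : (ph 1 n)⁻¹ ≤ c₂ * x ^ (a + η) := by
        have h1 := D.deriv_double x f1 n h5 (by linarith)
        have h2 := D.deriv_pos n (hge n hn.1.1)
        have h3 : x ^ (-a - η) ≤ c₂ * ph 1 n := f3.trans h1
        rw [inv_le_iff_one_le_mul₀ h2]
        calc (1 : ℝ) = x ^ (a + η) * x ^ (-a - η) := by
              rw [← Real.rpow_add hx0, show a + η + (-a - η) = 0 by ring, Real.rpow_zero]
          _ ≤ x ^ (a + η) * (c₂ * ph 1 n) := by gcongr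
          _ = _ := by ring
      have hw0 : 0 < (ph 1 n)⁻¹ := inv_pos.2 (D.deriv_pos n (hge n hn.1.1))
      have hΛ : 0 ≤ ArithmeticFunction.vonMangoldt n := ArithmeticFunction.vonMangoldt_nonneg
      simp only [ht]
      rw [norm_mul, norm_mul, norm_mul, norm_e, mul_one, Complex.norm_real, Complex.norm_real,
        Complex.norm_real, Real.norm_eq_abs, Real.norm_eq_abs, Real.norm_eq_abs,
        abs_of_pos hw0, abs_of_nonneg hΛ]
      calc (ph 1 n)⁻¹ * ArithmeticFunction.vonMangoldt n * |f n|
          ≤ (c₂ * x ^ (a + η)) * ArithmeticFunction.vonMangoldt n * 1 := by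
            gcongr
            exact hf1 n
        _ = _ := mul_one _
    refine (norm_sum_le_of_le _ h1).trans ?_
    rw [← Finset.mul_sum]
    have h2 : ∑ n ∈ (Finset.Ioc X X').filter (fun n => ¬ n.Prime),
        ArithmeticFunction.vonMangoldt n ≤ 4 * √x * ℓ := by
      have h3 := Chebyshev.psi_sub_theta_eq_sum_not_prime (X' : ℝ)
      have h4 := Chebyshev.psi_sub_theta_le (show (1 : ℝ) ≤ X' by
        exact_mod_cast (by omega : 1 ≤ X'))
      rw [h3, Nat.floor_natCast] at h4
      have h5 : √(X' : ℝ) ≤ 2 * √x := by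
        refine Real.sqrt_le_iff.2 ⟨by positivity, ?_⟩
        rw [mul_pow, Real.sq_sqrt hx0.le]; linarith
      have h6 : Real.log X' ≤ ℓ := (hlogn X' (Finset.mem_Ioc.2 ⟨hXX', le_rfl⟩)).2
      have h7 : 0 ≤ Real.log X' := Real.log_natCast_nonneg X'
      calc _ ≤ ∑ n ∈ (Finset.Ioc 0 X').filter (fun n => ¬ n.Prime),
            ArithmeticFunction.vonMangoldt n := by
            refine Finset.sum_le_sum_of_subset_of_nonneg ?_
              fun n _ _ => ArithmeticFunction.vonMangoldt_nonneg
            exact Finset.filter_subset_filter _ (Finset.Ioc_subset_Ioc_left (Nat.zero_le X))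
        _ ≤ 2 * √(X' : ℝ) * Real.log X' := h4
        _ ≤ 2 * (2 * √x) * ℓ := by gcongr
        _ = _ := by ring
    calc _ ≤ c₂ * x ^ (a + η) * (4 * √x * ℓ) := by gcongr
      _ = (4 * c₂ * ℓ) * (x ^ (a + η) * x ^ (1 / 2 : ℝ)) := by rw [Real.sqrt_eq_rpow]; ring
      _ ≤ x ^ η * (x ^ (a + η) * x ^ (1 / 2 : ℝ)) := by gcongr
      _ = x ^ (η + (a + η + 1 / 2)) := by rw [← Real.rpow_add hx0, ← Real.rpow_add hx0]
      _ ≤ _ := hmono (by linarith)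
  rw [hsplit]
  calc _ ≤ x ^ (1 - χ - 3 * η) + (x ^ (1 - χ - 3 * η) + x ^ (1 - χ - 3 * η)) :=
        (norm_add_le _ _).trans (add_le_add hrb ((norm_sub_le _ _).trans (add_le_add hS htb)))
    _ = 3 * x ^ (1 - χ - 3 * η) := by ring
    _ ≤ x ^ η * x ^ (1 - χ - 3 * η) := by gcongr
    _ = x ^ (1 - χ - 2 * η) := by rw [← Real.rpow_add hx0]; congr 1; ring

end blocks

end ThinPrimes
end

noncomputable section
open Filter Topology
namespace ThinPrimes

/-- A family of sequences whose increments over dyadic blocks are `O(X ^ β)` is `O(N ^ β)`. -/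
lemma exists_norm_le_of_dyadic {ι : Type*} {F : ι → ℕ → ℂ} {β : ℝ} (hβ : 0 < β) {X₀ : ℕ}
    (hblock : ∀ X, X₀ ≤ X → ∀ X', X < X' → X' ≤ 2 * X → ∀ i, ‖F i X' - F i X‖ ≤ (X : ℝ) ^ β)
    (hB : ∀ N, ∃ B : ℝ, ∀ i, ‖F i N‖ ≤ B) :
    ∃ C : ℝ, 0 < C ∧ ∀ N : ℕ, 1 ≤ N → ∀ i, ‖F i N‖ ≤ C * (N : ℝ) ^ β := by
  choose B hB using hB
  set ρ : ℝ := (2 / 3) ^ β with hρ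
  have hρ1 : ρ < 1 := Real.rpow_lt_one (by norm_num) (by norm_num) hβ
  have hρ0 : 0 < ρ := by positivity
  set S := ∑ N ∈ Finset.range (2 * X₀ + 4), |B N| with hS
  have hS0 : 0 ≤ S := Finset.sum_nonneg fun _ _ => abs_nonneg _
  have hinv : 0 < 1 / (1 - ρ) := by
    have : 0 < 1 - ρ := by linarith
    positivity
  -- S covers the initial values of N. The other summand makes (C + 1)ρ ≤ C, so one halving step
  -- reproduces the bound.
  set C := S + 1 / (1 - ρ) with hC
  have hCρ : (C + 1) * ρ ≤ C := by
    have h1 : (1 / (1 - ρ)) * (1 - ρ) = 1 := one_div_mul_cancel (by linarith)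
    have h2 : 0 ≤ S * (1 - ρ) := mul_nonneg hS0 (by linarith)
    rw [hC]; nlinarith
  refine ⟨C, by positivity, fun N => ?_⟩
  induction N using Nat.strong_induction_on with
  | _ N ih =>
    intro hN i
    have hN1 : (1 : ℝ) ≤ N := by exact_mod_cast hN
    rcases lt_or_ge N (2 * X₀ + 4) with h | h
    · have h1 : |B N| ≤ S := Finset.single_le_sum (f := fun N => |B N|)
        (fun _ _ => abs_nonneg _) (Finset.mem_range.2 h)
      have h2 : 1 ≤ (N : ℝ) ^ β := Real.one_le_rpow hN1 hβ.le
      calc ‖F i N‖ ≤ |B N| := (hB N i).trans (le_abs_self _)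
        _ ≤ C * 1 := by linarith
        _ ≤ _ := by gcongr
    -- Rounding up gives N ≤ 2X, and N ≥ 4 still ensures X ≤ 2N/3, hence the ratio (2/3)^β.
    · set X := (N + 1) / 2 with hX
      have h1 := ih X (by omega) (by omega) i
      have h2 := hblock X (by omega) N (by omega) (by omega) i
      have h3 : (X : ℝ) ≤ 2 / 3 * N := by
        have : 3 * X ≤ 2 * N := by omega
        have : (3 : ℝ) * X ≤ 2 * N := by exact_mod_cast this
        linarith
      calc ‖F i N‖ = ‖F i X + (F i N - F i X)‖ := by rw [add_sub_cancel]
        _ ≤ C * (X : ℝ) ^ β + (X : ℝ) ^ β := (norm_add_le _ _).trans (add_le_add h1 h2)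
        _ = (C + 1) * (X : ℝ) ^ β := by ring
        _ ≤ (C + 1) * (2 / 3 * N) ^ β := by gcongr
        _ = ((C + 1) * ρ) * (N : ℝ) ^ β := by
          rw [Real.mul_rpow (by norm_num) (by positivity)]; ring
        _ ≤ _ := by gcongr

/-! ### Detection of 𝐏_h and assembly of the dyadic blocks. -/

open Classical in
-- The right side is ⌈v⌉ - ⌈u⌉, the number of integers in [u, v), which is 0 or 1 since v - u < 1.
lemma indicator_exists_natCast_eq {u v : ℝ} (hu : 0 ≤ u) (huv : u ≤ v) (hv : v - u < 1) :
    (if ∃ n : ℕ, u ≤ n ∧ (n : ℝ) < v then 1 else 0 : ℝ) =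
      v - u + (Int.fract (-v) - Int.fract (-u)) := by
  have hk : (0 : ℤ) ≤ ⌈u⌉ := Int.ceil_nonneg hu
  obtain ⟨k, hk⟩ := Int.eq_ofNat_of_zero_le hk
  have h1 : u ≤ k := by
    have := Int.le_ceil u
    rw [hk] at this
    exact_mod_cast this
  have h2 : (k : ℝ) < u + 1 := by
    have := Int.ceil_lt_add_one u
    rw [hk] at this
    exact_mod_cast this
  have hfu : ⌊-u⌋ = -(k : ℤ) := by
    rw [Int.floor_eq_iff]; push_cast; constructor <;> linarith
  have hiff : (∃ n : ℕ, u ≤ n ∧ (n : ℝ) < v) ↔ (k : ℝ) < v := by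
    refine ⟨fun ⟨n, hn, hn'⟩ => lt_of_le_of_lt ?_ hn', fun h => ⟨k, h1, h⟩⟩
    have : (k : ℝ) < n + 1 := by linarith
    have : k < n + 1 := by exact_mod_cast this
    exact_mod_cast Nat.lt_succ_iff.1 this
  rw [Int.fract, Int.fract, hfu]
  split_ifs with h
  · rw [hiff] at h
    have hfv : ⌊-v⌋ = -(k : ℤ) - 1 := by
      rw [Int.floor_eq_iff]; push_cast; constructor <;> linarith
    rw [hfv]; push_cast; ring
  · rw [hiff, not_lt] at h
    have hfv : ⌊-v⌋ = -(k : ℤ) := by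
      rw [Int.floor_eq_iff]; push_cast; constructor <;> linarith
    rw [hfv]; push_cast; ring

/-- Monotonicity of h turns p ≤ h(n) < p + 1 into a condition on n. -/
lemma mem_primesOf_iff {c x₀ : ℝ} {h φ : ℝ → ℝ} (hh : MemF c x₀ h) (hφ : IsInverse x₀ h φ) {p : ℕ}
    (hp : p.Prime) (hxp : h x₀ ≤ p) :
    p ∈ primesOf x₀ h ↔ ∃ n : ℕ, φ p ≤ n ∧ (n : ℝ) < φ ((p + 1 : ℕ) : ℝ) := by
  have hp1 : (p : ℝ) ∈ Set.Ici (h x₀) := hxp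
  have hp2 : ((p + 1 : ℕ) : ℝ) ∈ Set.Ici (h x₀) := by
    push_cast
    exact Set.mem_Ici.2 (by linarith)
  have hx : ∀ n : ℕ, x₀ ≤ (n : ℝ) → ((p : ℤ) = ⌊h n⌋ ↔
      φ p ≤ n ∧ (n : ℝ) < φ ((p + 1 : ℕ) : ℝ)) := by
    intro n hn
    have h1 := hh.strictMonoOn.le_iff_le (hφ.1 hp1) (show (n : ℝ) ∈ Set.Ici x₀ from hn)
    have h2 := hh.strictMonoOn.lt_iff_lt (show (n : ℝ) ∈ Set.Ici x₀ from hn) (hφ.1 hp2)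
    rw [hφ.2.2 hp1] at h1
    rw [hφ.2.2 hp2] at h2
    rw [← h1, ← h2, eq_comm, Int.floor_eq_iff]
    push_cast
    rfl
  constructor
  · rintro ⟨-, n, hn, h1⟩
    exact ⟨n, (hx n hn).1 h1⟩
  · rintro ⟨n, h1⟩
    have hn : x₀ ≤ (n : ℝ) := le_trans (hφ.1 hp1) h1.1
    exact ⟨hp, n, hn, (hx n hn).2 h1⟩

open Classical in
/-- The difference of the two prime sums as a single sum. -/
lemma thinSum_sub_primeSum (x₀ : ℝ) (h φ : ℝ → ℝ) (W : ℤ → ℤ) (N : ℕ) (ξ : ℝ) :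
    thinSum x₀ h φ W N ξ - primeSum W N ξ = ∑ p ∈ (Finset.Ioc 0 N).filter Nat.Prime,
      (((derivWithin φ (Set.Ici (h x₀)) (p : ℝ))⁻¹ *
        (if p ∈ primesOf x₀ h ∧ h x₀ ≤ (p : ℝ) then 1 else 0) - 1 : ℝ) : ℂ) *
        ((Real.log p : ℂ) * e (ξ * (W p : ℝ))) := by
  have h1 : (Finset.Icc 1 N).filter (fun p : ℕ => p ∈ primesOf x₀ h ∧ h x₀ ≤ (p : ℝ)) =
      ((Finset.Ioc 0 N).filter Nat.Prime).filter
        (fun p : ℕ => p ∈ primesOf x₀ h ∧ h x₀ ≤ (p : ℝ)) := by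
    rw [Finset.filter_filter]
    ext p
    simp only [Finset.mem_filter, Finset.mem_Icc, Finset.mem_Ioc, Nat.succ_le_iff]
    exact ⟨fun hp => ⟨hp.1, hp.2.1.1, hp.2⟩, fun hp => ⟨hp.1, hp.2.2⟩⟩
  have h2 : Finset.Icc 1 N = Finset.Ioc 0 N := by
    ext p
    simp [Nat.succ_le_iff]
  rw [thinSum, primeSum, h1, h2, Finset.sum_filter, ← Finset.sum_sub_distrib]
  refine Finset.sum_congr rfl fun p _ => ?_
  split_ifs <;> push_cast <;> ring

theorem exists_norm_thinSum_sub_primeSum_le {q : ℕ} (hq : 1 ≤ q) {W : ℤ → ℤ}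
    (hW : IsIntPolynomial W q) {c x₀ : ℝ} {h φ : ℝ → ℝ} (hh : MemF c x₀ h)
    (hφ : IsInverse x₀ h φ) {χ : ℝ} (hχ : 0 < χ)
    (hcond : (2 ^ q + 1) * (2 * ((1 - c⁻¹) + 2 * χ)) + χ < 1 / 2) :
    ∃ χ' : ℝ, 0 < χ' ∧ ∃ C : ℝ, 0 < C ∧ ∀ N : ℕ, 1 ≤ N → ∀ ξ : ℝ,
      ‖thinSum x₀ h φ W N ξ - primeSum W N ξ‖ ≤ C * (N : ℝ) ^ (1 - χ - χ') := by
  classical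
  obtain ⟨ph, Φ, c₁, c₂, s, y₁, D⟩ := hh.exists_inverseData hq hφ
  have ha : 0 ≤ 1 - c⁻¹ := sub_nonneg.2 (inv_le_one_of_one_le₀ hh.one_le_c)
  set a := 1 - c⁻¹ with hadef
  obtain ⟨P, hPdeg, hPW⟩ := hW
  set Q : Polynomial ℝ := P.map (algebraMap ℚ ℝ) with hQ
  have hQdeg : Q.natDegree ≤ q :=
    Polynomial.natDegree_map_le.trans (Polynomial.natDegree_le_of_degree_le hPdeg.le)
  have hQW : ∀ n : ℕ, Q.eval (n : ℝ) = (W n : ℝ) := fun n => by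
    have h1 := Polynomial.eval₂_at_apply (p := P) (algebraMap ℚ ℝ) (n : ℚ)
    have h2 := hPW n
    rw [Int.cast_natCast] at h2
    rw [h2, ← Polynomial.eval_map, map_natCast] at h1
    rw [hQ, h1]
    simp
  -- The choice for which the condition of the block estimate holds with equality.
  set η := (1 / 2 - ((2 ^ q + 1) * (2 * (a + 2 * χ)) + χ)) / (24 * (2 ^ q + 1) + 8) with hη
  have hη0 : 0 < η := div_pos (by linarith) (by positivity)
  have hη' : (2 ^ q + 1) * (2 * (a + 2 * χ) + 24 * η) + χ + 8 * η ≤ 1 / 2 := by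
    have h1 : η * (24 * (2 ^ q + 1) + 8) = 1 / 2 - ((2 ^ q + 1) * (2 * (a + 2 * χ)) + χ) :=
      div_mul_cancel₀ _ (by positivity)
    linarith
  have h2q : (1 : ℝ) ≤ 2 ^ q := one_le_pow₀ (by norm_num)
  have hβ : 0 < 1 - χ - 2 * η := by nlinarith
  -- Besides the block estimate, n must lie in the domain of φ, and φ' < 1 is needed so that [φ(n),
  -- φ(n+1)) is shorter than 1.
  have hev := (eventually_norm_primeBlock_le hq ha hχ hη0 hη' D hQdeg).and
    ((tendsto_natCast_atTop_atTop.eventually (eventually_ge_atTop y₁)).and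
    ((tendsto_natCast_atTop_atTop.eventually (eventually_ge_atTop (h x₀))).and
    (tendsto_natCast_atTop_atTop.eventually (D.deriv_zero.eventually (gt_mem_nhds one_pos)))))
  obtain ⟨X₀, hX₀⟩ := eventually_atTop.1 hev
  refine ⟨2 * η, by positivity, exists_norm_le_of_dyadic
    (F := fun (ξ : ℝ) N => thinSum x₀ h φ W N ξ - primeSum W N ξ) hβ (X₀ := X₀) ?_ ?_⟩
  · intro X hX X' hXX' hX' ξ
    have hblock := (hX₀ X hX).1 X' hXX' hX' ξ
    refine le_trans (le_of_eq (congrArg _ ?_)) hblock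
    simp only [thinSum_sub_primeSum, Finset.sum_filter]
    rw [← Finset.sum_Ioc_consecutive _ (Nat.zero_le X) hXX'.le, add_sub_cancel_left]
    refine Finset.sum_congr rfl fun n hn => ?_
    by_cases hnp : n.Prime
    · rw [if_pos hnp, if_pos hnp, hQW n]
      obtain ⟨-, h1, h2, h3⟩ := hX₀ n (hX.trans (Finset.mem_Ioc.1 hn).1.le)
      have h4 := D.deriv 0 (by omega) n h1
      rw [D.zero] at h4
      rw [h4.hasDerivWithinAt.derivWithin (uniqueDiffOn_Ici (h x₀) n h2)]
      obtain ⟨ζ, h5, -, h6⟩ := D.exists_sub_eq h1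
      rw [← Nat.cast_add_one] at h6
      have h7 := D.deriv_pos ζ (h1.trans h5)
      have h8 := D.deriv_anti h1 (h1.trans h5) h5
      have h9 : 0 ≤ φ n := le_trans (by linarith [hh.one_le_x₀]) (hφ.1 (show (n : ℝ) ∈ _ from h2))
      rw [← indicator_exists_natCast_eq h9 (by linarith) (by linarith),
        ← mem_primesOf_iff hh hφ hnp h2]
      simp only [h2, and_true]
    · rw [if_neg hnp, if_neg hnp]
  · intro N
    refine ⟨∑ p ∈ (Finset.Ioc 0 N).filter Nat.Prime, |((derivWithin φ (Set.Ici (h x₀)) (p : ℝ))⁻¹ *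
        (if p ∈ primesOf x₀ h ∧ h x₀ ≤ (p : ℝ) then 1 else 0) - 1)| * |Real.log p|, fun ξ => ?_⟩
    rw [thinSum_sub_primeSum]
    refine norm_sum_le_of_le _ fun p _ => le_of_eq ?_
    rw [norm_mul, norm_mul, norm_e, mul_one, Complex.norm_real, Complex.norm_real,
      Real.norm_eq_abs, Real.norm_eq_abs]

end ThinPrimes
end

theorem lemma4p1 (q : ℕ) (hq : 1 ≤ q) (W : ℤ → ℤ) (hW : ThinPrimes.IsIntPolynomial W q)
    (c : ℝ) (hc₁ : 1 ≤ c) (hc₂ : c < ThinPrimes.cBound q)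
    (x₀ : ℝ) (h : ℝ → ℝ) (hh : ThinPrimes.MemF c x₀ h)
    (φ : ℝ → ℝ) (hφ : ThinPrimes.IsInverse x₀ h φ)
    (γ : ℝ) (hγ : γ = 1 / c) (χ : ℝ) (hχ₀ : 0 < χ)
    (hχ : ((2 : ℝ) ^ (2 * q + 2) + 2 ^ q - 2) * (1 - γ)
      + 2 ^ q * ((2 : ℝ) ^ (q + 3) - 2) * χ < 1) :
    ∃ χ' : ℝ, 0 < χ' ∧ ∃ C : ℝ, 0 < C ∧
      ∀ N : ℕ, 1 ≤ N → ∀ ξ : ℝ, 0 ≤ ξ → ξ ≤ 1 →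
        ‖ThinPrimes.thinSum x₀ h φ W N ξ - ThinPrimes.primeSum W N ξ‖
          ≤ C * (N : ℝ) ^ (1 - χ - χ') := by
  have hcond : ((2 : ℝ) ^ q + 1) * (2 * ((1 - c⁻¹) + 2 * χ)) + χ < 1 / 2 := by
    have ht : (2 : ℝ) ≤ 2 ^ q := by
      calc (2 : ℝ) = 2 ^ 1 := by norm_num
        _ ≤ 2 ^ q := pow_le_pow_right₀ (by norm_num) hq
    have ha : 0 ≤ 1 - c⁻¹ := sub_nonneg.2 (inv_le_one_of_one_le₀ hc₁)
    rw [hγ, one_div, show (2 : ℝ) ^ (2 * q + 2) = 4 * (2 ^ q) ^ 2 by ring,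
      show (2 : ℝ) ^ (q + 3) = 8 * 2 ^ q by ring] at hχ
    generalize (2 : ℝ) ^ q = t at ht hχ ⊢
    generalize 1 - c⁻¹ = a at ha hχ ⊢
    -- With t = 2^q, twice the required inequality reads (4t + 4)a + (8t + 10)χ < 1. Since t ≥ 2,
    -- both coefficients are dominated by those of the hypothesis; this uses q ≥ 1.
    have h1 : (4 * t + 4) * a ≤ (4 * t ^ 2 + t - 2) * a :=
      mul_le_mul_of_nonneg_right (by nlinarith) ha
    have h2 : (8 * t + 10) * χ ≤ t * (8 * t - 2) * χ :=
      mul_le_mul_of_nonneg_right (by nlinarith) hχ₀.le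
    linarith
  obtain ⟨χ', h1, C, h2, h3⟩ :=
    ThinPrimes.exists_norm_thinSum_sub_primeSum_le hq hW hh hφ hχ₀ hcond
  exact ⟨χ', h1, C, h2, fun N hN ξ _ _ => h3 N hN ξ⟩
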